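/- Let $X=(X_t)_{t\ge 0}$ be the continuous-time simple random walk on $\mathbb{Z}$ with jump rate one, started at $x$ under $P_x$ (expectation $E_x$), and let $H_y=\inf\{t\ge 0: X_t=y\}$. For $\gamma,\eta\le 0$ and $x\le y$ let $$P^{\gamma,\eta}_{x,y}(A)=\frac{E_x\big[\exp\big(\int_0^{H_y}(\gamma+\eta)\,ds\big);A\big]}{E_x\big[\exp\big(\int_0^{H_y}(\gamma+\eta)\,ds\big)\big]},\qquad A\in\sigma\big((X_{t\wedge H_y})_{t\ge 0}\big),$$ let the tilted measure $P^{\gamma,\eta}_x$ (expectation $E_x^{\gamma,\eta}$) be the law of the walk that extends the consistent family $(P^{\gamma,\eta}_{x,y})_{y\ge x}$, and let $v^{\gamma,\eta}=1/E^{\gamma,\eta}_0[H_1]$ (with $1/\infty=0$) be the speed of $X$ under $P_0^{\gamma,\eta}$. Then for all $\gamma,\eta\le 0$ $$v^{\gamma,\eta}=\sqrt{(\gamma+\eta)(\gamma+\eta-2)}.$$ Moreover, let $\xi=(\xi(x))_{x\in\mathbb{Z}}$ be i.i.d. random variables with law $\mathbb{P}$ such that $0<\mathbf{ei}:=\operatorname{ess\,inf}\xi(0)<\operatorname{ess\,sup}\xi(0)=:\mathbf{es}<\infty$.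 Given $\xi$, consider the branching random walk started from one particle at $0$, in which every particle performs a continuous-time simple random walk on $\mathbb{Z}$ with jump rate one and, independently, splits into two particles at rate $\xi(z)$ while at $z$, all particles evolving independently. Let $N(t,y)$ be the number of particles at $y$ at time $t$, and $\mathtt{E}_0^\xi$ the expectation given $\xi$. Let $\lambda:\mathbb{R}\to\mathbb{R}$ be the (non-random) Lyapunov exponent, that is, for every $v\in\mathbb R$, $$\lambda(v)=\lim_{t\to\infty}\frac1t\log \mathtt{E}_0^\xi[N(t,\lfloor vt\rfloor)]\qquad \mathbb{P}\text{-a.s.},$$ and let the critical speed $v_c\in(0,\infty)$ be the unique number such that $\lambda$ is linear (i.e. affine) on $[0,v_c]$ and strictly concave on $(v_c,\infty)$. With $\triangle=\mathbf{es}-\mathbf{ei}$, $$v_c\le\sqrt{\triangle(2+\triangle)}<\sqrt{\mathbf{es}(2+\mathbf{es})}<\mathbf{es}+1.$$ -/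

import Mathlib

open MeasureTheory ProbabilityTheory Filter Topology Set
open scoped ENNReal NNReal

noncomputable section

namespace BRWRE

/-! ### Continuous-time simple random walk on `ℤ` with jump rate one -/

/-- A fair coin. -/
def fairCoin : Measure Bool := (PMF.uniformOfFintype Bool).toMeasure

/-- The displacement encoded by a coin: `+1` or `-1`. -/
def step (b : Bool) : ℤ := if b then 1 else -1

/-- Driving data of a walk: the sequence of its holding times and of its directions, where the
holding times are positive and have infinite sum. These are in bijection with the step functions
`[0,∞) → ℤ` started at `0` that make infinitely many jumps, all of them `±1`. -/
def WalkSpace : Type :=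
  {ω : ℕ → ℝ × Bool // (∀ i, 0 < (ω i).1) ∧
    Tendsto (fun n : ℕ => ∑ i ∈ Finset.range n, (ω i).1) atTop atTop}

instance : MeasurableSpace WalkSpace := Subtype.instMeasurableSpace

/-- The law of the driving data of the rate one simple random walk: i.i.d. holding times with law
`Exp(1)` and, independently, i.i.d. fair directions. (The restriction to `WalkSpace` only removes
a null set.) -/
def walkMeasure : Measure WalkSpace :=
  Measure.comap (fun ω : WalkSpace => ω.1)
    (Measure.infinitePi (fun _ : ℕ => (expMeasure 1).prod fairCoin))

/-- The number of jumps up to time `t`: the number of `n` such that the `n`-th jump time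
`e₀ + ⋯ + eₙ` is at most `t`. -/
def jumpCount (ω : WalkSpace) (t : ℝ) : ℕ :=
  {n : ℕ | ∑ i ∈ Finset.range (n + 1), (ω.1 i).1 ≤ t}.ncard

/-- The walk `X_t` started at `x`. Under `walkMeasure`, it has the law `P_x`. -/
def walk (x : ℤ) (ω : WalkSpace) (t : ℝ) : ℤ :=
  x + ∑ i ∈ Finset.range (jumpCount ω t), step (ω.1 i).2

/-- The hitting time `H_y = inf {t ≥ 0 : X_t = y} ∈ [0,∞]` of the walk started at `x`. -/
def hit (x y : ℤ) (ω : WalkSpace) : ℝ≥0∞ :=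
  ⨅ (t : ℝ≥0) (_ : walk x ω t = y), (t : ℝ≥0∞)

/-! ### The tilted measures -/

/-- The weight `exp (∫_0^{H_y} (ζ(X_s) + η) ds)`, for the walk started at `x`.
(`H_y` is almost surely finite.) -/
def weight (x y : ℤ) (ζ : ℤ → ℝ) (η : ℝ) (ω : WalkSpace) : ℝ≥0∞ :=
  ENNReal.ofReal (Real.exp (∫ s in (0 : ℝ)..(hit x y ω).toReal, (ζ (walk x ω s) + η)))

/-- The normalizing constant `Z_{x,y}^{ζ,η}`. -/
def partitionFunction (x y : ℤ) (ζ : ℤ → ℝ) (η : ℝ) : ℝ≥0∞ :=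
  ∫⁻ ω, weight x y ζ η ω ∂walkMeasure

/-- The stopped `σ`-algebra `σ((X_{t ∧ H_y})_{t ≥ 0})`. -/
abbrev stoppedSigma (x y : ℤ) : MeasurableSpace WalkSpace :=
  ⨆ t : ℝ≥0, MeasurableSpace.comap
    (fun ω : WalkSpace => walk x ω (min (t : ℝ≥0∞) (hit x y ω)).toReal) ⊤

/-- `Q` extends the family `(P_{x,y}^{ζ,η})_{y ≥ x}`, where
`P_{x,y}^{ζ,η}(A) = E_x[exp (∫_0^{H_y} (ζ(X_s) + η) ds); A] / Z_{x,y}^{ζ,η}` for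
`A ∈ σ((X_{t ∧ H_y})_{t ≥ 0})`. -/
def IsTiltedLaw (x : ℤ) (ζ : ℤ → ℝ) (η : ℝ) (Q : Measure WalkSpace) : Prop :=
  ∀ y : ℤ, x ≤ y → ∀ A : Set WalkSpace, MeasurableSet[stoppedSigma x y] A →
    Q A = (partitionFunction x y ζ η)⁻¹ * ∫⁻ ω in A, weight x y ζ η ω ∂walkMeasure

open Classical in
/-- The tilted measure `P_x^{ζ,η}`: the law of the walk that extends the consistent family
`(P_{x,y}^{ζ,η})_{y ≥ x}`. (If there were no extension, this would be the zero measure, and the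
speed below would be `∞`.) -/
def tiltedLaw (x : ℤ) (ζ : ℤ → ℝ) (η : ℝ) : Measure WalkSpace :=
  if h : ∃ Q, IsTiltedLaw x ζ η Q then h.choose else 0

/-- The speed `v^{γ,η} = 1 / E_0^{γ,η}[H_1]` under the tilted measure with constant potential
`γ`, as an element of `[0,∞]` with `1/∞ = 0`. -/
def tiltedSpeed (γ η : ℝ) : ℝ≥0∞ :=
  (∫⁻ ω, hit 0 1 ω ∂(tiltedLaw 0 (fun _ => γ) η))⁻¹

/-! ### Branching random walk in the environment `ξ : ℤ → ℝ`

A particle located at `z` waits for the first of two independent events: a jump, which comes at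
rate one and moves it to a uniformly chosen neighbour, and a branching, which comes at rate `ξ z`
and replaces it by two particles at `z`. After the event, the particles involved start afresh
and evolve independently of each other.

A label `u : List Bool` describes a line of descent, from the root on: every letter stands for one
event. A branching of `u` produces `u ++ [false]` and `u ++ [true]`; after a jump, the particle
continues under the label `u ++ [false]`, and `u ++ [true]` is not used. -/

/-- The data of a label: a unit rate exponential time for the jump, one for the branching (to be
divided by the branching rate), and the direction of the jump. -/
abbrev Clocks : Type := ℝ × ℝ × Bool

/-- Independent data for all labels. -/
def branchingMeasure : Measure (List Bool → Clocks) :=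
  Measure.infinitePi
    (fun _ : List Bool => (expMeasure 1).prod ((expMeasure 1).prod fairCoin))

/-- At `z`, branching comes before the jump. -/
def Branches (ξ : ℤ → ℝ) (z : ℤ) (c : Clocks) : Prop := c.2.1 < ξ z * c.1

open Classical in
/-- The time until the first event at `z`. -/
def eventTime (ξ : ℤ → ℝ) (z : ℤ) (c : Clocks) : ℝ :=
  if Branches ξ z c then c.2.1 / ξ z else c.1

open Classical in
/-- The position after the first event at `z`. -/
def nextSite (ξ : ℤ → ℝ) (z : ℤ) (c : Clocks) : ℤ :=
  if Branches ξ z c then z else z + step c.2.2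

/-- In the process with data `ω` started from one particle at `z`, the label `u` is in use at time
`t`, for a particle located at `y`. -/
def Occupies (ξ : ℤ → ℝ) (y : ℤ) : List Bool → (List Bool → Clocks) → ℤ → ℝ → Prop
  | [], ω, z, t => 0 ≤ t ∧ t < eventTime ξ z (ω []) ∧ z = y
  | i :: u, ω, z, t =>
      eventTime ξ z (ω []) ≤ t ∧ (i = false ∨ Branches ξ z (ω [])) ∧
        Occupies ξ y u (fun w => ω (i :: w)) (nextSite ξ z (ω [])) (t - eventTime ξ z (ω []))

/-- `N(t,y)`: the number of particles at `y` at time `t`, in the process started at `x`. -/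
def particleCount (ξ : ℤ → ℝ) (x : ℤ) (t : ℝ) (y : ℤ) (ω : List Bool → Clocks) : ℕ∞ :=
  {u : List Bool | Occupies ξ y u ω x t}.encard

/-- The quenched expectation of `N(t,y)`, for the process started at `x`. -/
def expectedCount (ξ : ℤ → ℝ) (x : ℤ) (t : ℝ) (y : ℤ) : ℝ≥0∞ :=
  ∫⁻ ω, (particleCount ξ x t y ω : ℝ≥0∞) ∂branchingMeasure

/-! ### The environment, the Lyapunov exponent and the critical speed -/

/-- The random environment `ξ` is an i.i.d. family of random variables whose essential infimum
`ei` and essential supremum `es` satisfy `0 < ei < es < ∞`. -/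
structure IsEnvironment {Ω : Type*} [MeasurableSpace Ω] (P : Measure Ω) (ξ : ℤ → Ω → ℝ)
    (ei es : ℝ) : Prop where
  isProbabilityMeasure : IsProbabilityMeasure P
  measurable : ∀ x, Measurable (ξ x)
  indep : iIndepFun ξ P
  identDistrib : ∀ x, IdentDistrib (ξ x) (ξ 0) P P
  essInf_eq : essInf (fun ω => (ξ 0 ω : EReal)) P = (ei : EReal)
  essSup_eq : essSup (fun ω => (ξ 0 ω : EReal)) P = (es : EReal)
  ei_pos : 0 < ei
  ei_lt_es : ei < es

/-- `lam : ℝ → ℝ` is the quenched Lyapunov exponent: for every `v`, almost surely,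
`lam v = lim_{t → ∞} (1/t) log E_0^ξ[N(t,⌊vt⌋)]`. -/
def IsLyapunovExponent {Ω : Type*} [MeasurableSpace Ω] (P : Measure Ω) (ξ : ℤ → Ω → ℝ)
    (lam : ℝ → ℝ) : Prop :=
  ∀ v : ℝ, ∀ᵐ ω ∂P, Tendsto
    (fun t : ℝ => (1 / t) * Real.log (expectedCount (fun z => ξ z ω) 0 t ⌊v * t⌋).toReal)
    atTop (𝓝 (lam v))

/-- `vc ∈ (0,∞)` is the critical speed of `lam`: the function `lam` is linear (that is, affine) on
`[0,vc]` and strictly concave on `(vc,∞)`. There is at most one such `vc`. -/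
def IsCriticalSpeed (lam : ℝ → ℝ) (vc : ℝ) : Prop :=
  0 < vc ∧ (∃ a b : ℝ, ∀ v ∈ Icc 0 vc, lam v = a + b * v) ∧ StrictConcaveOn ℝ (Ioi vc) lam

end BRWRE

end

namespace BRWRE

/-! ### Infinite products of a single probability measure -/

section Product

variable {α : Type*} [MeasurableSpace α] (ν : Measure α) [IsProbabilityMeasure ν]

/-! Speed of the tilted walk. Put `θ = 1 - (γ + η)` and let `φ` be the smaller root of `φ + 1/φ =
2θ`. A walk with rate `θ` and upward probability `p = 1/(2θφ)` has, after `n` steps, the density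
`exp ((1 - θ) Tₙ) φ ^ (-Xₙ)` with respect to simple random walk, `Tₙ` being the time of the `n`-th
jump and `Xₙ` the displacement. At the first visit to `y` this is the exponential weight times the
constant `φ ^ (-(y - x))`, so this drifted walk extends the tilted family (`isTiltedLaw_walkLaw`).
Its drift is `θ (2p - 1) = √(θ² - 1)`. First-step analysis gives the mean hitting time, which is
infinite without drift.

Critical speed. Write `K_t(x,y)` for the expected number of particles and `G_κ(x,y)` for its Laplace
transform in time. For `κ` above `a = λ(0)` it is finite and satisfies `2 (κ + 1 - ξ x) G(x) =
G(x+1) + G(x-1)` away from `y`. Hence the ratios `G(x)/G(x+1)`, for `x < y`, solve a Riccati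
recursion. Since `a ≤ es` and `ξ ≥ ei`, its coefficients are, for `κ` near `a`, at most about `2 (1
+ Δ)` with `Δ = es - ei`, so the ratios are bounded below by about the smaller root `ρ` of `ρ + 1/ρ
= 2 (1 + Δ)` (`smallRoot_le_riccati`). Raising `κ` by `δ` lowers each ratio by a factor at least `1
+ w`, with `w ≈ 2ρδ/(1 - ρ²) = δ/√(Δ(2+Δ))` (`riccati_ratio`), whence `(1 + w)ⁿ G_{κ+δ}(0,n) ≤
G_κ(0,n)` (`green_ratio`).

With `n ≈ vt`, the left side is at least of order `exp (-(κ+δ) t) K_t(0,n)`. If `v₀` is small, the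
right side is at most about `exp (-a t') K_{t'}(0,n)` with `t' = vt/v₀`: particles reaching `n`
early can have waited at the origin (`exists_green_le`). On the exponential scale this reads `v log
(1 + w) + λ(v) ≤ κ + δ + (v/v₀)(λ(v₀) - λ(0))` (`growth_rate_inequality`). For `v = vc` linearity of
`λ` cancels all its values but `λ(0)`, and `κ = λ(0) + δ²` leaves `vc log (1 + w) ≤ δ + δ²`. Letting
`δ → 0` gives `vc ≤ √(Δ(2+Δ))`. -/

theorem infinitePi_map_comp_injective {ι κ : Type*} {e : κ → ι} (he : Function.Injective e) :
    (Measure.infinitePi (fun _ : ι => ν)).map (fun ω k => ω (e k)) =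
      Measure.infinitePi (fun _ : κ => ν) := by
  classical
  refine Measure.eq_infinitePi _ fun s t ht => ?_
  have hm : Measurable (fun (ω : ι → α) k => ω (e k)) :=
    measurable_pi_lambda _ fun k => measurable_pi_apply _
  rw [Measure.map_apply hm (.pi s.countable_toSet fun i _ => ht i)]
  have hpre : (fun (ω : ι → α) k => ω (e k)) ⁻¹' ((s : Set κ).pi t) =
      ((s.map ⟨e, he⟩ : Finset ι) : Set ι).pi (Function.extend e t fun _ => univ) := by
    ext ω
    simp [Set.mem_pi, he.extend_apply]
  rw [hpre, Measure.infinitePi_pi]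
  · simp [he.extend_apply]
  · intro i hi
    obtain ⟨k, -, rfl⟩ := Finset.mem_map.1 hi
    simpa [he.extend_apply] using ht k

theorem prod_infinitePi_map_option {κ : Type*} :
    (ν.prod (Measure.infinitePi (fun _ : κ => ν))).map
        (fun p (o : Option κ) => o.elim p.1 p.2) =
      Measure.infinitePi (fun _ : Option κ => ν) := by
  classical
  refine Measure.eq_infinitePi _ fun s t ht => ?_
  have hm : Measurable (fun (p : α × (κ → α)) (o : Option κ) => o.elim p.1 p.2) := by
    refine measurable_pi_lambda _ fun o => ?_
    cases o with
    | none => exact measurable_fst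
    | some k => exact (measurable_pi_apply k).comp measurable_snd
  rw [Measure.map_apply hm (.pi s.countable_toSet fun i _ => ht i)]
  have hpre : (fun (p : α × (κ → α)) (o : Option κ) => o.elim p.1 p.2) ⁻¹' ((s : Set _).pi t) =
      (if none ∈ s then t none else univ) ×ˢ
        ((Finset.eraseNone s : Finset κ) : Set κ).pi (fun k => t (some k)) := by
    ext ⟨c, ω⟩
    simp only [mem_preimage, Set.mem_pi, Finset.mem_coe, mem_prod, Finset.mem_eraseNone]
    constructor
    · intro h
      refine ⟨?_, fun k hk => h _ hk⟩
      split_ifs with h0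
      · exact h _ h0
      · trivial
    · rintro ⟨h0, h1⟩ (_ | k) hk
      · simpa [hk] using h0
      · exact h1 k hk
  rw [hpre, Measure.prod_prod, Measure.infinitePi_pi _ fun k _ => ht _]
  have hprod : ∏ k ∈ Finset.eraseNone s, ν (t (some k)) =
      ∏ o ∈ s.erase none, ν (t o) := by
    rw [← Finset.map_some_eraseNone, Finset.prod_map]
    rfl
  rw [hprod]
  split_ifs with h0
  · rw [Finset.mul_prod_erase s (fun o => ν (t o)) h0]
  · rw [measure_univ, one_mul, Finset.erase_eq_of_notMem h0]

/-- Under an infinite product, one coordinate and the family of some others have the product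
law. -/
theorem infinitePi_map_prodMk {ι κ : Type*} (i : ι) {σ : κ → ι} (hσ : Function.Injective σ)
    (hi : ∀ k, σ k ≠ i) :
    (Measure.infinitePi (fun _ : ι => ν)).map (fun ω => (ω i, fun k => ω (σ k))) =
      ν.prod (Measure.infinitePi (fun _ : κ => ν)) := by
  have he : Function.Injective (fun o : Option κ => o.elim i σ) := by
    rintro (_ | a) (_ | b) h
    · rfl
    · exact absurd h.symm (hi b)
    · exact absurd h (hi a)
    · exact congrArg some (hσ h)
  have h1 := infinitePi_map_comp_injective ν he
  rw [← prod_infinitePi_map_option] at h1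
  have hm : Measurable (fun (w : Option κ → α) => (w none, fun k => w (some k))) := by fun_prop
  have h2 := congrArg (fun m => m.map
    (fun (w : Option κ → α) => (w none, fun k => w (some k)))) h1
  have hm1 : Measurable (fun (ω : ι → α) (o : Option κ) => ω (o.elim i σ)) :=
    measurable_pi_lambda _ fun k => measurable_pi_apply _
  have hm2 : Measurable (fun (p : α × (κ → α)) (o : Option κ) => o.elim p.1 p.2) := by
    refine measurable_pi_lambda _ fun o => ?_
    cases o with
    | none => exact measurable_fst
    | some k => exact (measurable_pi_apply k).comp measurable_snd
  rw [Measure.map_map hm hm1, Measure.map_map hm hm2] at h2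
  have h3 : ((fun (w : Option κ → α) => (w none, fun k => w (some k))) ∘
      fun (p : α × (κ → α)) (o : Option κ) => o.elim p.1 p.2) = id := by
    ext p <;> rfl
  rw [h3, Measure.map_id] at h2
  exact h2

theorem lintegral_infinitePi_prodMk {ι κ : Type*} (i : ι) {σ : κ → ι}
    (hσ : Function.Injective σ) (hi : ∀ k, σ k ≠ i) {f : α × (κ → α) → ℝ≥0∞}
    (hf : Measurable f) :
    ∫⁻ ω, f (ω i, fun k => ω (σ k)) ∂Measure.infinitePi (fun _ : ι => ν) =
      ∫⁻ c, ∫⁻ ω, f (c, ω) ∂Measure.infinitePi (fun _ : κ => ν) ∂ν := by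
  rw [← lintegral_prod _ hf.aemeasurable, ← infinitePi_map_prodMk ν i hσ hi,
    lintegral_map hf (by fun_prop)]

end Product

/-! ### Exponential laws and coins -/

theorem lintegral_expMeasure (r : ℝ) (f : ℝ → ℝ≥0∞) (hf : Measurable f) :
    ∫⁻ x, f x ∂expMeasure r =
      ∫⁻ x in Ioi 0, ENNReal.ofReal (r * Real.exp (-(r * x))) * f x := by
  have hE : expMeasure r = volume.withDensity (exponentialPDF r) := rfl
  have hmp : Measurable (exponentialPDF r) := (measurable_exponentialPDFReal r).ennreal_ofReal
  rw [hE, lintegral_withDensity_eq_lintegral_mul _ hmp hf,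
    ← setLIntegral_eq_of_support_subset (s := Ici 0), setLIntegral_congr Ioi_ae_eq_Ici.symm]
  · refine setLIntegral_congr_fun measurableSet_Ioi fun x hx => ?_
    simp only [Pi.mul_apply]
    rw [exponentialPDF_of_nonneg (le_of_lt hx)]
  · intro x hx
    by_contra h
    rw [mem_Ici, not_le] at h
    simp [exponentialPDF_of_neg h] at hx

instance : IsProbabilityMeasure (expMeasure 1) := isProbabilityMeasure_expMeasure one_pos

instance : IsProbabilityMeasure fairCoin := by unfold fairCoin; infer_instance

theorem lintegral_fairCoin (f : Bool → ℝ≥0∞) :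
    ∫⁻ b, f b ∂fairCoin = 2⁻¹ * (f true + f false) := by
  have h : ∀ b, fairCoin {b} = 2⁻¹ := fun b => by
    simp [fairCoin]
  rw [lintegral_fintype, Fintype.sum_bool, h, h]
  ring

/-- The integral of an exponential, in `[0,∞]`. -/
theorem lintegral_exp_neg_mul (c : ℝ) :
    ∫⁻ x in Ioi (0 : ℝ), ENNReal.ofReal (Real.exp (-(c * x))) = (ENNReal.ofReal c)⁻¹ := by
  rcases lt_or_ge 0 c with hc | hc
  · have h1 := lintegral_expMeasure c 1 measurable_one
    have := isProbabilityMeasure_expMeasure hc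
    simp only [Pi.one_apply, lintegral_const, measure_univ, mul_one,
      ENNReal.ofReal_mul hc.le] at h1
    rw [lintegral_const_mul _ (by fun_prop)] at h1
    rw [eq_comm]
    exact (ENNReal.eq_inv_of_mul_eq_one_left (by rw [mul_comm]; exact h1.symm)).symm
  -- For `c ≤ 0` both sides are infinite: `ENNReal.ofReal c` is zero and its inverse is `⊤`.
  · rw [ENNReal.ofReal_of_nonpos hc, ENNReal.inv_zero, eq_top_iff]
    calc (⊤ : ℝ≥0∞) = ∫⁻ x in Ioi (0 : ℝ), 1 := by simp
      _ ≤ _ := by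
        refine setLIntegral_mono (by fun_prop) fun x hx => ?_
        rw [← ENNReal.ofReal_one]
        refine ENNReal.ofReal_le_ofReal (Real.one_le_exp ?_)
        have hx' : (0 : ℝ) < x := hx
        nlinarith

/-! ### The first event of a particle -/

theorem measurableSet_branches (ξ : ℤ → ℝ) (z : ℤ) : MeasurableSet {c | Branches ξ z c} :=
  measurableSet_lt (by fun_prop) (by fun_prop)

theorem measurable_eventTime (ξ : ℤ → ℝ) (z : ℤ) : Measurable (eventTime ξ z) := by
  unfold eventTime
  exact Measurable.ite (measurableSet_branches ξ z) (by fun_prop) (by fun_prop)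

theorem measurable_nextSite (ξ : ℤ → ℝ) (z : ℤ) : Measurable (nextSite ξ z) := by
  unfold nextSite
  refine Measurable.ite (measurableSet_branches ξ z) (by fun_prop) ?_
  exact (measurable_of_countable fun b : Bool => z + step b).comp (by fun_prop)

/-- The law of the data of one label. -/
noncomputable abbrev clockMeasure : Measure Clocks :=
  (expMeasure 1).prod ((expMeasure 1).prod fairCoin)

theorem lintegral_exp_neg_mul_Ioi {c : ℝ} (hc : 0 < c) (a : ℝ) :
    ∫⁻ x in Ioi a, ENNReal.ofReal (c * Real.exp (-(c * x))) =
      ENNReal.ofReal (Real.exp (-(c * a))) := by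
  rw [← ofReal_integral_eq_lintegral_ofReal]
  · congr 1
    rw [integral_const_mul]
    have h := integral_exp_mul_Ioi (neg_lt_zero.2 hc) a
    simp only [neg_mul] at h
    rw [h]
    field_simp
  · have h := integrableOn_exp_mul_Ioi (neg_lt_zero.2 hc) a
    simp only [neg_mul] at h
    exact h.const_mul c
  · filter_upwards with x
    positivity

theorem expMeasure_one_Ioi {a : ℝ} (ha : 0 ≤ a) :
    expMeasure 1 (Ioi a) = ENNReal.ofReal (Real.exp (-a)) := by
  rw [← lintegral_indicator_one measurableSet_Ioi,
    lintegral_expMeasure _ _ (measurable_one.indicator measurableSet_Ioi)]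
  have h := lintegral_exp_neg_mul_Ioi one_pos a
  simp only [one_mul] at h ⊢
  rw [← h, ← lintegral_indicator measurableSet_Ioi, ← lintegral_indicator measurableSet_Ioi]
  refine lintegral_congr fun x => ?_
  by_cases hx : a < x
  · simp [hx, ha.trans_lt hx]
  · simp [hx]

theorem expMeasure_one_Ici {a : ℝ} (ha : 0 ≤ a) :
    expMeasure 1 (Ici a) = ENNReal.ofReal (Real.exp (-a)) := by
  rw [← expMeasure_one_Ioi ha]
  have hac : expMeasure 1 ≪ volume := withDensity_absolutelyContinuous _ _
  exact (measure_congr (hac.ae_le Ioi_ae_eq_Ici)).symm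

theorem lintegral_Ioi_comp_div {c : ℝ} (hc : 0 < c) (f : ℝ → ℝ≥0∞) :
    ∫⁻ x in Ioi (0 : ℝ), f x = ENNReal.ofReal c * ∫⁻ x in Ioi (0 : ℝ), f (c * x) := by
  have himg : (fun x => c * x) '' Ioi (0 : ℝ) = Ioi 0 := by
    ext x
    simp only [mem_image, mem_Ioi]
    exact ⟨by rintro ⟨y, hy, rfl⟩; positivity, fun hx => ⟨x / c, by positivity, by field_simp⟩⟩
  have h := lintegral_image_eq_lintegral_abs_deriv_mul (s := Ioi (0 : ℝ)) measurableSet_Ioi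
    (f := fun x => c * x) (f' := fun _ => c)
    (fun x _ => by simpa using ((hasDerivAt_id x).const_mul c).hasDerivWithinAt)
    (mul_right_injective₀ hc.ne').injOn f
  rw [himg] at h
  rw [h, abs_of_pos hc, lintegral_const_mul' _ _ ENNReal.ofReal_ne_top]

open Classical in
/-- The first event comes at rate `1 + ξ z`, and it is a branching with probability
`ξ z / (1 + ξ z)`, independently of its time. -/
theorem lintegral_clockMeasure {ξ : ℤ → ℝ} {z : ℤ} (hξ : 0 < ξ z) {B : ℝ → ℝ≥0∞}
    {J : Bool → ℝ → ℝ≥0∞} (hB : Measurable B) (hJ : ∀ b, Measurable (J b)) :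
    ∫⁻ c, (if Branches ξ z c then B (eventTime ξ z c) else J c.2.2 (eventTime ξ z c))
        ∂clockMeasure =
      ∫⁻ r in Ioi 0, ENNReal.ofReal (Real.exp (-((1 + ξ z) * r))) *
        (ENNReal.ofReal (ξ z) * B r + 2⁻¹ * (J true r + J false r)) := by
  have hJ' : Measurable (fun p : ℝ × Bool => J p.2 p.1) :=
    measurable_from_prod_countable_left hJ
  have hbr : MeasurableSet {p : ℝ × ℝ | p.2 < ξ z * p.1} :=
    measurableSet_lt (by fun_prop) (by fun_prop)
  have hm1 : Measurable (fun p : ℝ × ℝ => if p.2 < ξ z * p.1 then B (p.2 / ξ z) else 0) :=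
    Measurable.ite hbr (by fun_prop) measurable_const
  have hm2 : Measurable (fun p : ℝ × ℝ =>
      if p.2 < ξ z * p.1 then 0 else 2⁻¹ * (J true p.1 + J false p.1)) := by
    have := hJ true
    have := hJ false
    exact Measurable.ite hbr measurable_const (by fun_prop)
  have hm : Measurable (fun c : Clocks =>
      if Branches ξ z c then B (eventTime ξ z c) else J c.2.2 (eventTime ξ z c)) := by
    refine Measurable.ite (measurableSet_branches ξ z) (hB.comp (measurable_eventTime ξ z)) ?_
    exact hJ'.comp (Measurable.prodMk (measurable_eventTime ξ z) (by fun_prop))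
  have hstep : ∀ T S : ℝ, ∫⁻ b, (if Branches ξ z (T, S, b) then B (eventTime ξ z (T, S, b))
      else J b (eventTime ξ z (T, S, b))) ∂fairCoin =
      (if S < ξ z * T then B (S / ξ z) else 0) +
        (if S < ξ z * T then 0 else 2⁻¹ * (J true T + J false T)) := by
    intro T S
    rw [lintegral_fairCoin]
    by_cases h : S < ξ z * T
    · have hb : ∀ b, Branches ξ z (T, S, b) := fun _ => h
      simp only [eventTime, hb, if_true, h, add_zero, ← two_mul, ← mul_assoc]
      rw [ENNReal.inv_mul_cancel (by simp) (by simp), one_mul]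
    · have hb : ∀ b, ¬ Branches ξ z (T, S, b) := fun _ => h
      simp [eventTime, hb, h]
  -- The jump clock `T` is integrated first: it exceeds `S / ξ z` with probability `exp (-(S / ξ
  -- z))`, and `r = S / ξ z` is then the event time. In `e3` the two clocks exchange their roles.
  have e1 : ∫⁻ T, ∫⁻ S, (if S < ξ z * T then B (S / ξ z) else 0) ∂expMeasure 1 ∂expMeasure 1 =
      ∫⁻ r in Ioi 0, ENNReal.ofReal (Real.exp (-((1 + ξ z) * r))) *
        (ENNReal.ofReal (ξ z) * B r) := by
    rw [lintegral_lintegral_swap hm1.aemeasurable]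
    have e2 : ∀ S : ℝ, ∫⁻ T, (if S < ξ z * T then B (S / ξ z) else 0) ∂expMeasure 1 =
        B (S / ξ z) * expMeasure 1 (Ioi (S / ξ z)) := by
      intro S
      rw [← lintegral_indicator_one measurableSet_Ioi, ← lintegral_const_mul _
        (measurable_one.indicator measurableSet_Ioi)]
      refine lintegral_congr fun T => ?_
      have : S < ξ z * T ↔ S / ξ z < T := by rw [div_lt_iff₀ hξ, mul_comm]
      by_cases h : S / ξ z < T
      · simp [this, h]
      · simp [this, h]
    simp_rw [e2]
    have hmeas : Measurable fun S : ℝ => B (S / ξ z) * expMeasure 1 (Ioi (S / ξ z)) := by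
      refine (hB.comp (by fun_prop)).mul (Measurable.comp (g := fun a : ℝ => expMeasure 1 (Ioi a))
        ?_ (by fun_prop))
      exact (antitone_iff_forall_lt.2 fun a b hab => measure_mono (Ioi_subset_Ioi hab.le)).measurable
    rw [lintegral_expMeasure _ _ hmeas, lintegral_Ioi_comp_div hξ,
      ← lintegral_const_mul' _ _ ENNReal.ofReal_ne_top]
    refine setLIntegral_congr_fun measurableSet_Ioi fun r hr => ?_
    simp only [one_mul]
    rw [mul_div_cancel_left₀ _ hξ.ne', expMeasure_one_Ioi (le_of_lt hr),
      show -((1 + ξ z) * r) = -(ξ z * r) + -r by ring, Real.exp_add,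
      ENNReal.ofReal_mul (Real.exp_nonneg _)]
    ring
  have e3 : ∫⁻ T, ∫⁻ S, (if S < ξ z * T then 0 else 2⁻¹ * (J true T + J false T))
        ∂expMeasure 1 ∂expMeasure 1 =
      ∫⁻ r in Ioi 0, ENNReal.ofReal (Real.exp (-((1 + ξ z) * r))) *
        (2⁻¹ * (J true r + J false r)) := by
    have e2 : ∀ T : ℝ, ∫⁻ S, (if S < ξ z * T then 0 else 2⁻¹ * (J true T + J false T))
        ∂expMeasure 1 = 2⁻¹ * (J true T + J false T) * expMeasure 1 (Ici (ξ z * T)) := by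
      intro T
      rw [← lintegral_indicator_one measurableSet_Ici, ← lintegral_const_mul _
        (measurable_one.indicator measurableSet_Ici)]
      refine lintegral_congr fun S => ?_
      by_cases h : S < ξ z * T
      · simp [h]
      · simp [h, not_lt.1 h]
    rw [lintegral_expMeasure _ _ hm2.lintegral_prod_right']
    refine setLIntegral_congr_fun measurableSet_Ioi fun r hr => ?_
    simp only [one_mul]
    rw [e2, expMeasure_one_Ici (mul_nonneg hξ.le (le_of_lt hr)),
      show -((1 + ξ z) * r) = -(ξ z * r) + -r by ring, Real.exp_add,
      ENNReal.ofReal_mul (Real.exp_nonneg _)]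
    ring
  rw [lintegral_prod _ hm.aemeasurable]
  have e4 : ∀ T : ℝ, ∫⁻ p, (if Branches ξ z (T, p) then B (eventTime ξ z (T, p))
      else J p.2 (eventTime ξ z (T, p))) ∂(expMeasure 1).prod fairCoin =
      ∫⁻ S, (if S < ξ z * T then B (S / ξ z) else 0) ∂expMeasure 1 +
      ∫⁻ S, (if S < ξ z * T then 0 else 2⁻¹ * (J true T + J false T)) ∂expMeasure 1 := by
    intro T
    have hmT : Measurable (fun p : ℝ × Bool => if Branches ξ z (T, p) then
        B (eventTime ξ z (T, p)) else J p.2 (eventTime ξ z (T, p))) :=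
      hm.comp measurable_prodMk_left
    rw [lintegral_prod _ hmT.aemeasurable]
    simp_rw [hstep]
    exact lintegral_add_left (hm1.comp measurable_prodMk_left) _
  simp_rw [e4]
  rw [lintegral_add_left hm1.lintegral_prod_right', e1, e3, ← lintegral_add_left]
  · simp_rw [mul_add]
  · fun_prop

/-! ### The backward equation for the expected number of particles -/

/-- Joint measurability in data and time is what the induction needs, because the recursion
evaluates at the random time `t - eventTime`. The random site takes countably many values and is
handled by a union. -/
theorem measurableSet_occupies (ξ : ℤ → ℝ) (y : ℤ) (u : List Bool) (z : ℤ) :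
    MeasurableSet {p : (List Bool → Clocks) × ℝ | Occupies ξ y u p.1 z p.2} := by
  induction u generalizing z with
  | nil =>
    have h1 : Measurable fun p : (List Bool → Clocks) × ℝ => eventTime ξ z (p.1 []) :=
      (measurable_eventTime ξ z).comp (by fun_prop)
    exact (measurableSet_le measurable_const measurable_snd).inter
      ((measurableSet_lt measurable_snd h1).inter (MeasurableSet.const _))
  | cons i u ih =>
    have h0 : Measurable fun p : (List Bool → Clocks) × ℝ => p.1 [] := by fun_prop
    have h1 : Measurable fun p : (List Bool → Clocks) × ℝ => eventTime ξ z (p.1 []) :=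
      (measurable_eventTime ξ z).comp h0
    have h2 : Measurable fun p : (List Bool → Clocks) × ℝ =>
        ((fun w => p.1 (i :: w) : List Bool → Clocks), p.2 - eventTime ξ z (p.1 [])) :=
      Measurable.prodMk (by fun_prop) (measurable_snd.sub h1)
    have heq : {p : (List Bool → Clocks) × ℝ | Occupies ξ y (i :: u) p.1 z p.2} =
        {p | eventTime ξ z (p.1 []) ≤ p.2} ∩ ({p | i = false ∨ Branches ξ z (p.1 [])} ∩
          ⋃ z' : ℤ, {p | nextSite ξ z (p.1 []) = z'} ∩
            (fun p : (List Bool → Clocks) × ℝ =>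
              ((fun w => p.1 (i :: w) : List Bool → Clocks), p.2 - eventTime ξ z (p.1 []))) ⁻¹'
            {p | Occupies ξ y u p.1 z' p.2}) := by
      ext p
      simp [Occupies]
    rw [heq]
    refine (measurableSet_le h1 measurable_snd).inter (((MeasurableSet.const _).union
      (h0 (measurableSet_branches ξ z))).inter (MeasurableSet.iUnion fun z' => ?_))
    exact (((measurable_nextSite ξ z).comp h0) (measurableSet_singleton z')).inter (h2 (ih z'))

/-- The probability that the label `u` is in use at time `t`, for a particle at `y`. -/
noncomputable def occupationProb (ξ : ℤ → ℝ) (y : ℤ) (u : List Bool) (z : ℤ) (t : ℝ) : ℝ≥0∞ :=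
  branchingMeasure {ω | Occupies ξ y u ω z t}

instance : IsProbabilityMeasure branchingMeasure := by
  unfold branchingMeasure; infer_instance

theorem measurableSet_occupies_time (ξ : ℤ → ℝ) (y : ℤ) (u : List Bool) (z : ℤ) (t : ℝ) :
    MeasurableSet {ω | Occupies ξ y u ω z t} :=
  measurable_prodMk_right (measurableSet_occupies ξ y u z)

theorem measurable_occupationProb (ξ : ℤ → ℝ) (y : ℤ) (u : List Bool) (z : ℤ) :
    Measurable (occupationProb ξ y u z) :=
  measurable_measure_prodMk_right (measurableSet_occupies ξ y u z)

theorem expectedCount_eq_tsum (ξ : ℤ → ℝ) (x : ℤ) (t : ℝ) (y : ℤ) :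
    expectedCount ξ x t y = ∑' u, occupationProb ξ y u x t := by
  have h : ∀ ω, (particleCount ξ x t y ω : ℝ≥0∞) =
      ∑' u, {ω | Occupies ξ y u ω x t}.indicator 1 ω := by
    intro ω
    rw [particleCount, ← ENNReal.tsum_set_one]
    exact tsum_subtype {u | Occupies ξ y u ω x t} fun _ => (1 : ℝ≥0∞)
  unfold expectedCount
  simp_rw [h]
  rw [lintegral_tsum fun u =>
    (measurable_one.indicator (measurableSet_occupies_time ξ y u x t)).aemeasurable]
  simp_rw [lintegral_indicator_one (measurableSet_occupies_time ξ y _ x t)]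
  rfl

theorem branchingMeasure_eq : branchingMeasure = Measure.infinitePi (fun _ => clockMeasure) := rfl

open Classical in
theorem occupationProb_nil {ξ : ℤ → ℝ} {z : ℤ} (hξ : 0 < ξ z) (y : ℤ) {t : ℝ} (ht : 0 ≤ t) :
    occupationProb ξ y [] z t =
      if z = y then ENNReal.ofReal (Real.exp (-((1 + ξ z) * t))) else 0 := by
  have hset : {ω : List Bool → Clocks | Occupies ξ y [] ω z t} =
      (fun ω => ω []) ⁻¹' {c | t < eventTime ξ z c ∧ z = y} := by
    ext ω; simp [Occupies, ht]
  have hm : MeasurableSet {c | t < eventTime ξ z c ∧ z = y} :=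
    (measurableSet_lt measurable_const (measurable_eventTime ξ z)).inter (MeasurableSet.const _)
  rw [occupationProb, hset, branchingMeasure_eq, ← Measure.map_apply (by fun_prop) hm,
    Measure.infinitePi_map_eval]
  split_ifs with hzy
  · have hi : Measurable ((Ioi t).indicator (1 : ℝ → ℝ≥0∞)) :=
      measurable_one.indicator measurableSet_Ioi
    have h := lintegral_clockMeasure hξ hi (fun _ : Bool => hi)
    simp only [ite_self] at h
    rw [← lintegral_indicator_one hm]
    have h1 : ∀ c, {c | t < eventTime ξ z c ∧ z = y}.indicator (1 : Clocks → ℝ≥0∞) c =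
        (Ioi t).indicator 1 (eventTime ξ z c) := by
      intro c
      simp [indicator, hzy]
    simp_rw [h1]
    rw [h, ← lintegral_exp_neg_mul_Ioi (by positivity), ← lintegral_indicator measurableSet_Ioi,
      ← lintegral_indicator measurableSet_Ioi]
    refine lintegral_congr fun r => ?_
    by_cases hr : t < r
    · have h2 : (2 : ℝ≥0∞)⁻¹ * (1 + 1) = 1 := by
        rw [one_add_one_eq_two, ENNReal.inv_mul_cancel (by simp) (by simp)]
      simp only [indicator, mem_Ioi, hr, ht.trans_lt hr, if_true, Pi.one_apply, mul_one, h2]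
      rw [← ENNReal.ofReal_one, ← ENNReal.ofReal_add hξ.le zero_le_one, add_comm (ξ z) 1,
        ← ENNReal.ofReal_mul (Real.exp_nonneg _), mul_comm]
    · simp [indicator, hr]
  · simp [hzy]

open Classical in
-- Markov property at the first event: the data of the descendants sit at the labels `i :: w`, which
-- are independent of the data at the root.
theorem occupationProb_cons (ξ : ℤ → ℝ) (y : ℤ) (i : Bool) (u : List Bool) (z : ℤ) (t : ℝ) :
    occupationProb ξ y (i :: u) z t = ∫⁻ c,
      (if eventTime ξ z c ≤ t ∧ (i = false ∨ Branches ξ z c) then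
        occupationProb ξ y u (nextSite ξ z c) (t - eventTime ξ z c) else 0) ∂clockMeasure := by
  have hm : MeasurableSet {p : Clocks × (List Bool → Clocks) |
      (eventTime ξ z p.1 ≤ t ∧ (i = false ∨ Branches ξ z p.1)) ∧
        Occupies ξ y u p.2 (nextSite ξ z p.1) (t - eventTime ξ z p.1)} := by
    have h1 : Measurable fun p : Clocks × (List Bool → Clocks) => eventTime ξ z p.1 :=
      (measurable_eventTime ξ z).comp measurable_fst
    have heq : {p : Clocks × (List Bool → Clocks) |
      (eventTime ξ z p.1 ≤ t ∧ (i = false ∨ Branches ξ z p.1)) ∧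
        Occupies ξ y u p.2 (nextSite ξ z p.1) (t - eventTime ξ z p.1)} =
      {p | eventTime ξ z p.1 ≤ t ∧ (i = false ∨ Branches ξ z p.1)} ∩
      ⋃ z' : ℤ, {p | nextSite ξ z p.1 = z'} ∩
        (fun p : Clocks × (List Bool → Clocks) => (p.2, t - eventTime ξ z p.1)) ⁻¹'
            {p | Occupies ξ y u p.1 z' p.2} := by
      ext p; simp
    rw [heq]
    refine ((measurableSet_le h1 measurable_const).inter ((MeasurableSet.const _).union
      (measurable_fst (measurableSet_branches ξ z)))).inter (MeasurableSet.iUnion fun z' => ?_)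
    exact (((measurable_nextSite ξ z).comp measurable_fst) (measurableSet_singleton z')).inter
      ((measurable_snd.prodMk (measurable_const.sub h1)) (measurableSet_occupies ξ y u z'))
  have h := lintegral_infinitePi_prodMk clockMeasure (κ := List Bool) []
    (σ := fun w => i :: w) (List.cons_injective) (fun _ => by simp)
    ((measurable_one (α := ℝ≥0∞)).indicator hm)
  rw [occupationProb, ← lintegral_indicator_one (measurableSet_occupies_time ξ y _ z t),
    branchingMeasure_eq]
  refine Eq.trans (lintegral_congr fun ω => ?_) (h.trans (lintegral_congr fun c => ?_))
  · simp only [indicator, Occupies, and_assoc, mem_ofPred_eq]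
    congr
  · split_ifs with hc
    · rw [occupationProb, ← lintegral_indicator_one (measurableSet_occupies_time ξ y _ _ _),
        branchingMeasure_eq]
      refine lintegral_congr fun ω => ?_
      simp [indicator, hc]
    · simp [indicator, hc]

theorem measurable_occupationProb_next (ξ : ℤ → ℝ) (y : ℤ) (u : List Bool) (z : ℤ)
    (t : ℝ) : Measurable (fun c => occupationProb ξ y u (nextSite ξ z c) (t - eventTime ξ z c)) := by
  have h : Measurable (fun p : ℤ × ℝ => occupationProb ξ y u p.1 p.2) :=
    measurable_from_prod_countable_right fun z' => measurable_occupationProb ξ y u z'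
  exact h.comp ((measurable_nextSite ξ z).prodMk (measurable_const.sub (measurable_eventTime ξ z)))

theorem tsum_list_bool (f : List Bool → ℝ≥0∞) :
    ∑' u, f u = f [] + (∑' u, f (false :: u) + ∑' u, f (true :: u)) := by
  let e : Unit ⊕ (List Bool ⊕ List Bool) ≃ List Bool :=
    { toFun := Sum.elim (fun _ => []) (Sum.elim (fun u => false :: u) fun u => true :: u)
      invFun := fun u => match u with
        | [] => Sum.inl ()
        | false :: u => Sum.inr (Sum.inl u)
        | true :: u => Sum.inr (Sum.inr u)
      left_inv := by rintro (_ | _ | _) <;> rfl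
      right_inv := by rintro (_ | ⟨_ | _, _⟩) <;> rfl }
  rw [← e.tsum_eq, Summable.tsum_sum ENNReal.summable ENNReal.summable,
    Summable.tsum_sum ENNReal.summable ENNReal.summable, tsum_fintype]
  simp [e]

/-- The expected number of particles at `y` with fewer than `n` events in their line of descent. -/
noncomputable def truncatedCount (ξ : ℤ → ℝ) (y : ℤ) (n : ℕ) (z : ℤ) (t : ℝ) : ℝ≥0∞ :=
  ∑' u, if u.length < n then occupationProb ξ y u z t else 0

/-- Truncating by the number of events makes induction available: upper bounds on the expected count
are proved for every truncation, starting from zero. -/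
theorem expectedCount_eq_iSup (ξ : ℤ → ℝ) (x : ℤ) (t : ℝ) (y : ℤ) :
    expectedCount ξ x t y = ⨆ n, truncatedCount ξ y n x t := by
  rw [expectedCount_eq_tsum]
  refine le_antisymm ?_ (iSup_le fun n => ENNReal.tsum_le_tsum fun u => ?_)
  · rw [ENNReal.tsum_eq_iSup_sum]
    refine iSup_le fun s => le_iSup_of_le (s.sup List.length + 1) ?_
    refine le_trans (Finset.sum_le_sum fun u hu => ?_) (ENNReal.sum_le_tsum s)
    rw [if_pos (Nat.lt_succ_of_le (Finset.le_sup hu))]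
  · split_ifs
    · exact le_rfl
    · exact bot_le

theorem measurable_truncatedCount (ξ : ℤ → ℝ) (y : ℤ) (n : ℕ) (z : ℤ) :
    Measurable (truncatedCount ξ y n z) := by
  refine Measurable.tsum fun u => ?_
  split_ifs
  · exact measurable_occupationProb ξ y u z
  · exact measurable_const

theorem measurable_expectedCount (ξ : ℤ → ℝ) (x y : ℤ) :
    Measurable (fun t => expectedCount ξ x t y) := by
  simp_rw [expectedCount_eq_iSup]
  exact Measurable.iSup fun n => measurable_truncatedCount ξ y n x

theorem monotone_truncatedCount (ξ : ℤ → ℝ) (y : ℤ) (z : ℤ) (t : ℝ) :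
    Monotone fun n => truncatedCount ξ y n z t := by
  refine fun m n hmn => ENNReal.tsum_le_tsum fun u => ?_
  by_cases h : u.length < m
  · simp [h, h.trans_le hmn]
  · simp [h]

theorem truncatedCount_zero (ξ : ℤ → ℝ) (y : ℤ) (z : ℤ) (t : ℝ) :
    truncatedCount ξ y 0 z t = 0 := by
  simp [truncatedCount]

/-- The rate at which an event at `x` contributes, for a function `F` of the site. -/
noncomputable def eventGain (ξ : ℤ → ℝ) (F : ℤ → ℝ≥0∞) (x : ℤ) : ℝ≥0∞ :=
  2⁻¹ * (F (x + 1) + F (x - 1)) + 2 * ENNReal.ofReal (ξ x) * F x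

open Classical in
-- Decomposition at the first event. A branching feeds both subtrees `false :: u` and `true :: u`, a
-- jump only the first, which is why the factor 2 in `eventGain` stands at the branching term alone.
theorem truncatedCount_succ {ξ : ℤ → ℝ} {z : ℤ} (hξ : 0 < ξ z) (y : ℤ) (n : ℕ) {t : ℝ}
    (ht : 0 ≤ t) :
    truncatedCount ξ y (n + 1) z t =
      (if z = y then ENNReal.ofReal (Real.exp (-((1 + ξ z) * t))) else 0) +
        ∫⁻ r in Ioc 0 t, ENNReal.ofReal (Real.exp (-((1 + ξ z) * r))) *
          eventGain ξ (fun x => truncatedCount ξ y n x (t - r)) z := by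
  have hcons : ∀ i, ∑' u : List Bool,
      (if (i :: u).length < n + 1 then occupationProb ξ y (i :: u) z t else 0) =
      ∫⁻ c, (if eventTime ξ z c ≤ t ∧ (i = false ∨ Branches ξ z c) then
        truncatedCount ξ y n (nextSite ξ z c) (t - eventTime ξ z c) else 0) ∂clockMeasure := by
    intro i
    have h1 : ∀ u : List Bool,
        (if (i :: u).length < n + 1 then occupationProb ξ y (i :: u) z t else 0) =
        ∫⁻ c, (if eventTime ξ z c ≤ t ∧ (i = false ∨ Branches ξ z c) then
          (if u.length < n then
            occupationProb ξ y u (nextSite ξ z c) (t - eventTime ξ z c) else 0) else 0)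
          ∂clockMeasure := by
      intro u
      by_cases hu : u.length < n
      · simp only [List.length_cons, Nat.add_lt_add_iff_right, hu, if_true]
        exact occupationProb_cons ξ y i u z t
      · simp [hu]
    simp_rw [h1]
    rw [← lintegral_tsum]
    · refine lintegral_congr fun c => ?_
      split_ifs
      · rfl
      · simp
    · intro u
      refine Measurable.aemeasurable (Measurable.ite ?_ ?_ measurable_const)
      · exact (measurableSet_le (measurable_eventTime ξ z) measurable_const).inter
          ((MeasurableSet.const _).union (measurableSet_branches ξ z))
      · split_ifs
        · exact measurable_occupationProb_next ξ y u z t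
        · exact measurable_const
  have hmt : ∀ x, Measurable fun r => if r ≤ t then truncatedCount ξ y n x (t - r) else 0 :=
    fun x => Measurable.ite measurableSet_Iic
      ((measurable_truncatedCount ξ y n x).comp (by fun_prop)) measurable_const
  have hmN : Measurable (fun c : Clocks =>
      truncatedCount ξ y n (nextSite ξ z c) (t - eventTime ξ z c)) := by
    have h : Measurable (fun p : ℤ × ℝ => truncatedCount ξ y n p.1 p.2) :=
      measurable_from_prod_countable_right fun z' => measurable_truncatedCount ξ y n z'
    exact h.comp
      ((measurable_nextSite ξ z).prodMk (measurable_const.sub (measurable_eventTime ξ z)))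
  rw [truncatedCount, tsum_list_bool, hcons, hcons, ← lintegral_add_left]
  · congr 1
    · rw [← occupationProb_nil hξ y ht]
      simp
    · have h := lintegral_clockMeasure hξ
        (B := fun r => 2 * if r ≤ t then truncatedCount ξ y n z (t - r) else 0)
        (J := fun b r => if r ≤ t then truncatedCount ξ y n (z + step b) (t - r) else 0)
        ((hmt z).const_mul 2) (fun b => hmt _)
      refine Eq.trans (lintegral_congr fun c => ?_) (h.trans ?_)
      · by_cases hb : Branches ξ z c
        · by_cases hc : eventTime ξ z c ≤ t
          · simp [hb, hc, nextSite, two_mul]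
          · simp [hc]
        · by_cases hc : eventTime ξ z c ≤ t
          · simp [hb, hc, nextSite]
          · simp [hc]
      · rw [← lintegral_indicator measurableSet_Ioi, ← lintegral_indicator measurableSet_Ioc]
        refine lintegral_congr fun r => ?_
        by_cases h0 : 0 < r
        · by_cases hr : r ≤ t
          · simp only [indicator, mem_Ioi, h0, if_true, hr, mem_Ioc, and_self, eventGain, step]
            simp only [Bool.false_eq_true, if_false, ← sub_eq_add_neg]
            ring
          · simp [indicator, hr]
        · simp [indicator, h0]
  · refine Measurable.ite ?_ hmN measurable_const
    exact (measurableSet_le (measurable_eventTime ξ z) measurable_const).inter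
      ((MeasurableSet.const _).union (measurableSet_branches ξ z))

theorem iSup_eventGain (ξ : ℤ → ℝ) {F : ℕ → ℤ → ℝ≥0∞} (hF : ∀ x, Monotone fun n => F n x)
    (x : ℤ) : ⨆ n, eventGain ξ (F n) x = eventGain ξ (fun z => ⨆ n, F n z) x := by
  unfold eventGain
  rw [← ENNReal.iSup_add_iSup_of_monotone, ← ENNReal.mul_iSup, ← ENNReal.mul_iSup,
    ← ENNReal.iSup_add_iSup_of_monotone (hF _) (hF _)]
  · exact fun m n h => mul_le_mul_right (add_le_add (hF _ h) (hF _ h)) _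
  · exact fun m n h => mul_le_mul_right (hF _ h) _

theorem measurable_eventGain (ξ : ℤ → ℝ) {F : ℝ → ℤ → ℝ≥0∞} (hF : ∀ x, Measurable fun t => F t x)
    (x : ℤ) : Measurable fun t => eventGain ξ (F t) x := by
  have h1 := hF (x + 1)
  have h2 := hF (x - 1)
  have h3 := hF x
  unfold eventGain
  fun_prop

open Classical in
/-- The backward equation. -/
theorem expectedCount_eq {ξ : ℤ → ℝ} {z : ℤ} (hξ : 0 < ξ z) (y : ℤ) {t : ℝ} (ht : 0 ≤ t) :
    expectedCount ξ z t y =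
      (if z = y then ENNReal.ofReal (Real.exp (-((1 + ξ z) * t))) else 0) +
        ∫⁻ r in Ioc 0 t, ENNReal.ofReal (Real.exp (-((1 + ξ z) * r))) *
          eventGain ξ (fun x => expectedCount ξ x (t - r) y) z := by
  have h1 : ∀ r, ENNReal.ofReal (Real.exp (-((1 + ξ z) * r))) *
      eventGain ξ (fun x => expectedCount ξ x (t - r) y) z =
      ⨆ n, ENNReal.ofReal (Real.exp (-((1 + ξ z) * r))) *
        eventGain ξ (fun x => truncatedCount ξ y n x (t - r)) z := by
    intro r
    simp_rw [expectedCount_eq_iSup]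
    rw [← ENNReal.mul_iSup,
      iSup_eventGain ξ (fun x => monotone_truncatedCount ξ y x (t - r))]
  simp_rw [h1]
  rw [lintegral_iSup, ENNReal.add_iSup, expectedCount_eq_iSup]
  · simp_rw [← truncatedCount_succ hξ y _ ht]
    refine le_antisymm (iSup_le fun n => le_iSup_of_le n ?_) (iSup_le fun n => le_iSup_of_le (n + 1) le_rfl)
    exact monotone_truncatedCount ξ y z t n.le_succ
  · intro n
    refine Measurable.mul (by fun_prop) ?_
    exact measurable_eventGain ξ (fun x => (measurable_truncatedCount ξ y n x).comp (by fun_prop)) z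
  · intro m n hmn r
    refine mul_le_mul_right ?_ _
    unfold eventGain
    have h := fun x => monotone_truncatedCount ξ y x (t - r) hmn
    exact add_le_add (mul_le_mul_right (add_le_add (h _) (h _)) _) (mul_le_mul_right (h _) _)

/-! ### Semigroup bounds -/

section Semigroup

variable {ξ : ℤ → ℝ} (hξ : ∀ z, 0 < ξ z)

theorem eventGain_mono {F F' : ℤ → ℝ≥0∞} (h : ∀ x, F x ≤ F' x) (x : ℤ) :
    eventGain ξ F x ≤ eventGain ξ F' x :=
  add_le_add (mul_le_mul_right (add_le_add (h _) (h _)) _) (mul_le_mul_right (h _) _)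

theorem eventGain_mul (F : ℤ → ℝ≥0∞) (c : ℝ≥0∞) (x : ℤ) :
    eventGain ξ (fun z => F z * c) x = eventGain ξ F x * c := by
  unfold eventGain; ring

theorem measurable_eventGain_expectedCount (t : ℝ) (x y : ℤ) :
    Measurable fun r => ENNReal.ofReal (Real.exp (-((1 + ξ x) * r))) *
      eventGain ξ (fun x => expectedCount ξ x (t - r) y) x := by
  refine Measurable.mul (by fun_prop) ?_
  exact measurable_eventGain ξ (fun x => (measurable_expectedCount ξ x y).comp (by fun_prop)) x

include hξ in
-- The backward equation over `t + s`, cut at `t`. By memorylessness of the first event, the part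
-- with no event before `t` is a fresh start with remaining time `s`.
theorem expectedCount_add (x y : ℤ) {t s : ℝ} (ht : 0 ≤ t) (hs : 0 ≤ s) :
    expectedCount ξ x (t + s) y =
      ENNReal.ofReal (Real.exp (-((1 + ξ x) * t))) * expectedCount ξ x s y +
        ∫⁻ r in Ioc 0 t, ENNReal.ofReal (Real.exp (-((1 + ξ x) * r))) *
          eventGain ξ (fun x => expectedCount ξ x (t + s - r) y) x := by
  have hsplit : Ioc 0 (t + s) = Ioc 0 t ∪ Ioc t (t + s) :=
    (Ioc_union_Ioc_eq_Ioc ht (by linarith)).symm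
  have htrans : ∫⁻ r in Ioc t (t + s), ENNReal.ofReal (Real.exp (-((1 + ξ x) * r))) *
          eventGain ξ (fun x => expectedCount ξ x (t + s - r) y) x =
      ENNReal.ofReal (Real.exp (-((1 + ξ x) * t))) *
        ∫⁻ r in Ioc 0 s, ENNReal.ofReal (Real.exp (-((1 + ξ x) * r))) *
          eventGain ξ (fun x => expectedCount ξ x (s - r) y) x := by
    rw [← (measurePreserving_add_left volume t).setLIntegral_comp_preimage measurableSet_Ioc
      (measurable_eventGain_expectedCount (t + s) x y),
      ← lintegral_const_mul _ (measurable_eventGain_expectedCount s x y)]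
    have hpre : (fun r => t + r) ⁻¹' Ioc t (t + s) = Ioc 0 s := by
      ext r; simp
    rw [hpre]
    refine lintegral_congr fun r => ?_
    rw [show t + s - (t + r) = s - r by ring, ← mul_assoc,
      ← ENNReal.ofReal_mul (Real.exp_nonneg _), ← Real.exp_add]
    ring_nf
  rw [expectedCount_eq (hξ x) y (by linarith : 0 ≤ t + s), hsplit,
    lintegral_union measurableSet_Ioc (Ioc_disjoint_Ioc_of_le le_rfl), htrans,
    expectedCount_eq (hξ x) y hs,
    show -((1 + ξ x) * (t + s)) = -((1 + ξ x) * t) + -((1 + ξ x) * s) by ring, Real.exp_add,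
    ENNReal.ofReal_mul (Real.exp_nonneg _)]
  split_ifs
  · ring
  · ring

include hξ in
/-- The expected number of particles dominates the contribution of those that pass through a
given site at a given time. -/
theorem expectedCount_mul_le (x y z : ℤ) {t s : ℝ} (ht : 0 ≤ t) (hs : 0 ≤ s) :
    expectedCount ξ x t y * expectedCount ξ y s z ≤ expectedCount ξ x (t + s) z := by
  -- Only the first factor is truncated. `truncatedCount_succ` and `expectedCount_add` then have the
  -- same shape, and they are compared term by term.
  have key : ∀ n : ℕ, ∀ x : ℤ, ∀ t : ℝ, 0 ≤ t →
      truncatedCount ξ y n x t * expectedCount ξ y s z ≤ expectedCount ξ x (t + s) z := by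
    intro n
    induction n with
    | zero => intro x t _; simp [truncatedCount_zero]
    | succ n ih =>
      intro x t ht
      rw [truncatedCount_succ (hξ x) y n ht, expectedCount_add hξ x z ht hs, add_mul]
      refine add_le_add ?_ ?_
      · split_ifs with h
        · rw [h]
        · simp
      · rw [← lintegral_mul_const]
        · refine setLIntegral_mono (measurable_eventGain_expectedCount (t + s) x z) fun r hr => ?_
          rw [mul_assoc, ← eventGain_mul]
          refine mul_le_mul_right (eventGain_mono (fun w => ?_) x) _
          have := ih w (t - r) (by linarith [hr.2])
          rwa [show t - r + s = t + s - r by ring] at this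
        · refine Measurable.mul (by fun_prop) ?_
          exact measurable_eventGain ξ
            (fun x => (measurable_truncatedCount ξ y n x).comp (by fun_prop)) x
  rw [expectedCount_eq_iSup, ENNReal.iSup_mul]
  exact iSup_le fun n => key n x t ht

include hξ in
-- The function `exp (M t)` is a supersolution of the backward equation: the gain of a constant
-- carries the rate `1 + 2 ξ x ≤ 1 + ξ x + M`, and with the rate `1 + ξ x + M` equality would hold.
theorem expectedCount_le_exp {M : ℝ} (hM : ∀ z, ξ z ≤ M) (x y : ℤ) {t : ℝ} (ht : 0 ≤ t) :
    expectedCount ξ x t y ≤ ENNReal.ofReal (Real.exp (M * t)) := by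
  rw [expectedCount_eq_iSup]
  refine iSup_le fun n => ?_
  induction n generalizing x t with
  | zero => simp [truncatedCount_zero]
  | succ n ih =>
    rw [truncatedCount_succ (hξ x) y n ht]
    have hx := hξ x
    have hq : 0 < 1 + ξ x + M := by linarith [hM x]
    have h1 := lintegral_exp_neg_mul_Ioi hq 0
    rw [← Ioc_union_Ioi_eq_Ioi ht, lintegral_union measurableSet_Ioi
      (Ioc_disjoint_Ioi le_rfl), lintegral_exp_neg_mul_Ioi hq t] at h1
    simp only [mul_zero, neg_zero, Real.exp_zero, ENNReal.ofReal_one] at h1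
    rw [add_comm] at h1
    calc _ ≤ ENNReal.ofReal (Real.exp (-((1 + ξ x) * t))) +
          ENNReal.ofReal (Real.exp (M * t)) * ∫⁻ r in Ioc 0 t,
            ENNReal.ofReal ((1 + ξ x + M) * Real.exp (-((1 + ξ x + M) * r))) := by
          refine add_le_add ?_ ?_
          · split_ifs
            · exact le_rfl
            · exact bot_le
          · rw [← lintegral_const_mul _ (by fun_prop)]
            refine setLIntegral_mono (by fun_prop) fun r hr => ?_
            have hmono : eventGain ξ (fun x => truncatedCount ξ y n x (t - r)) x ≤
                eventGain ξ (fun _ => ENNReal.ofReal (Real.exp (M * (t - r)))) x :=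
              eventGain_mono (fun w => ih w (by linarith [hr.2])) x
            have hconst : eventGain ξ (fun _ => ENNReal.ofReal (Real.exp (M * (t - r)))) x =
                ENNReal.ofReal ((1 + 2 * ξ x) * Real.exp (M * (t - r))) := by
              unfold eventGain
              rw [← two_mul, ← mul_assoc, ENNReal.inv_mul_cancel (by simp) (by simp), ← add_mul,
                ENNReal.ofReal_mul (by positivity), ENNReal.ofReal_add zero_le_one (by positivity),
                ENNReal.ofReal_one, ENNReal.ofReal_mul zero_le_two]
              simp
            refine (mul_le_mul_right (hmono.trans_eq hconst) _).trans ?_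
            rw [← ENNReal.ofReal_mul (Real.exp_nonneg _), ← ENNReal.ofReal_mul (Real.exp_nonneg _)]
            refine ENNReal.ofReal_le_ofReal ?_
            have e1 : Real.exp (M * t) * ((1 + ξ x + M) * Real.exp (-((1 + ξ x + M) * r))) =
                (1 + ξ x + M) * (Real.exp (-((1 + ξ x) * r)) * Real.exp (M * (t - r))) := by
              rw [← Real.exp_add, mul_left_comm, ← Real.exp_add]
              ring_nf
            rw [e1, mul_left_comm]
            exact mul_le_mul_of_nonneg_right (by linarith [hM x]) (by positivity)
      _ = ENNReal.ofReal (Real.exp (M * t)) := by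
          conv_rhs => rw [← mul_one (ENNReal.ofReal (Real.exp (M * t))), ← h1]
          rw [mul_add, ← ENNReal.ofReal_mul (Real.exp_nonneg _), ← Real.exp_add]
          ring_nf

include hξ in
theorem le_expectedCount_self (x : ℤ) {t : ℝ} (ht : 0 ≤ t) :
    ENNReal.ofReal (Real.exp (-((1 + ξ x) * t))) ≤ expectedCount ξ x t x := by
  rw [expectedCount_eq (hξ x) x ht, if_pos rfl]
  exact le_self_add

include hξ in
-- A single jump at time `r ≤ t` and no other event suffices. The waits before and after the jump
-- cost at most `exp (-(1 + M) t)` each. Chained by `expectedCount_mul_le`, this reaches every site.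
theorem le_expectedCount_neighbour {M : ℝ} (hM : ∀ z, ξ z ≤ M) {x y : ℤ}
    (hxy : y = x + 1 ∨ y = x - 1) {t : ℝ} (ht : 0 ≤ t) :
    ENNReal.ofReal (Real.exp (-(2 * (1 + M) * t)) / 2 * t) ≤ expectedCount ξ x t y := by
  rw [expectedCount_eq (hξ x) y ht]
  refine le_trans ?_ le_add_self
  have hM0 : 0 ≤ 1 + M := by linarith [hξ x, hM x]
  have hconst : ∀ a : ℝ, 0 ≤ a →
      ENNReal.ofReal (a * t) = ∫⁻ r in Ioc (0 : ℝ) t, ENNReal.ofReal a := by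
    intro a ha
    simp [ENNReal.ofReal_mul ha]
  rw [hconst _ (by positivity)]
  refine setLIntegral_mono (measurable_eventGain_expectedCount t x y) fun r hr => ?_
  have hy : ENNReal.ofReal (Real.exp (-((1 + M) * t))) ≤ expectedCount ξ y (t - r) y := by
    refine le_trans (ENNReal.ofReal_le_ofReal (Real.exp_le_exp.2 (neg_le_neg ?_)))
      (le_expectedCount_self hξ y (by linarith [hr.2]))
    have := hξ y
    exact mul_le_mul (by linarith [hM y]) (by linarith [hr.1]) (by linarith [hr.2]) hM0
  have hgain : 2⁻¹ * ENNReal.ofReal (Real.exp (-((1 + M) * t))) ≤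
      eventGain ξ (fun x => expectedCount ξ x (t - r) y) x := by
    unfold eventGain
    refine le_trans (mul_le_mul_right ?_ _) le_self_add
    rcases hxy with rfl | rfl
    · exact hy.trans le_self_add
    · exact hy.trans le_add_self
  have hexp : ENNReal.ofReal (Real.exp (-((1 + M) * t))) ≤
      ENNReal.ofReal (Real.exp (-((1 + ξ x) * r))) := by
    refine ENNReal.ofReal_le_ofReal (Real.exp_le_exp.2 (neg_le_neg ?_))
    exact mul_le_mul (by linarith [hM x]) hr.2 hr.1.le hM0
  refine le_trans (le_of_eq ?_) (mul_le_mul' hexp hgain)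
  rw [mul_left_comm, ← ENNReal.ofReal_mul (Real.exp_nonneg _), ← Real.exp_add, div_eq_inv_mul,
    ENNReal.ofReal_mul (by norm_num), ENNReal.ofReal_inv_of_pos two_pos]
  congr 2
  · simp
  · ring_nf

include hξ in
theorem le_expectedCount_right {M : ℝ} (hM : ∀ z, ξ z ≤ M) {t : ℝ} (ht : 0 ≤ t) (x : ℤ) (m : ℕ) :
    ENNReal.ofReal (Real.exp (-(2 * (1 + M) * t)) / 2 * t) ^ m ≤
      expectedCount ξ x (m * t) (x + m) := by
  induction m with
  | zero => simpa using le_expectedCount_self hξ x le_rfl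
  | succ m ih =>
    rw [pow_succ]
    push_cast
    refine (mul_le_mul' ih
      (le_expectedCount_neighbour hξ hM (x := x + m) (Or.inl rfl) ht)).trans ?_
    rw [← add_assoc, add_mul, one_mul]
    exact expectedCount_mul_le hξ _ _ _ (by positivity) ht

include hξ in
theorem le_expectedCount_left {M : ℝ} (hM : ∀ z, ξ z ≤ M) {t : ℝ} (ht : 0 ≤ t) (x : ℤ) (m : ℕ) :
    ENNReal.ofReal (Real.exp (-(2 * (1 + M) * t)) / 2 * t) ^ m ≤
      expectedCount ξ x (m * t) (x - m) := by
  induction m with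
  | zero => simpa using le_expectedCount_self hξ x le_rfl
  | succ m ih =>
    rw [pow_succ]
    push_cast
    refine (mul_le_mul' ih
      (le_expectedCount_neighbour hξ hM (x := x - m) (Or.inr rfl) ht)).trans ?_
    rw [← sub_sub, add_mul, one_mul]
    exact expectedCount_mul_le hξ _ _ _ (by positivity) ht

include hξ in
theorem expectedCount_pos {M : ℝ} (hM : ∀ z, ξ z ≤ M) (x y : ℤ) {t : ℝ} (ht : 0 < t) :
    0 < expectedCount ξ x t y := by
  obtain ⟨m, hm⟩ := Int.eq_ofNat_of_zero_le (abs_nonneg (y - x))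
  rcases Nat.eq_zero_or_pos m with rfl | hm0
  · have : y = x := by simpa [sub_eq_zero] using hm
    rw [this]
    exact (ENNReal.ofReal_pos.2 (Real.exp_pos _)).trans_le (le_expectedCount_self hξ x ht.le)
  · have hm0' : (0 : ℝ) < m := Nat.cast_pos.2 hm0
    have htm : 0 < t / m := by positivity
    have hc : (0 : ℝ≥0∞) < ENNReal.ofReal (Real.exp (-(2 * (1 + M) * (t / m))) / 2 * (t / m)) :=
      ENNReal.ofReal_pos.2 (by positivity)
    have htime : (m : ℝ) * (t / m) = t := by field_simp
    rcases abs_choice (y - x) with h | h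
    · have hy : y = x + m := by omega
      have h1 := le_expectedCount_right hξ hM htm.le x m
      rw [htime, ← hy] at h1
      exact (ENNReal.pow_pos hc m).trans_le h1
    · have hy : y = x - m := by omega
      have h1 := le_expectedCount_left hξ hM htm.le x m
      rw [htime, ← hy] at h1
      exact (ENNReal.pow_pos hc m).trans_le h1

end Semigroup

/-! ### Green's function -/

/-- The Laplace transform in time of the expected number of particles. -/
noncomputable def green (ξ : ℤ → ℝ) (κ : ℝ) (x y : ℤ) : ℝ≥0∞ :=
  ∫⁻ t in Ioi 0, ENNReal.ofReal (Real.exp (-(κ * t))) * expectedCount ξ x t y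

theorem lintegral_laplace_convolution (κ q : ℝ) {F : ℝ → ℝ≥0∞} (hF : Measurable F) :
    ∫⁻ t in Ioi 0, ENNReal.ofReal (Real.exp (-(κ * t))) *
        ∫⁻ r in Ioc 0 t, ENNReal.ofReal (Real.exp (-(q * r))) * F (t - r) =
      (ENNReal.ofReal (κ + q))⁻¹ *
        ∫⁻ t in Ioi 0, ENNReal.ofReal (Real.exp (-(κ * t))) * F t := by
  have h1 : ∀ t ∈ Ioi (0 : ℝ), ENNReal.ofReal (Real.exp (-(κ * t))) *
        ∫⁻ r in Ioc 0 t, ENNReal.ofReal (Real.exp (-(q * r))) * F (t - r) =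
      ∫⁻ r in Ioi 0, if r ≤ t then ENNReal.ofReal (Real.exp (-((κ + q) * r))) *
        (ENNReal.ofReal (Real.exp (-(κ * (t - r)))) * F (t - r)) else 0 := by
    intro t _
    rw [← lintegral_const_mul _ (by fun_prop), ← lintegral_indicator measurableSet_Ioc,
      ← lintegral_indicator measurableSet_Ioi]
    refine lintegral_congr fun r => ?_
    by_cases h0 : 0 < r
    · by_cases hr : r ≤ t
      · simp only [indicator, mem_Ioc, mem_Ioi, h0, hr, and_self, if_true]
        rw [← mul_assoc, ← mul_assoc, ← ENNReal.ofReal_mul (Real.exp_nonneg _),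
          ← ENNReal.ofReal_mul (Real.exp_nonneg _), ← Real.exp_add, ← Real.exp_add]
        ring_nf
      · simp [indicator, hr]
    · simp [indicator, h0]
  rw [setLIntegral_congr_fun measurableSet_Ioi h1, lintegral_lintegral_swap]
  · rw [← lintegral_exp_neg_mul, ← lintegral_mul_const _ (by fun_prop)]
    refine setLIntegral_congr_fun measurableSet_Ioi fun r hr => ?_
    have hr' : (0 : ℝ) < r := hr
    rw [← lintegral_const_mul _ (by fun_prop), setLIntegral_congr Ioi_ae_eq_Ici,
      setLIntegral_congr (f := fun t => ENNReal.ofReal (Real.exp (-((κ + q) * r))) * _)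
        Ioi_ae_eq_Ici,
      ← lintegral_indicator measurableSet_Ici, ← lintegral_indicator measurableSet_Ici,
      eq_comm, ← lintegral_sub_right_eq_self _ r]
    refine lintegral_congr fun t => ?_
    by_cases hrt : r ≤ t
    · simp [indicator, hrt, hr'.le.trans hrt]
    · simp [indicator, hrt]
  · refine Measurable.aemeasurable (Measurable.ite ?_ (by fun_prop) measurable_const)
    exact measurableSet_le measurable_snd measurable_fst

open Classical in
-- The time convolution becomes a product. Keeping `f` and `F` separate lets the lemma serve both
-- the equation of the full count and the passage from one truncation to the next.
theorem laplace_backward {ξ : ℤ → ℝ} (κ : ℝ) (x y : ℤ) {F : ℤ → ℝ → ℝ≥0∞} {f : ℝ → ℝ≥0∞}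
    (hF : ∀ z, Measurable (F z))
    (hf : ∀ t, 0 ≤ t → f t =
      (if x = y then ENNReal.ofReal (Real.exp (-((1 + ξ x) * t))) else 0) +
        ∫⁻ r in Ioc 0 t, ENNReal.ofReal (Real.exp (-((1 + ξ x) * r))) *
          eventGain ξ (fun z => F z (t - r)) x) :
    ∫⁻ t in Ioi 0, ENNReal.ofReal (Real.exp (-(κ * t))) * f t =
      (ENNReal.ofReal (κ + (1 + ξ x)))⁻¹ * ((if x = y then 1 else 0) + eventGain ξ
        (fun z => ∫⁻ t in Ioi 0, ENNReal.ofReal (Real.exp (-(κ * t))) * F z t) x) := by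
  have hgain : ∫⁻ t in Ioi 0, ENNReal.ofReal (Real.exp (-(κ * t))) *
      eventGain ξ (fun z => F z t) x = eventGain ξ
        (fun z => ∫⁻ t in Ioi 0, ENNReal.ofReal (Real.exp (-(κ * t))) * F z t) x := by
    have h1 := hF (x + 1)
    have h2 := hF (x - 1)
    have h3 := hF x
    unfold eventGain
    rw [← lintegral_add_left (by fun_prop), ← lintegral_const_mul _ (by fun_prop),
      ← lintegral_const_mul _ (by fun_prop), ← lintegral_add_left (by fun_prop)]
    refine lintegral_congr fun t => ?_
    ring
  have hconv := lintegral_laplace_convolution κ (1 + ξ x) (measurable_eventGain ξ hF x)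
  rw [hgain] at hconv
  rw [mul_add, ← hconv]
  have h1 : ∀ t ∈ Ioi (0 : ℝ), ENNReal.ofReal (Real.exp (-(κ * t))) * f t =
      (if x = y then ENNReal.ofReal (Real.exp (-((κ + (1 + ξ x)) * t))) else 0) +
      ENNReal.ofReal (Real.exp (-(κ * t))) * ∫⁻ r in Ioc 0 t,
        ENNReal.ofReal (Real.exp (-((1 + ξ x) * r))) *
          eventGain ξ (fun z => F z (t - r)) x := by
    intro t ht
    rw [hf t (le_of_lt ht), mul_add]
    congr 1
    split_ifs
    · rw [← ENNReal.ofReal_mul (Real.exp_nonneg _), ← Real.exp_add]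
      ring_nf
    · simp
  rw [setLIntegral_congr_fun measurableSet_Ioi h1, lintegral_add_left]
  · congr 1
    split_ifs
    · rw [lintegral_exp_neg_mul, mul_one]
    · simp
  · split_ifs
    · fun_prop
    · fun_prop

open Classical in
theorem green_eq {ξ : ℤ → ℝ} (hξ : ∀ z, 0 < ξ z) (κ : ℝ) (x y : ℤ) :
    green ξ κ x y = (ENNReal.ofReal (κ + (1 + ξ x)))⁻¹ *
      ((if x = y then 1 else 0) + eventGain ξ (fun z => green ξ κ z y) x) :=
  laplace_backward κ x y (fun z => measurable_expectedCount ξ z y)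
    fun _ ht => expectedCount_eq (hξ x) y ht

open Classical in
/-- Green's function is the minimal solution of its equation. -/
theorem green_le_of_supersolution {ξ : ℤ → ℝ} (hξ : ∀ z, 0 < ξ z) (κ : ℝ) (y : ℤ)
    {u : ℤ → ℝ≥0∞} (hu : ∀ x, (ENNReal.ofReal (κ + (1 + ξ x)))⁻¹ *
      ((if x = y then 1 else 0) + eventGain ξ u x) ≤ u x) (x : ℤ) :
    green ξ κ x y ≤ u x := by
  have h1 : green ξ κ x y = ⨆ n, ∫⁻ t in Ioi 0,
      ENNReal.ofReal (Real.exp (-(κ * t))) * truncatedCount ξ y n x t := by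
    unfold green
    simp_rw [expectedCount_eq_iSup, ENNReal.mul_iSup]
    refine lintegral_iSup (fun n => ?_) fun m n hmn t => ?_
    · exact Measurable.mul (by fun_prop) (measurable_truncatedCount ξ y n x)
    · exact mul_le_mul_right (monotone_truncatedCount ξ y x t hmn) _
  rw [h1]
  refine iSup_le fun n => ?_
  clear h1
  induction n generalizing x with
  | zero => simp [truncatedCount_zero]
  | succ n ih =>
    rw [laplace_backward κ x y (fun z => measurable_truncatedCount ξ y n z)
      fun _ ht => truncatedCount_succ (hξ x) y n ht]
    exact (mul_le_mul_right (add_le_add le_rfl (eventGain_mono ih x)) _).trans (hu x)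

/-- The ratio of consecutive values of Green's function is nonincreasing in `κ`. -/
theorem green_mul_green_le {ξ : ℤ → ℝ} (hξ : ∀ z, 0 < ξ z) {κ₁ κ₂ : ℝ} (hκ : κ₁ ≤ κ₂) {y : ℤ}
    (hpos : ∀ x, green ξ κ₁ x y ≠ 0) (hfin : ∀ x, green ξ κ₁ x y ≠ ⊤) {x m : ℤ} (hxm : x < m)
    (hmy : m ≤ y) :
    green ξ κ₂ x y * green ξ κ₁ m y ≤ green ξ κ₂ m y * green ξ κ₁ x y := by
  classical
  -- The factor `c` matches the two Green's functions at `m`. Since `κ₁ ≤ κ₂` and the source `y` is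
  -- not to the left of `m`, `c * green κ₁` is a supersolution for `κ₂` there. Taking its minimum
  -- with `green κ₂` to the left of `m` gives a supersolution `u`, and minimality of Green's
  -- function forces `green κ₂ ≤ u`.
  set c := green ξ κ₂ m y / green ξ κ₁ m y with hc
  have hcm : green ξ κ₁ m y * c = green ξ κ₂ m y :=
    ENNReal.mul_div_cancel (hpos m) (hfin m)
  set u : ℤ → ℝ≥0∞ := fun z =>
    if z < m then min (green ξ κ₂ z y) (green ξ κ₁ z y * c) else green ξ κ₂ z y with hu
  have hu1 : ∀ z, u z ≤ green ξ κ₂ z y := by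
    intro z
    simp only [hu]
    split_ifs
    · exact min_le_left _ _
    · exact le_rfl
  have hu2 : ∀ z, z ≤ m → u z ≤ green ξ κ₁ z y * c := by
    intro z hz
    rcases hz.lt_or_eq with h | rfl
    · simp only [hu, h, if_true]
      exact min_le_right _ _
    · simp [hu, hcm]
  have key := green_le_of_supersolution hξ κ₂ y (u := u) (fun z => ?_) x
  · have h1 := mul_le_mul_left (key.trans (hu2 x hxm.le)) (green ξ κ₁ m y)
    refine h1.trans_eq ?_
    rw [← hcm]
    ring
  · have h2 : (ENNReal.ofReal (κ₂ + (1 + ξ z)))⁻¹ *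
        ((if z = y then 1 else 0) + eventGain ξ u z) ≤ green ξ κ₂ z y := by
      rw [green_eq hξ κ₂ z y]
      exact mul_le_mul_right (add_le_add le_rfl (eventGain_mono hu1 z)) _
    by_cases hz : z < m
    · have h3 : u z = min (green ξ κ₂ z y) (green ξ κ₁ z y * c) := by simp [hu, hz]
      rw [h3]
      refine le_min h2 ?_
      rw [green_eq hξ κ₁ z y, if_neg (by omega), zero_add, zero_add, mul_assoc, ← eventGain_mul]
      refine mul_le_mul' ?_ ?_
      · exact ENNReal.inv_le_inv.2 (ENNReal.ofReal_le_ofReal (by linarith))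
      · unfold eventGain
        exact add_le_add (mul_le_mul_right (add_le_add (hu2 _ (by omega)) (hu2 _ (by omega))) _)
          (mul_le_mul_right (hu2 _ hz.le) _)
    · have h3 : u z = green ξ κ₂ z y := by simp [hu, hz]
      rw [h3]
      exact h2

/-! ### A Riccati comparison -/

/-- The smaller root of `ρ + 1 / ρ = C`. -/
noncomputable def smallRoot (C : ℝ) : ℝ := (C - Real.sqrt (C ^ 2 - 4)) / 2

theorem smallRoot_mul {C : ℝ} (hC : 2 ≤ C) : smallRoot C * (C - smallRoot C) = 1 := by
  have h := Real.sq_sqrt (show 0 ≤ C ^ 2 - 4 by nlinarith)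
  unfold smallRoot
  nlinarith

theorem smallRoot_pos {C : ℝ} (hC : 2 ≤ C) : 0 < smallRoot C := by
  have h : Real.sqrt (C ^ 2 - 4) < C := by
    rw [Real.sqrt_lt' (by linarith)]
    linarith
  unfold smallRoot
  linarith

/-- The hypothesis says that `ρ` lies between the two roots of the quadratic. -/
theorem smallRoot_le {C ρ : ℝ} (hC : 2 ≤ C) (h : 1 ≤ ρ * (C - ρ)) : smallRoot C ≤ ρ := by
  have h1 := Real.sq_sqrt (show 0 ≤ C ^ 2 - 4 by nlinarith)
  have h2 := Real.sqrt_nonneg (C ^ 2 - 4)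
  by_contra hlt
  unfold smallRoot at hlt
  push Not at hlt
  nlinarith

/-- Positive solutions of `φ x * (c x - φ (x - 1)) = 1` are bounded below by the constant
solution. -/
theorem smallRoot_le_riccati {n : ℤ} {c φ : ℤ → ℝ} {C : ℝ} (hC : 2 ≤ C) (hcC : ∀ x < n, c x ≤ C)
    (hpos : ∀ x < n, 0 < φ x) (hφ : ∀ x < n, φ x * (c x - φ (x - 1)) = 1) {x : ℤ} (hx : x < n) :
    smallRoot C ≤ φ x := by
  have : Nonempty (Iio n) := ⟨⟨x, hx⟩⟩
  -- The half-line offers no initial value to start an induction from. The infimum replaces it: `φ x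
  -- = 1 / (c x - φ (x - 1)) ≥ 1 / (C - ρ)` for all `x` yields `ρ (C - ρ) ≥ 1`.
  set ρ := ⨅ x : Iio n, φ x with hρ
  have hbdd : BddBelow (range fun x : Iio n => φ x) :=
    ⟨0, by rintro _ ⟨⟨x, hx⟩, rfl⟩; exact (hpos x hx).le⟩
  have hle : ∀ x, x < n → ρ ≤ φ x := fun x hx => ciInf_le hbdd ⟨x, hx⟩
  have hsub : ∀ x, x < n → 0 < c x - φ (x - 1) := by
    intro x hx
    by_contra h
    have := hφ x hx
    nlinarith [hpos x hx]
  have hCρ : 0 < C - ρ := by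
    have := hsub x hx
    linarith [hcC x hx, hle (x - 1) (by omega)]
  have h1 : 1 / (C - ρ) ≤ ρ := by
    refine le_ciInf fun ⟨z, hz⟩ => ?_
    rw [div_le_iff₀ hCρ, ← hφ z hz]
    exact mul_le_mul_of_nonneg_left
      (by linarith [hcC z hz, hle (z - 1) (by have : z < n := hz; omega)]) (hpos z hz).le
  rw [div_le_iff₀ hCρ] at h1
  exact (smallRoot_le hC h1).trans (hle x hx)

/-- Comparison of the Riccati recursions with coefficients `c` and `c + 2 * δ`. -/
theorem riccati_ratio {n : ℤ} {c φ₁ φ₂ : ℤ → ℝ} {ρ δ w : ℝ} (hρ : 0 < ρ) (hδ : 0 < δ)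
    (h₁ : ∀ x < n, φ₁ x * (c x - φ₁ (x - 1)) = 1)
    (h₂ : ∀ x < n, φ₂ x * (c x + 2 * δ - φ₂ (x - 1)) = 1)
    (hpos : ∀ x < n, 0 < φ₂ x) (hle : ∀ x < n, φ₂ x ≤ φ₁ x) (hρle : ∀ x < n, ρ ≤ φ₁ x)
    (hw : 0 ≤ w) (hwlt : w * (1 + w - ρ ^ 2 - 2 * δ * ρ) < 2 * δ * ρ) {x : ℤ} (hx : x < n) :
    (1 + w) * φ₂ x ≤ φ₁ x := by
  have : Nonempty (Iio n) := ⟨⟨x, hx⟩⟩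
  set U := ⨅ x : Iio n, (φ₁ x / φ₂ x - 1) with hU
  have hone : ∀ x, x < n → 0 ≤ φ₁ x / φ₂ x - 1 := by
    intro x hx
    rw [sub_nonneg, one_le_div (hpos x hx)]
    exact hle x hx
  have hbdd : BddBelow (range fun x : Iio n => φ₁ x / φ₂ x - 1) :=
    ⟨0, by rintro _ ⟨⟨x, hx⟩, rfl⟩; exact hone x hx⟩
  have hUle : ∀ x, x < n → U ≤ φ₁ x / φ₂ x - 1 := fun x hx => ciInf_le hbdd ⟨x, hx⟩
  have hU0 : 0 ≤ U := le_ciInf fun ⟨z, hz⟩ => hone z hz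
  have hmul : ∀ x, x < n → (1 + U) * φ₂ x ≤ φ₁ x := by
    intro x hx
    have h := hUle x hx
    have h3 : 1 + U ≤ φ₁ x / φ₂ x := by linarith
    rwa [le_div_iff₀ (hpos x hx)] at h3
  -- Subtracting the recursions gives `φ₁/φ₂ - 1 = φ₁ (2δ + φ₁(x-1) - φ₂(x-1))`. By the definition
  -- of `U`, the last difference is at least `φ₁(x-1) U/(1+U)`. Again an infimum over the half-line
  -- stands in for initial data.
  have hstep : ρ * (2 * δ + ρ * (U / (1 + U))) ≤ U := by
    refine le_ciInf fun ⟨z, hz⟩ => ?_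
    have hz : z < n := hz
    have hz1 : z - 1 < n := by omega
    have hp2 := hpos z hz
    have hp1 : 0 < φ₁ z := hp2.trans_le (hle z hz)
    have hr : φ₁ z / φ₂ z - 1 = φ₁ z * (2 * δ + (φ₁ (z - 1) - φ₂ (z - 1))) := by
      have e2 : 1 / φ₂ z = c z + 2 * δ - φ₂ (z - 1) := by
        rw [div_eq_iff hp2.ne', mul_comm]; exact (h₂ z hz).symm
      rw [div_eq_mul_one_div, e2, ← h₁ z hz]
      ring
    have hdiff : φ₁ (z - 1) * (U / (1 + U)) ≤ φ₁ (z - 1) - φ₂ (z - 1) := by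
      have h := hmul (z - 1) hz1
      have h3 : φ₁ (z - 1) * (U / (1 + U)) = φ₁ (z - 1) - φ₁ (z - 1) / (1 + U) := by
        field_simp
        ring
      rw [h3]
      have h4 : φ₂ (z - 1) ≤ φ₁ (z - 1) / (1 + U) := by
        rw [le_div_iff₀ (by linarith)]
        linarith
      linarith
    have hUU : 0 ≤ U / (1 + U) := by positivity
    show _ ≤ φ₁ z / φ₂ z - 1
    rw [hr]
    have h5 : ρ * (U / (1 + U)) ≤ φ₁ (z - 1) - φ₂ (z - 1) :=
      (mul_le_mul_of_nonneg_right (hρle _ hz1) hUU).trans hdiff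
    exact mul_le_mul (hρle z hz) (by linarith) (by positivity) hp1.le
  have hU1 : 2 * δ * ρ ≤ U * (1 + U - ρ ^ 2 - 2 * δ * ρ) := by
    have h := mul_le_mul_of_nonneg_right hstep (show 0 ≤ 1 + U by linarith)
    have h6 : ρ * (2 * δ + ρ * (U / (1 + U))) * (1 + U) = ρ * (2 * δ * (1 + U) + ρ * U) := by
      field_simp
    rw [h6] at h
    nlinarith
  -- On the range where its second factor is positive, `u (1 + u - ρ² - 2δρ)` increases in `u ≥ 0`.
  -- It is at least `2δρ` at `U` and smaller at `w`.
  have hwU : w ≤ U := by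
    by_contra hlt
    push Not at hlt
    have hpos2 : 0 < 2 * δ * ρ := by positivity
    have h7 : 0 < 1 + U - ρ ^ 2 - 2 * δ * ρ := by
      by_contra h8
      nlinarith
    nlinarith
  refine le_trans ?_ (hmul x hx)
  exact mul_le_mul_of_nonneg_right (by linarith) (hpos x hx).le

/-- The condition on `w` in `riccati_ratio` is, for small `δ`, met by `w = s * δ` whenever
`s * (1 - ρ ^ 2) < 2 * ρ`. -/
theorem le_of_forall_small_log {Δ v : ℝ} (hΔ : 0 ≤ Δ) (hv : 0 < v)
    (h : ∀ δ w : ℝ, 0 < δ → δ < 1 → 0 ≤ w →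
      w * (1 + w - smallRoot (2 * (1 + Δ + δ ^ 2)) ^ 2 -
        2 * δ * smallRoot (2 * (1 + Δ + δ ^ 2))) < 2 * δ * smallRoot (2 * (1 + Δ + δ ^ 2)) →
      v * Real.log (1 + w) ≤ δ + δ ^ 2) :
    v ≤ Real.sqrt (Δ * (2 + Δ)) := by
  by_contra hlt
  push Not at hlt
  have hV0 := Real.sqrt_nonneg (Δ * (2 + Δ))
  have hVsq := Real.sq_sqrt (show 0 ≤ Δ * (2 + Δ) by positivity)
  set V := Real.sqrt (Δ * (2 + Δ)) with hV
  have hC2 : 2 ≤ 2 * (1 + Δ + 0 ^ 2) := by linarith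
  have hr0 := smallRoot_pos hC2
  have hr1 := smallRoot_mul hC2
  have hrV : smallRoot (2 * (1 + Δ + 0 ^ 2)) = 1 + Δ - V := by
    have : (2 * (1 + Δ + 0 ^ 2)) ^ 2 - 4 = 2 ^ 2 * (Δ * (2 + Δ)) := by ring
    rw [smallRoot, this, Real.sqrt_mul (by positivity), Real.sqrt_sq (by norm_num), ← hV]
    ring
  -- a slope strictly between `1 / v` and `1 / V`
  obtain ⟨s, hs1, hs2⟩ : ∃ s : ℝ, 1 < v * s ∧
      s * (1 - smallRoot (2 * (1 + Δ + 0 ^ 2)) ^ 2) < 2 * smallRoot (2 * (1 + Δ + 0 ^ 2)) := by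
    refine ⟨2 / (v + V), ?_, ?_⟩
    · rw [← mul_div_assoc, lt_div_iff₀ (by linarith)]
      linarith
    -- The limiting root `ρ = 1 + Δ - V` has inverse `1 + Δ + V`, so `1 - ρ² = 2Vρ` and the claim
    -- amounts to `s V < 1`.
    · rw [div_mul_eq_mul_div, div_lt_iff₀ (by linarith)]
      rw [hrV] at hr0 hr1 ⊢
      nlinarith
  have hs : 0 < s := by
    by_contra h0
    nlinarith
  have hcont : ContinuousAt (fun δ : ℝ => smallRoot (2 * (1 + Δ + δ ^ 2))) 0 := by
    unfold smallRoot
    fun_prop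
  -- This is the condition on `w = s * δ` divided by `δ`; its limit at zero is negative by the
  -- choice of `s`.
  have hlim1 : Tendsto (fun δ : ℝ => s * (1 + s * δ - smallRoot (2 * (1 + Δ + δ ^ 2)) ^ 2 -
        2 * δ * smallRoot (2 * (1 + Δ + δ ^ 2))) - 2 * smallRoot (2 * (1 + Δ + δ ^ 2))) (𝓝[>] 0)
      (𝓝 (s * (1 + s * 0 - smallRoot (2 * (1 + Δ + 0 ^ 2)) ^ 2 -
        2 * 0 * smallRoot (2 * (1 + Δ + 0 ^ 2))) - 2 * smallRoot (2 * (1 + Δ + 0 ^ 2)))) := by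
    refine Tendsto.mono_left (ContinuousAt.tendsto (f := fun δ : ℝ =>
      s * (1 + s * δ - smallRoot (2 * (1 + Δ + δ ^ 2)) ^ 2 -
        2 * δ * smallRoot (2 * (1 + Δ + δ ^ 2))) - 2 * smallRoot (2 * (1 + Δ + δ ^ 2))) ?_)
      nhdsWithin_le_nhds
    fun_prop
  have hev1 := hlim1.eventually_lt_const (u := 0) (by linarith)
  -- A positive derivative `v s - 1` at zero makes `v log (1 + sδ)` exceed `δ + δ²` for small `δ >
  -- 0`, against the hypothesis.
  have hderiv : HasDerivAt (fun δ : ℝ => v * Real.log (1 + s * δ) - (δ + δ ^ 2)) (v * s - 1) 0 := by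
    have h1 : HasDerivAt (fun δ : ℝ => 1 + s * δ) s 0 := by
      simpa using ((hasDerivAt_id (0 : ℝ)).const_mul s).const_add 1
    have h2 := (h1.log (by norm_num)).const_mul v
    have h3 := h2.sub ((hasDerivAt_id (0 : ℝ)).add (hasDerivAt_pow 2 (0 : ℝ)))
    have h4 : v * s - 1 = v * (s / (1 + s * 0)) - (1 + ((2 : ℕ) : ℝ) * 0 ^ (2 - 1)) := by norm_num
    rw [h4]
    exact h3
  have hev2 : ∀ᶠ δ in 𝓝[>] (0 : ℝ), 0 < v * Real.log (1 + s * δ) - (δ + δ ^ 2) := by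
    have hslope := (hasDerivAt_iff_tendsto_slope.1 hderiv).mono_left
      (nhdsWithin_mono 0 fun x (hx : (0 : ℝ) < x) => hx.ne')
    have hev := hslope.eventually_const_lt (u := 0) (by linarith)
    filter_upwards [hev, self_mem_nhdsWithin] with δ h1 h2
    have h2' : (0 : ℝ) < δ := h2
    rw [slope_def_field] at h1
    simp only [mul_zero, add_zero, Real.log_one, sub_zero, ne_eq, OfNat.ofNat_ne_zero,
      not_false_eq_true, zero_pow] at h1
    exact (div_pos_iff_of_pos_right h2').1 h1
  have hev3 : ∀ᶠ δ in 𝓝[>] (0 : ℝ), δ < 1 :=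
    nhdsWithin_le_nhds (eventually_lt_nhds one_pos)
  obtain ⟨δ, h1, h2, h3, h4⟩ :=
    (hev1.and (hev2.and (hev3.and self_mem_nhdsWithin))).exists
  have h4' : (0 : ℝ) < δ := h4
  have := h δ (s * δ) h4' h3 (by positivity) (by nlinarith)
  linarith

/-! ### Growth rates in a fixed bounded environment -/

section Quenched

variable {ξ : ℤ → ℝ} {M : ℝ} (hξ : ∀ z, 0 < ξ z) (hM : ∀ z, ξ z ≤ M)

include hξ hM in
theorem expectedCount_ne_top (x y : ℤ) {t : ℝ} (ht : 0 ≤ t) : expectedCount ξ x t y ≠ ⊤ :=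
  ((expectedCount_le_exp hξ hM x y ht).trans_lt ENNReal.ofReal_lt_top).ne

include hξ hM in
theorem toReal_expectedCount_pos (x y : ℤ) {t : ℝ} (ht : 0 < t) :
    0 < (expectedCount ξ x t y).toReal :=
  ENNReal.toReal_pos (expectedCount_pos hξ hM x y ht).ne' (expectedCount_ne_top hξ hM x y ht.le)

include hξ hM in
theorem le_expectedCount_self_of_le (x : ℤ) {t : ℝ} (ht : 0 ≤ t) :
    ENNReal.ofReal (Real.exp (-((1 + M) * t))) ≤ expectedCount ξ x t x := by
  refine le_trans (ENNReal.ofReal_le_ofReal (Real.exp_le_exp.2 (neg_le_neg ?_)))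
    (le_expectedCount_self hξ x ht)
  exact mul_le_mul_of_nonneg_right (by linarith [hM x]) ht

variable {a : ℝ} (ha : Tendsto (fun t : ℝ => (1 / t) * Real.log (expectedCount ξ 0 t 0).toReal)
  atTop (𝓝 a))

include hξ hM ha in
theorem exists_expectedCount_le {b : ℝ} (hb : a < b) :
    ∃ C, 0 < C ∧ ∀ t, 0 ≤ t → expectedCount ξ 0 t 0 ≤ ENNReal.ofReal (C * Real.exp (b * t)) := by
  obtain ⟨T, hT⟩ := eventually_atTop.1 ((ha.eventually_lt_const hb).and (eventually_gt_atTop 0))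
  have hT0 : 0 < T := (hT T le_rfl).2
  have hM0 : 0 < M := (hξ 0).trans_le (hM 0)
  -- The growth rate controls times from `T` on; for `t < T` the constant absorbs both `exp (M t)`
  -- and a possibly small `exp (b t)`.
  refine ⟨Real.exp ((M + |b|) * T), Real.exp_pos _, fun t ht => ?_⟩
  rcases le_or_gt T t with h | h
  · obtain ⟨h1, h2⟩ := hT t h
    have hk := toReal_expectedCount_pos hξ hM 0 0 h2
    rw [one_div, inv_mul_lt_iff₀ h2, Real.log_lt_iff_lt_exp hk] at h1
    rw [← ENNReal.ofReal_toReal (expectedCount_ne_top hξ hM 0 0 ht)]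
    refine ENNReal.ofReal_le_ofReal (h1.le.trans ?_)
    rw [mul_comm t b]
    exact le_mul_of_one_le_left (Real.exp_nonneg _) (Real.one_le_exp (by positivity))
  · refine (expectedCount_le_exp hξ hM 0 0 ht).trans (ENNReal.ofReal_le_ofReal ?_)
    rw [← Real.exp_add]
    refine Real.exp_le_exp.2 ?_
    have h1 : -(|b| * T) ≤ b * t := by
      have := neg_abs_le (b * t)
      rw [abs_mul, abs_of_nonneg ht] at this
      nlinarith [abs_nonneg b]
    nlinarith

include hξ hM ha in
theorem exists_le_expectedCount {b : ℝ} (hb : b < a) :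
    ∃ c, 0 < c ∧ ∀ t, 0 ≤ t → ENNReal.ofReal (c * Real.exp (b * t)) ≤ expectedCount ξ 0 t 0 := by
  obtain ⟨T, hT⟩ := eventually_atTop.1 ((ha.eventually_const_lt hb).and (eventually_gt_atTop 0))
  have hT0 : 0 < T := (hT T le_rfl).2
  have hM0 : 0 < M := (hξ 0).trans_le (hM 0)
  refine ⟨Real.exp (-((1 + M + |b|) * T)), Real.exp_pos _, fun t ht => ?_⟩
  rcases le_or_gt T t with h | h
  · obtain ⟨h1, h2⟩ := hT t h
    have hk := toReal_expectedCount_pos hξ hM 0 0 h2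
    rw [one_div, lt_inv_mul_iff₀ h2, Real.lt_log_iff_exp_lt hk] at h1
    rw [← ENNReal.ofReal_toReal (expectedCount_ne_top hξ hM 0 0 ht)]
    refine ENNReal.ofReal_le_ofReal (le_trans ?_ h1.le)
    rw [mul_comm t b]
    refine mul_le_of_le_one_left (Real.exp_nonneg _) (Real.exp_le_one_iff.2 ?_)
    exact neg_nonpos.2 (by positivity)
  · refine le_trans (ENNReal.ofReal_le_ofReal ?_) (le_expectedCount_self_of_le hξ hM 0 ht)
    rw [← Real.exp_add]
    refine Real.exp_le_exp.2 ?_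
    have h1 : b * t ≤ |b| * T := by
      have := le_abs_self (b * t)
      rw [abs_mul, abs_of_nonneg ht] at this
      nlinarith [abs_nonneg b]
    nlinarith

include hξ hM ha in
theorem growth_rate_le : a ≤ M := by
  refine le_of_tendsto ha ?_
  filter_upwards [eventually_gt_atTop 0] with t ht
  have hk := toReal_expectedCount_pos hξ hM 0 0 ht
  rw [one_div, inv_mul_le_iff₀ ht, Real.log_le_iff_le_exp hk, mul_comm t]
  exact ENNReal.toReal_le_of_le_ofReal (Real.exp_nonneg _)
    (expectedCount_le_exp hξ hM 0 0 ht.le)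

include hξ hM in
/-- A lower bound of Green's function by the expected number of particles at one time. -/
theorem expectedCount_le_green (κ : ℝ) (x y : ℤ) {t : ℝ} (ht : 0 ≤ t) :
    ENNReal.ofReal (Real.exp (-(|κ| + 1 + M)) * Real.exp (-(κ * t))) * expectedCount ξ x t y ≤
      green ξ κ x y := by
  have hM0 : 0 < M := (hξ 0).trans_le (hM 0)
  -- The Laplace integral is restricted to `(t, t + 1]`: a particle at `y` at time `t` remains there
  -- up to a factor `exp (-(1 + M))`, and the weight changes by at most `exp (-|κ|)`.
  have hone : ∀ c : ℝ≥0∞, c = ∫⁻ r in Ioc t (t + 1), c := by intro c; simp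
  rw [hone (_ * _), green]
  refine le_trans ?_ (lintegral_mono_set (s := Ioc t (t + 1)) fun s hs => ht.trans_lt hs.1)
  refine setLIntegral_mono (Measurable.mul (by fun_prop) (measurable_expectedCount ξ x y))
    fun s hs => ?_
  have h1 := expectedCount_mul_le hξ x y y ht (s := s - t) (by linarith [hs.1])
  have h2 := le_expectedCount_self_of_le hξ hM y (t := s - t) (by linarith [hs.1])
  rw [add_sub_cancel] at h1
  refine le_trans ?_ (mul_le_mul_right ((mul_le_mul_right h2 _).trans h1) _)
  rw [mul_left_comm, ← ENNReal.ofReal_mul (Real.exp_nonneg _), mul_comm]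
  refine mul_le_mul_right (ENNReal.ofReal_le_ofReal ?_) _
  rw [← Real.exp_add, ← Real.exp_add]
  refine Real.exp_le_exp.2 ?_
  have h3 : κ * (s - t) ≤ |κ| := by
    refine (le_abs_self _).trans ?_
    rw [abs_mul, abs_of_nonneg (by linarith [hs.1] : 0 ≤ s - t)]
    exact mul_le_of_le_one_right (abs_nonneg κ) (by linarith [hs.2])
  have h4 : (1 + M) * (s - t) ≤ 1 + M := mul_le_of_le_one_right (by linarith) (by linarith [hs.2])
  nlinarith

include hξ hM in
theorem green_ne_zero (κ : ℝ) (x y : ℤ) : green ξ κ x y ≠ 0 := by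
  have h := expectedCount_le_green hξ hM κ x y zero_le_one
  refine ((ENNReal.mul_pos ?_ (expectedCount_pos hξ hM x y one_pos).ne').trans_le h).ne'
  exact (ENNReal.ofReal_pos.2 (by positivity)).ne'

include hξ hM ha in
-- Going from `0` to `x` and from `y` back to `0`, in unit time each, turns particles from `x` to
-- `y` into returns to the origin, whose growth rate is `a < κ`.
theorem green_ne_top {κ : ℝ} (hκ : a < κ) (x y : ℤ) : green ξ κ x y ≠ ⊤ := by
  obtain ⟨b, hab, hbκ⟩ := exists_between hκ
  obtain ⟨C, hC, hCle⟩ := exists_expectedCount_le hξ hM ha hab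
  have h0 := (expectedCount_pos hξ hM 0 x one_pos).ne'
  have h1 := (expectedCount_pos hξ hM y 0 one_pos).ne'
  have h2 : green ξ κ x y * (expectedCount ξ 0 1 x * expectedCount ξ y 1 0) ≤
      ENNReal.ofReal (C * Real.exp (2 * b)) * (ENNReal.ofReal (κ - b))⁻¹ := by
    have hmK := measurable_expectedCount ξ x y
    rw [← lintegral_exp_neg_mul, ← lintegral_const_mul _ (by fun_prop), green,
      ← lintegral_mul_const _ (by fun_prop)]
    refine setLIntegral_mono (by fun_prop) fun t ht => ?_
    have ht' : (0 : ℝ) < t := ht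
    have h3 := (mul_le_mul_left (expectedCount_mul_le hξ 0 x y zero_le_one ht'.le)
      (expectedCount ξ y 1 0)).trans (expectedCount_mul_le hξ 0 y 0
        (by linarith : (0 : ℝ) ≤ 1 + t) zero_le_one)
    have h4 := h3.trans (hCle _ (by linarith))
    calc _ = ENNReal.ofReal (Real.exp (-(κ * t))) *
          (expectedCount ξ 0 1 x * expectedCount ξ x t y * expectedCount ξ y 1 0) := by ring
      _ ≤ ENNReal.ofReal (Real.exp (-(κ * t))) *
          ENNReal.ofReal (C * Real.exp (b * (1 + t + 1))) := mul_le_mul_right h4 _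
      _ = _ := by
        rw [← ENNReal.ofReal_mul (Real.exp_nonneg _), ← ENNReal.ofReal_mul (by positivity),
          mul_left_comm, ← Real.exp_add, mul_assoc, ← Real.exp_add]
        ring_nf
  have h5 : ENNReal.ofReal (C * Real.exp (2 * b)) * (ENNReal.ofReal (κ - b))⁻¹ ≠ ⊤ :=
    ENNReal.mul_ne_top ENNReal.ofReal_ne_top
      (ENNReal.inv_ne_top.2 (ENNReal.ofReal_pos.2 (by linarith)).ne')
  intro htop
  rw [htop, ENNReal.top_mul (mul_ne_zero h0 h1)] at h2
  exact h5 (top_le_iff.1 h2)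

include hξ hM ha in
/-- Green's function, as a real function of its starting point. -/
theorem toReal_green_eq {κ : ℝ} (hκ : a < κ) {x y : ℤ} (hxy : x ≠ y) :
    2 * (κ + 1 - ξ x) * (green ξ κ x y).toReal =
      (green ξ κ (x + 1) y).toReal + (green ξ κ (x - 1) y).toReal := by
  have hfin := fun z => green_ne_top hξ hM ha hκ z y
  have hne := fun z => green_ne_zero hξ hM κ z y
  have h := green_eq hξ κ x y
  rw [if_neg hxy, zero_add] at h
  have hg : eventGain ξ (fun z => green ξ κ z y) x ≠ 0 := by
    unfold eventGain
    have := hne (x + 1)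
    simp [this]
  -- Otherwise the prefactor in `green_eq` would be `⊤`, against finiteness of Green's function.
  have hpos : 0 < κ + (1 + ξ x) := by
    by_contra hle
    rw [ENNReal.ofReal_of_nonpos (not_lt.1 hle), ENNReal.inv_zero, ENNReal.top_mul hg] at h
    exact hfin x h
  have h2 : ENNReal.ofReal (κ + (1 + ξ x)) * green ξ κ x y =
      eventGain ξ (fun z => green ξ κ z y) x := by
    conv_lhs => rw [h]
    rw [← mul_assoc, ENNReal.mul_inv_cancel (ENNReal.ofReal_pos.2 hpos).ne' ENNReal.ofReal_ne_top,
      one_mul]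
  have h3 := congrArg ENNReal.toReal h2
  have hx := hξ x
  unfold eventGain at h3
  rw [ENNReal.toReal_mul, ENNReal.toReal_ofReal hpos.le, ENNReal.toReal_add, ENNReal.toReal_mul,
    ENNReal.toReal_add (hfin _) (hfin _), ENNReal.toReal_mul, ENNReal.toReal_mul,
    ENNReal.toReal_ofReal hx.le] at h3
  · simp only [ENNReal.toReal_inv, ENNReal.toReal_ofNat] at h3
    linarith
  · exact ENNReal.mul_ne_top (by simp) (ENNReal.add_ne_top.2 ⟨hfin _, hfin _⟩)
  · exact ENNReal.mul_ne_top (ENNReal.mul_ne_top (by simp) ENNReal.ofReal_ne_top) (hfin _)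

include hξ hM ha in
-- The quotients of neighbouring values solve the Riccati recursions with coefficients differing by
-- `2δ`. Each site between `0` and `n` contributes a factor `1 + w`, and at the target itself
-- Green's function decreases in `κ`.
theorem green_ratio {κ δ C w : ℝ} (hκ : a < κ) (hδ : 0 < δ) (hC : 2 ≤ C)
    (hcC : ∀ x, 2 * (κ + 1 - ξ x) ≤ C) (hw : 0 ≤ w)
    (hwlt : w * (1 + w - smallRoot C ^ 2 - 2 * δ * smallRoot C) < 2 * δ * smallRoot C) (n : ℕ) :
    (1 + w) ^ n * (green ξ (κ + δ) 0 n).toReal ≤ (green ξ κ 0 n).toReal := by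
  have hκ' : a < κ + δ := by linarith
  set g₁ : ℤ → ℝ := fun x => (green ξ κ x n).toReal with hg₁
  set g₂ : ℤ → ℝ := fun x => (green ξ (κ + δ) x n).toReal with hg₂
  have hp₁ : ∀ x, 0 < g₁ x := fun x =>
    ENNReal.toReal_pos (green_ne_zero hξ hM κ x n) (green_ne_top hξ hM ha hκ x n)
  have hp₂ : ∀ x, 0 < g₂ x := fun x =>
    ENNReal.toReal_pos (green_ne_zero hξ hM _ x n) (green_ne_top hξ hM ha hκ' x n)
  have he₁ : ∀ x < (n : ℤ), g₁ x / g₁ (x + 1) *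
      (2 * (κ + 1 - ξ x) - g₁ (x - 1) / g₁ (x - 1 + 1)) = 1 := by
    intro x hx
    have h := toReal_green_eq hξ hM ha hκ (x := x) (y := n) (by omega)
    have h1 := (hp₁ x).ne'
    have h2 := (hp₁ (x + 1)).ne'
    rw [sub_add_cancel]
    change 2 * (κ + 1 - ξ x) * g₁ x = g₁ (x + 1) + g₁ (x - 1) at h
    field_simp
    linarith
  have he₂ : ∀ x < (n : ℤ), g₂ x / g₂ (x + 1) *
      (2 * (κ + 1 - ξ x) + 2 * δ - g₂ (x - 1) / g₂ (x - 1 + 1)) = 1 := by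
    intro x hx
    have h := toReal_green_eq hξ hM ha hκ' (x := x) (y := n) (by omega)
    have h1 := (hp₂ x).ne'
    have h2 := (hp₂ (x + 1)).ne'
    rw [sub_add_cancel]
    change 2 * (κ + δ + 1 - ξ x) * g₂ x = g₂ (x + 1) + g₂ (x - 1) at h
    field_simp
    linarith
  have hmono : ∀ x < (n : ℤ), g₂ x / g₂ (x + 1) ≤ g₁ x / g₁ (x + 1) := by
    intro x hx
    rw [div_le_div_iff₀ (hp₂ _) (hp₁ _)]
    have h := green_mul_green_le hξ (by linarith : κ ≤ κ + δ) (fun z => green_ne_zero hξ hM κ z n)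
      (fun z => green_ne_top hξ hM ha hκ z n) (lt_add_one x) (by omega : x + 1 ≤ n)
    have h2 := ENNReal.toReal_mono (ENNReal.mul_ne_top (green_ne_top hξ hM ha hκ' _ _)
      (green_ne_top hξ hM ha hκ _ _)) h
    rw [ENNReal.toReal_mul, ENNReal.toReal_mul] at h2
    exact h2.trans_eq (mul_comm _ _)
  have hρ := fun x (hx : x < (n : ℤ)) => smallRoot_le_riccati (φ := fun x => g₁ x / g₁ (x + 1)) hC
    (fun x _ => hcC x) (fun x _ => div_pos (hp₁ _) (hp₁ _)) he₁ hx
  have hratio := fun x (hx : x < (n : ℤ)) => riccati_ratio (φ₁ := fun x => g₁ x / g₁ (x + 1))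
    (φ₂ := fun x => g₂ x / g₂ (x + 1)) (smallRoot_pos hC) hδ he₁ he₂
    (fun x _ => div_pos (hp₂ _) (hp₂ _)) hmono hρ hw hwlt hx
  have hend : g₂ n ≤ g₁ n := by
    refine ENNReal.toReal_mono (green_ne_top hξ hM ha hκ _ _) ?_
    refine setLIntegral_mono (Measurable.mul (by fun_prop) (measurable_expectedCount ξ _ _))
      fun t ht => mul_le_mul_left (ENNReal.ofReal_le_ofReal (Real.exp_le_exp.2 ?_)) _
    have ht' : (0 : ℝ) < t := ht
    nlinarith
  -- The product of the ratios telescopes, built up leftwards from `n`.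
  have key : ∀ k : ℕ, k ≤ n → (1 + w) ^ k * g₂ (n - k) ≤ g₁ (n - k) := by
    intro k
    induction k with
    | zero => intro _; simpa using hend
    | succ k ih =>
      intro hk
      have h1 := ih (by omega)
      have h2 := hratio (n - (k + 1 : ℕ)) (by push_cast; omega)
      have e : (n : ℤ) - (k + 1 : ℕ) + 1 = n - k := by push_cast; ring
      rw [e] at h2
      rw [le_div_iff₀ (hp₁ _)] at h2
      refine le_trans ?_ h2
      have h3 : (1 + w) * (g₂ (n - (k + 1 : ℕ)) / g₂ (n - k)) * ((1 + w) ^ k * g₂ (n - k)) =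
          (1 + w) ^ (k + 1) * g₂ (n - (k + 1 : ℕ)) := by
        have := (hp₂ (n - k)).ne'
        field_simp
        ring
      rw [← h3]
      refine mul_le_mul_of_nonneg_left h1 ?_
      have := hp₂ (n - (k + 1 : ℕ))
      have := hp₂ (n - k)
      positivity
  simpa using key n le_rfl

include hξ hM ha in
/-- At small speeds, Green's function above the growth rate is carried by the times before `t`,
and the remaining time can be spent at the origin. -/
theorem exists_green_le {κ : ℝ} (hκ : a < κ) :
    ∃ v₁, 0 < v₁ ∧ ∀ b, b < a → ∃ C, 0 < C ∧ ∀ᶠ t : ℝ in atTop, ∀ n : ℕ, (n : ℝ) ≤ v₁ * t →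
      (green ξ κ 0 n).toReal ≤
        C * t * Real.exp (-(b * t)) * (expectedCount ξ 0 t n).toReal := by
  obtain ⟨b', hab', hbκ'⟩ := exists_between hκ
  obtain ⟨C₁, hC₁, hC₁le⟩ := exists_expectedCount_le hξ hM ha hab'
  set ε := κ - b' with hε
  have hε0 : 0 < ε := by linarith
  set c₀ := Real.exp (-(2 * (1 + M))) / 2 with hc₀
  have hc₀0 : 0 < c₀ := by positivity
  -- Per-site factors: `B ^ n` bounds from above the cost of replacing the count at `n` by returns
  -- to the origin, and `A ^ n` bounds Green's function from below by travelling at speed one. Here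
  -- `c₀` is the price of one neighbour step in unit time.
  set B := Real.exp b' / c₀ with hB
  have hB0 : 0 < B := by positivity
  set A := c₀ * Real.exp (-κ) with hA
  have hA0 : 0 < A := by positivity
  set c₁ := Real.exp (-(|κ| + 1 + M)) with hc₁
  have hc₁0 : 0 < c₁ := Real.exp_pos _
  set β := |Real.log (B / A)| with hβ
  have hβ0 : 0 ≤ β := abs_nonneg _
  -- With this speed `(B / A) ^ n ≤ exp (ε t / 2)`, so the decay `exp (-ε t)` of the tail still
  -- wins.
  refine ⟨ε / (2 * (β + 1)), by positivity, fun b hb => ?_⟩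
  obtain ⟨c, hc, hcle⟩ := exists_le_expectedCount hξ hM ha hb
  refine ⟨2 / c, by positivity, ?_⟩
  have htail : ∀ᶠ t : ℝ in atTop, C₁ / ε * Real.exp (-(ε / 2 * t)) ≤ c₁ / 2 := by
    have h1 : Tendsto (fun t : ℝ => C₁ / ε * Real.exp (-(ε / 2 * t))) atTop (𝓝 (C₁ / ε * 0)) := by
      refine Tendsto.const_mul _ (Real.tendsto_exp_neg_atTop_nhds_zero.comp ?_)
      exact tendsto_id.const_mul_atTop (by positivity)
    rw [mul_zero] at h1
    exact (h1.eventually_lt_const (by positivity : 0 < c₁ / 2)).mono fun _ h => h.le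
  filter_upwards [htail, eventually_gt_atTop 0] with t ht ht0 n hn
  have hkt := expectedCount_ne_top hξ hM 0 n ht0.le
  have hgfin := green_ne_top hξ hM ha hκ 0 n
  have hstep1 : ENNReal.ofReal (c₀ ^ n) ≤ expectedCount ξ 0 n n := by
    have h := le_expectedCount_right hξ hM zero_le_one 0 n
    rw [ENNReal.ofReal_pow hc₀0.le]
    simpa [hc₀] using h
  have hstep2 : ENNReal.ofReal (c₀ ^ n) ≤ expectedCount ξ n n 0 := by
    have h := le_expectedCount_left hξ hM zero_le_one n n
    rw [ENNReal.ofReal_pow hc₀0.le]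
    simpa [hc₀] using h
  have hlow : c₁ * A ^ n ≤ (green ξ κ 0 n).toReal := by
    have h := (mul_le_mul_right hstep1 _).trans (expectedCount_le_green hξ hM κ 0 n n.cast_nonneg)
    rw [← ENNReal.ofReal_mul (by positivity)] at h
    have h2 := (ENNReal.ofReal_le_iff_le_toReal hgfin).1 h
    refine le_trans (le_of_eq ?_) h2
    rw [hA, mul_pow, ← Real.exp_nat_mul, hc₁]
    ring_nf
  have hupper : ∀ s, 0 ≤ s → expectedCount ξ 0 s n ≤
      ENNReal.ofReal (C₁ * B ^ n * Real.exp (b' * s)) := by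
    intro s hs
    have h1 := (expectedCount_mul_le hξ 0 n 0 hs (n.cast_nonneg : (0 : ℝ) ≤ n)).trans
      (hC₁le _ (by positivity))
    have h2 := (mul_le_mul_right hstep2 (expectedCount ξ 0 s n)).trans h1
    have h3 : ENNReal.ofReal (C₁ * Real.exp (b' * (s + n))) =
        ENNReal.ofReal (C₁ * B ^ n * Real.exp (b' * s)) * ENNReal.ofReal (c₀ ^ n) := by
      rw [← ENNReal.ofReal_mul (by positivity), hB, div_pow, ← Real.exp_nat_mul, mul_add,
        Real.exp_add]
      congr 1
      field_simp
    rw [h3] at h2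
    exact (ENNReal.mul_le_mul_iff_left (ENNReal.ofReal_pos.2 (by positivity)).ne'
      ENNReal.ofReal_ne_top).1 h2
  have htailint : ∫⁻ s in Ioi t, ENNReal.ofReal (Real.exp (-(κ * s))) * expectedCount ξ 0 s n ≤
      ENNReal.ofReal (C₁ / ε * B ^ n * Real.exp (-(ε * t))) := by
    have h1 : ENNReal.ofReal (C₁ / ε * B ^ n * Real.exp (-(ε * t))) =
        ENNReal.ofReal (C₁ / ε * B ^ n) *
          ∫⁻ s in Ioi t, ENNReal.ofReal (ε * Real.exp (-(ε * s))) := by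
      rw [lintegral_exp_neg_mul_Ioi hε0, ← ENNReal.ofReal_mul (by positivity)]
    rw [h1, ← lintegral_const_mul _ (by fun_prop)]
    refine setLIntegral_mono (by fun_prop) fun s hs => ?_
    refine (mul_le_mul_right (hupper s (ht0.le.trans (le_of_lt hs))) _).trans (le_of_eq ?_)
    rw [← ENNReal.ofReal_mul (by positivity), ← ENNReal.ofReal_mul (by positivity)]
    congr 1
    have h2 : Real.exp (-(ε * s)) = Real.exp (-(κ * s)) * Real.exp (b' * s) := by
      rw [← Real.exp_add, hε]
      ring_nf
    rw [h2]
    field_simp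
  -- The tail after `t` is at most half of Green's function and can be absorbed, which is the origin
  -- of the 2 in the constant `2 / c`.
  have hhalf : C₁ / ε * B ^ n * Real.exp (-(ε * t)) ≤ (green ξ κ 0 n).toReal / 2 := by
    have h1 : B ^ n ≤ A ^ n * Real.exp (ε / 2 * t) := by
      have h2 : (B / A) ^ n ≤ Real.exp (ε / 2 * t) := by
        rw [← Real.exp_log (div_pos hB0 hA0), ← Real.exp_nat_mul]
        refine Real.exp_le_exp.2 ?_
        have h3 : (n : ℝ) * Real.log (B / A) ≤ n * β :=
          mul_le_mul_of_nonneg_left (le_abs_self _) n.cast_nonneg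
        have h4 : (n : ℝ) * β ≤ ε / (2 * (β + 1)) * t * β :=
          mul_le_mul_of_nonneg_right hn hβ0
        have h5 : ε / (2 * (β + 1)) * t * β = ε / 2 * t * (β / (β + 1)) := by
          field_simp
        have h6 : β / (β + 1) ≤ 1 := by
          rw [div_le_one (by linarith)]
          linarith
        have h7 : 0 ≤ ε / 2 * t := by positivity
        nlinarith
      rw [div_pow, div_le_iff₀ (by positivity)] at h2
      linarith
    have h8 : Real.exp (-(ε * t)) = Real.exp (-(ε / 2 * t)) * Real.exp (-(ε / 2 * t)) := by
      rw [← Real.exp_add]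
      ring_nf
    have h9 : Real.exp (ε / 2 * t) * Real.exp (-(ε / 2 * t)) = 1 := by
      rw [← Real.exp_add, add_neg_cancel, Real.exp_zero]
    calc C₁ / ε * B ^ n * Real.exp (-(ε * t))
        ≤ C₁ / ε * (A ^ n * Real.exp (ε / 2 * t)) * Real.exp (-(ε * t)) := by gcongr
      _ = C₁ / ε * Real.exp (-(ε / 2 * t)) * A ^ n *
          (Real.exp (ε / 2 * t) * Real.exp (-(ε / 2 * t))) := by rw [h8]; ring
      _ = C₁ / ε * Real.exp (-(ε / 2 * t)) * A ^ n := by rw [h9, mul_one]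
      _ ≤ c₁ / 2 * A ^ n := by gcongr
      _ ≤ _ := by linarith
  have hmain : ∫⁻ s in Ioc 0 t, ENNReal.ofReal (Real.exp (-(κ * s))) * expectedCount ξ 0 s n ≤
      ENNReal.ofReal (t * (Real.exp (-(b * t)) / c) * (expectedCount ξ 0 t n).toReal) := by
    have hconst : ENNReal.ofReal (t * (Real.exp (-(b * t)) / c) *
        (expectedCount ξ 0 t n).toReal) =
        ∫⁻ s in Ioc 0 t, ENNReal.ofReal (Real.exp (-(b * t)) / c) * expectedCount ξ 0 t n := by
      rw [setLIntegral_const, Real.volume_Ioc, sub_zero, mul_assoc,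
        ENNReal.ofReal_mul ht0.le, ENNReal.ofReal_mul (by positivity), ENNReal.ofReal_toReal hkt,
        mul_comm]
    rw [hconst]
    refine setLIntegral_mono measurable_const fun s hs => ?_
    have h1 := (mul_le_mul_left (hcle (t - s) (by linarith [hs.2])) (expectedCount ξ 0 s n)).trans
      (expectedCount_mul_le hξ 0 0 n (by linarith [hs.2] : 0 ≤ t - s) hs.1.le)
    rw [sub_add_cancel] at h1
    refine le_trans ?_ (mul_le_mul_right h1 _)
    rw [← mul_assoc, ← ENNReal.ofReal_mul (by positivity)]
    refine mul_le_mul_left (ENNReal.ofReal_le_ofReal ?_) _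
    have h2 : Real.exp (-(b * t)) / c * (c * Real.exp (b * (t - s))) = Real.exp (-(b * s)) := by
      rw [mul_comm c, div_mul_eq_mul_div, ← mul_assoc, mul_div_cancel_right₀ _ hc.ne',
        ← Real.exp_add]
      ring_nf
    rw [h2]
    refine Real.exp_le_exp.2 ?_
    nlinarith [hs.1]
  have hsplit : green ξ κ 0 n ≤ ENNReal.ofReal
      (t * (Real.exp (-(b * t)) / c) * (expectedCount ξ 0 t n).toReal +
        C₁ / ε * B ^ n * Real.exp (-(ε * t))) := by
    rw [green, ← Ioc_union_Ioi_eq_Ioi ht0.le,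
      lintegral_union measurableSet_Ioi (Ioc_disjoint_Ioi le_rfl),
      ENNReal.ofReal_add (by positivity) (by positivity)]
    exact add_le_add hmain htailint
  have hfinal := ENNReal.toReal_le_of_le_ofReal (by positivity) hsplit
  have h10 : 2 / c * t * Real.exp (-(b * t)) * (expectedCount ξ 0 t n).toReal =
      2 * (t * (Real.exp (-(b * t)) / c) * (expectedCount ξ 0 t n).toReal) := by
    field_simp
  rw [h10]
  linarith

end Quenched

/-! ### The bound on the critical speed -/

theorem toNat_floor_eq {x : ℝ} (hx : 0 ≤ x) : ((⌊x⌋.toNat : ℕ) : ℤ) = ⌊x⌋ :=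
  Int.toNat_of_nonneg (Int.floor_nonneg.2 hx)

/-- Green's function at `n = ⌊vt⌋` is bounded below at `κ + δ` by the count at time `t`, and above
at `κ` by the count at time `vt/v₀`, at which `n` has speed `v₀`. `green_ratio` links the two
bounds; logarithms divided by `t` give the claim. -/
theorem growth_rate_inequality {ξ : ℤ → ℝ} {M a κ δ C w v : ℝ} (hξ : ∀ z, 0 < ξ z)
    (hM : ∀ z, ξ z ≤ M)
    (ha : Tendsto (fun t : ℝ => (1 / t) * Real.log (expectedCount ξ 0 t 0).toReal) atTop (𝓝 a))
    (hκ : a < κ) (hδ : 0 < δ) (hC : 2 ≤ C) (hcC : ∀ x, 2 * (κ + 1 - ξ x) ≤ C) (hw : 0 ≤ w)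
    (hwlt : w * (1 + w - smallRoot C ^ 2 - 2 * δ * smallRoot C) < 2 * δ * smallRoot C)
    (hv : 0 < v) :
    ∃ v₁, 0 < v₁ ∧ ∀ v₀ l l₀, 0 < v₀ → v₀ ≤ v₁ →
      Tendsto (fun t : ℝ => (1 / t) * Real.log (expectedCount ξ 0 t ⌊v * t⌋).toReal)
        atTop (𝓝 l) →
      Tendsto (fun t : ℝ => (1 / t) * Real.log (expectedCount ξ 0 t ⌊v₀ * t⌋).toReal)
        atTop (𝓝 l₀) →
      v * Real.log (1 + w) + l ≤ κ + δ + v / v₀ * (l₀ - a) := by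
  obtain ⟨v₁, hv₁, hgreen⟩ := exists_green_le hξ hM ha hκ
  refine ⟨v₁, hv₁, fun v₀ l l₀ hv₀ hv₀₁ hl hl₀ => ?_⟩
  have hD : 0 ≤ Real.log (1 + w) := Real.log_nonneg (by linarith)
  set r := v / v₀ with hr
  have hr0 : 0 < r := by positivity
  -- Counts at the origin grow at least like `exp (b t)` only for `b < a`; the value `a` is reached
  -- in the limit at the end.
  have key : ∀ b, b < a → v * Real.log (1 + w) + l ≤ κ + δ - b * r + r * l₀ := by
    intro b hb
    obtain ⟨C₁, hC₁, hev⟩ := hgreen b hb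
    obtain ⟨c₂, hc₂⟩ : ∃ c, c = Real.exp (-(|κ + δ| + 1 + M)) := ⟨_, rfl⟩
    have hc₂0 : 0 < c₂ := hc₂ ▸ Real.exp_pos _
    have htr : Tendsto (fun t : ℝ => r * t) atTop atTop := tendsto_id.const_mul_atTop hr0
    have hl₀' := (hl₀.comp htr).const_mul r
    have hlog : Tendsto (fun t : ℝ => (1 / t) * Real.log t) atTop (𝓝 0) := by
      have h := Real.isLittleO_log_id_atTop.tendsto_div_nhds_zero
      refine h.congr fun t => ?_
      simp [div_eq_inv_mul]
    have hinv : Tendsto (fun t : ℝ => 1 / t) atTop (𝓝 0) := by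
      simpa using tendsto_inv_atTop_zero (𝕜 := ℝ)
    -- The floor costs at most one site: `n ≥ v t - 1`, hence `v - 1 / t`.
    have hL : Tendsto (fun t : ℝ => (v - 1 / t) * Real.log (1 + w) +
        (1 / t) * Real.log (expectedCount ξ 0 t ⌊v * t⌋).toReal) atTop
        (𝓝 ((v - 0) * Real.log (1 + w) + l)) :=
      ((hinv.const_sub v).mul_const _).add hl
    have hR : Tendsto (fun t : ℝ => (1 / t) * Real.log (C₁ * r / c₂) + (1 / t) * Real.log t +
        (κ + δ - b * r) + r * ((1 / (r * t)) *
          Real.log (expectedCount ξ 0 (r * t) ⌊v₀ * (r * t)⌋).toReal)) atTop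
        (𝓝 (0 * Real.log (C₁ * r / c₂) + 0 + (κ + δ - b * r) + r * l₀)) :=
      (((hinv.mul_const _).add hlog).add_const _).add hl₀'
    have hle := le_of_tendsto_of_tendsto hL hR ?_
    · simpa using hle
    · filter_upwards [htr.eventually hev, eventually_gt_atTop 0] with t ht ht0
      have hvt : v₀ * (r * t) = v * t := by
        rw [hr]; field_simp
      rw [hvt]
      set n := ⌊v * t⌋.toNat with hn
      have hn' : ((n : ℕ) : ℤ) = ⌊v * t⌋ := toNat_floor_eq (by positivity)
      rw [← hn']
      have hnle : (n : ℝ) ≤ v * t := by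
        have := Int.floor_le (v * t)
        rw [← hn'] at this
        exact_mod_cast this
      have hnge : v * t - 1 ≤ n := by
        have := (Int.sub_one_lt_floor (v * t)).le
        rw [← hn'] at this
        exact_mod_cast this
      have hrt : 0 < r * t := by positivity
      have h1 := ht n (by
        rw [← hvt] at hnle
        exact hnle.trans (mul_le_mul_of_nonneg_right hv₀₁ hrt.le))
      have h2 := green_ratio hξ hM ha hκ hδ hC hcC hw hwlt n
      have h3 := expectedCount_le_green hξ hM (κ + δ) 0 n ht0.le
      have h4 := ENNReal.toReal_mono (green_ne_top hξ hM ha (by linarith : a < κ + δ) 0 n) h3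
      rw [ENNReal.toReal_mul, ENNReal.toReal_ofReal (by positivity), ← hc₂] at h4
      have hk := toReal_expectedCount_pos hξ hM 0 n ht0
      have hk0 := toReal_expectedCount_pos hξ hM 0 n hrt
      set k := (expectedCount ξ 0 t n).toReal
      set k₀ := (expectedCount ξ 0 (r * t) n).toReal
      have hw1 : 0 < (1 + w) ^ n := by positivity
      have h5 : (1 + w) ^ n * (c₂ * Real.exp (-((κ + δ) * t)) * k) ≤
          C₁ * (r * t) * Real.exp (-(b * (r * t))) * k₀ :=
        ((mul_le_mul_of_nonneg_left h4 hw1.le).trans h2).trans h1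
      rw [show C₁ * (r * t) = C₁ * r * t by ring] at h5
      have h6 := Real.log_le_log (by positivity) h5
      rw [Real.log_mul hw1.ne' (by positivity), Real.log_mul (by positivity) hk.ne',
        Real.log_mul hc₂0.ne' (Real.exp_pos _).ne', Real.log_exp, Real.log_pow,
        Real.log_mul (by positivity) hk0.ne', Real.log_mul (by positivity) (Real.exp_pos _).ne',
        Real.log_exp, Real.log_mul (by positivity) ht0.ne'] at h6
      have h7 : (v * t - 1) * Real.log (1 + w) ≤ n * Real.log (1 + w) :=
        mul_le_mul_of_nonneg_right hnge hD
      rw [Real.log_div (by positivity) hc₂0.ne']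
      have h8 : (v * t - 1) * Real.log (1 + w) + Real.log k ≤
          Real.log (C₁ * r) - Real.log c₂ + Real.log t + (κ + δ - b * r) * t + Real.log k₀ := by
        linarith
      have h9 := mul_le_mul_of_nonneg_left h8 (by positivity : 0 ≤ 1 / t)
      have e1 : (1 / t) * ((v * t - 1) * Real.log (1 + w) + Real.log k) =
          (v - 1 / t) * Real.log (1 + w) + 1 / t * Real.log k := by
        field_simp
      have e2 : (1 / t) * (Real.log (C₁ * r) - Real.log c₂ + Real.log t + (κ + δ - b * r) * t +
          Real.log k₀) = 1 / t * (Real.log (C₁ * r) - Real.log c₂) + 1 / t * Real.log t +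
          (κ + δ - b * r) + r * (1 / (r * t) * Real.log k₀) := by
        field_simp
      rwa [e1, e2] at h9
  have hlim : Tendsto (fun b => κ + δ - b * r + r * l₀) (𝓝[<] a) (𝓝 (κ + δ - a * r + r * l₀)) := by
    refine Tendsto.mono_left (Continuous.tendsto (by fun_prop) a) nhdsWithin_le_nhds
  have h := ge_of_tendsto hlim (eventually_mem_nhdsWithin.mono fun b hb => key b hb)
  linarith

theorem IsEnvironment.ae_bounds {Ω : Type*} [MeasurableSpace Ω] {P : Measure Ω}
    {ξ : ℤ → Ω → ℝ} {ei es : ℝ} (h : IsEnvironment P ξ ei es) :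
    ∀ᵐ ω ∂P, ∀ z, ei ≤ ξ z ω ∧ ξ z ω ≤ es := by
  refine ae_all_iff.2 fun z => ?_
  have h0 : ∀ᵐ ω ∂P, ξ 0 ω ∈ Icc ei es := by
    have h1 := ae_essInf_le (μ := P) (f := fun ω => (ξ 0 ω : EReal))
    have h2 := ae_le_essSup (μ := P) (f := fun ω => (ξ 0 ω : EReal))
    rw [h.essInf_eq] at h1
    rw [h.essSup_eq] at h2
    filter_upwards [h1, h2] with ω h3 h4
    exact ⟨EReal.coe_le_coe_iff.1 h3, EReal.coe_le_coe_iff.1 h4⟩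
  exact ((h.identDistrib z).symm.ae_mem_snd measurableSet_Icc h0)

/-- By linearity on `[0, vc]`, `(vc / v₀)(lam v₀ - lam 0) = lam vc - lam 0`, so the growth rate
inequality at speed `vc` retains nothing of the environment but `Δ`. -/
theorem critical_speed_le {Ω : Type*} [MeasurableSpace Ω] {P : Measure Ω}
    {ξ : ℤ → Ω → ℝ} {ei es : ℝ} (h : IsEnvironment P ξ ei es) {lam : ℝ → ℝ} {vc : ℝ}
    (hlam : IsLyapunovExponent P ξ lam) (hvc : IsCriticalSpeed lam vc) :
    vc ≤ Real.sqrt ((es - ei) * (2 + (es - ei))) := by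
  have := h.isProbabilityMeasure
  obtain ⟨hvc0, ⟨α, β, hlin⟩, -⟩ := hvc
  have hei := h.ei_pos
  have hes := h.ei_lt_es
  -- The threshold `v₁` depends on the environment and on `δ`, whereas the limits hold almost surely
  -- for each fixed speed. The countable family `vc / (k + 1)` contains arbitrarily small speeds.
  have hae : ∀ᵐ ω ∂P, ∀ k : ℕ, Tendsto (fun t : ℝ => (1 / t) * Real.log
      (expectedCount (fun z => ξ z ω) 0 t ⌊vc / (k + 1 : ℝ) * t⌋).toReal) atTop
      (𝓝 (lam (vc / (k + 1 : ℝ)))) := ae_all_iff.2 fun k => hlam _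
  obtain ⟨ω, hb, hl, ha, hlk⟩ :=
    (h.ae_bounds.and ((hlam vc).and ((hlam 0).and hae))).exists
  simp only [zero_mul, Int.floor_zero] at ha
  have hα : lam 0 = α := by simpa using hlin 0 ⟨le_rfl, hvc0.le⟩
  have hξ : ∀ z, 0 < ξ z ω := fun z => hei.trans_le (hb z).1
  have hM : ∀ z, ξ z ω ≤ es := fun z => (hb z).2
  have haM := growth_rate_le hξ hM ha
  refine le_of_forall_small_log (by linarith) hvc0 fun δ w hδ hδ1 hw hwlt => ?_
  -- The excess `δ ^ 2` of `κ` over `lam 0` is of smaller order than the shift `δ`. The bound `C` on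
  -- the coefficients comes from `lam 0 ≤ es` and `ei ≤ ξ z`.
  obtain ⟨v₁, hv₁, hineq⟩ := growth_rate_inequality hξ hM ha
    (κ := lam 0 + δ ^ 2) (C := 2 * (1 + (es - ei) + δ ^ 2)) (v := vc)
    (lt_add_of_pos_right _ (by positivity)) hδ (by nlinarith)
    (fun z => by linarith [(hb z).1]) hw hwlt hvc0
  obtain ⟨k, hk⟩ := exists_nat_gt (vc / v₁)
  have hk1 : (0 : ℝ) < k + 1 := by positivity
  have hv₀ : vc / (k + 1 : ℝ) ≤ v₁ := by
    rw [div_le_iff₀ hk1]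
    rw [div_lt_iff₀ hv₁] at hk
    linarith
  have hfin := hineq _ _ _ (div_pos hvc0 hk1) hv₀ hl (hlk k)
  rw [hlin vc ⟨hvc0.le, le_rfl⟩, hlin (vc / (k + 1 : ℝ)) ⟨by positivity,
    div_le_self hvc0.le (by linarith [(Nat.cast_nonneg k : (0 : ℝ) ≤ k)])⟩, hα] at hfin
  have e : vc / (vc / (k + 1 : ℝ)) * (α + β * (vc / (k + 1 : ℝ)) - α) = β * vc := by
    field_simp
    ring
  rw [e] at hfin
  linarith

/-! ### Random walks with exponential holding times, as sequences of steps -/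

/-- A coin that shows `true` with probability `p`. -/
noncomputable def coin (p : ℝ) : Measure Bool :=
  ENNReal.ofReal p • Measure.dirac true + ENNReal.ofReal (1 - p) • Measure.dirac false

theorem lintegral_coin (p : ℝ) (f : Bool → ℝ≥0∞) :
    ∫⁻ b, f b ∂coin p = ENNReal.ofReal p * f true + ENNReal.ofReal (1 - p) * f false := by
  rw [coin, lintegral_add_measure, lintegral_smul_measure, lintegral_smul_measure,
    lintegral_dirac, lintegral_dirac]
  rfl

theorem fairCoin_eq_coin : fairCoin = coin (1 / 2) := by
  refine Measure.ext_of_lintegral _ fun f _ => ?_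
  rw [lintegral_fairCoin, lintegral_coin, mul_add]
  norm_num [ENNReal.ofReal_div_of_pos]

theorem isProbabilityMeasure_coin {p : ℝ} (h0 : 0 ≤ p) (h1 : p ≤ 1) :
    IsProbabilityMeasure (coin p) := by
  constructor
  rw [← lintegral_one, lintegral_coin, mul_one, mul_one, ← ENNReal.ofReal_add h0 (by linarith)]
  simp

/-- The law of one holding time and direction: rate `θ`, upwards with probability `p`. -/
noncomputable def stepLaw (θ p : ℝ) : Measure (ℝ × Bool) := (expMeasure θ).prod (coin p)

theorem isProbabilityMeasure_stepLaw {θ p : ℝ} (hθ : 0 < θ) (h0 : 0 ≤ p) (h1 : p ≤ 1) :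
    IsProbabilityMeasure (stepLaw θ p) := by
  have := isProbabilityMeasure_expMeasure hθ
  have := isProbabilityMeasure_coin h0 h1
  unfold stepLaw
  infer_instance

instance (p : ℝ) : SFinite (coin p) := by unfold coin; infer_instance

theorem lintegral_stepLaw (θ p : ℝ) {f : ℝ × Bool → ℝ≥0∞} (hf : Measurable f) :
    ∫⁻ c, f c ∂stepLaw θ p = ∫⁻ x in Ioi 0, ENNReal.ofReal (θ * Real.exp (-(θ * x))) *
      (ENNReal.ofReal p * f (x, true) + ENNReal.ofReal (1 - p) * f (x, false)) := by
  rw [stepLaw, lintegral_prod _ hf.aemeasurable]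
  simp_rw [lintegral_coin]
  rw [lintegral_expMeasure]
  fun_prop

/-- The law of a sequence of independent steps. -/
noncomputable def pathLaw (θ p : ℝ) : Measure (ℕ → ℝ × Bool) :=
  Measure.infinitePi fun _ => stepLaw θ p

/-- The time of the `n`-th jump. -/
noncomputable def jumpTime (ω : ℕ → ℝ × Bool) (n : ℕ) : ℝ := ∑ i ∈ Finset.range n, (ω i).1

/-- The displacement after `n` jumps. -/
def position (ω : ℕ → ℝ × Bool) (n : ℕ) : ℤ := ∑ i ∈ Finset.range n, step (ω i).2

/-- The path without its first step. -/
def tail (ω : ℕ → ℝ × Bool) : ℕ → ℝ × Bool := fun n => ω (n + 1)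

theorem jumpTime_zero (ω : ℕ → ℝ × Bool) : jumpTime ω 0 = 0 := by simp [jumpTime]

theorem position_zero (ω : ℕ → ℝ × Bool) : position ω 0 = 0 := by simp [position]

theorem jumpTime_succ (ω : ℕ → ℝ × Bool) (n : ℕ) :
    jumpTime ω (n + 1) = (ω 0).1 + jumpTime (tail ω) n := by
  rw [jumpTime, Finset.sum_range_succ', add_comm]; rfl

theorem position_succ (ω : ℕ → ℝ × Bool) (n : ℕ) :
    position ω (n + 1) = step (ω 0).2 + position (tail ω) n := by
  rw [position, Finset.sum_range_succ', add_comm]; rfl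

@[fun_prop]
theorem measurable_jumpTime (n : ℕ) : Measurable fun ω => jumpTime ω n := by
  unfold jumpTime; fun_prop

@[fun_prop]
theorem measurable_step : Measurable step := measurable_of_countable _

@[fun_prop]
theorem measurable_position (n : ℕ) : Measurable fun ω => position ω n := by
  unfold position
  exact Finset.measurable_sum _ fun i _ => measurable_step.comp (by fun_prop)

/-- First-step analysis. -/
theorem lintegral_pathLaw (θ p : ℝ) [IsProbabilityMeasure (stepLaw θ p)]
    {f : (ℝ × Bool) × (ℕ → ℝ × Bool) → ℝ≥0∞} (hf : Measurable f) :
    ∫⁻ ω, f (ω 0, tail ω) ∂pathLaw θ p =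
      ∫⁻ c, ∫⁻ ω, f (c, ω) ∂pathLaw θ p ∂stepLaw θ p :=
  lintegral_infinitePi_prodMk _ 0 (add_left_injective 1) (fun k => k.succ_ne_zero) hf

section Law

variable {θ p : ℝ} [IsProbabilityMeasure (stepLaw θ p)]

instance : IsProbabilityMeasure (pathLaw θ p) := by unfold pathLaw; infer_instance

theorem ae_holdingTime_pos : ∀ᵐ ω ∂pathLaw θ p, ∀ i, 0 < (ω i).1 := by
  refine ae_all_iff.2 fun i => ?_
  have h1 : ∀ᵐ c ∂stepLaw θ p, 0 < c.1 := by
    rw [ae_iff]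
    have hm : MeasurableSet {c : ℝ × Bool | ¬ 0 < c.1} :=
      (measurableSet_lt measurable_const measurable_fst).compl
    rw [← lintegral_indicator_one hm, lintegral_stepLaw _ _ (measurable_one.indicator hm)]
    rw [← lintegral_zero (μ := volume.restrict (Ioi (0 : ℝ)))]
    refine setLIntegral_congr_fun measurableSet_Ioi fun x hx => ?_
    have hx' : (0 : ℝ) < x := hx
    simp [indicator, not_le.2 hx']
  have h2 := (measurePreserving_eval_infinitePi (fun _ : ℕ => stepLaw θ p) i)
  exact h2.quasiMeasurePreserving.ae h1

/-- The infimum `D` of `exp (-Tₙ)` loses a factor `exp (-T₁)` with the first step, so its mean is at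
most `θ / (θ + 1) < 1` times itself and vanishes. -/
theorem ae_tendsto_jumpTime (hθ : 0 < θ) :
    ∀ᵐ ω ∂pathLaw θ p, Tendsto (jumpTime ω) atTop atTop := by
  set D : (ℕ → ℝ × Bool) → ℝ≥0∞ := fun ω => ⨅ n, ENNReal.ofReal (Real.exp (-jumpTime ω n)) with hD
  have hDm : Measurable D := Measurable.iInf fun n => by fun_prop
  have hD1 : ∀ ω, D ω ≤ 1 := fun ω =>
    (iInf_le _ 0).trans_eq (by simp [jumpTime_zero])
  have hstep : ∀ ω, D ω ≤ ENNReal.ofReal (Real.exp (-(ω 0).1)) * D (tail ω) := by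
    intro ω
    rw [hD, ENNReal.mul_iInf_of_ne (ENNReal.ofReal_pos.2 (Real.exp_pos _)).ne'
      ENNReal.ofReal_ne_top]
    refine le_iInf fun n => (iInf_le _ (n + 1)).trans_eq ?_
    rw [jumpTime_succ, neg_add, Real.exp_add, ENNReal.ofReal_mul (Real.exp_nonneg _)]
  have hsum : ENNReal.ofReal p + ENNReal.ofReal (1 - p) = 1 := by
    have h := lintegral_stepLaw θ p (f := 1) measurable_one
    have h2 := lintegral_exp_neg_mul_Ioi hθ 0
    simp only [mul_zero, neg_zero, Real.exp_zero, ENNReal.ofReal_one] at h2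
    simp only [Pi.one_apply, mul_one, lintegral_const, measure_univ] at h
    rw [lintegral_mul_const _ (by fun_prop), h2, one_mul] at h
    exact h.symm
  have hexp : ∫⁻ c, ENNReal.ofReal (Real.exp (-c.1)) ∂stepLaw θ p =
      ENNReal.ofReal (θ / (θ + 1)) := by
    rw [lintegral_stepLaw _ _ (by fun_prop)]
    simp_rw [← add_mul, hsum, one_mul]
    rw [ENNReal.ofReal_div_of_pos (by linarith), div_eq_mul_inv, ← lintegral_exp_neg_mul,
      ← lintegral_const_mul _ (by fun_prop)]
    refine lintegral_congr fun x => ?_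
    rw [ENNReal.ofReal_mul hθ.le, mul_assoc, ← ENNReal.ofReal_mul (Real.exp_nonneg _),
      ← Real.exp_add]
    ring_nf
  have hE : ∫⁻ ω, D ω ∂pathLaw θ p ≤ ENNReal.ofReal (θ / (θ + 1)) * ∫⁻ ω, D ω ∂pathLaw θ p := by
    refine (lintegral_mono hstep).trans_eq ?_
    rw [lintegral_pathLaw θ p
      (f := fun q => ENNReal.ofReal (Real.exp (-q.1.1)) * D q.2) (by fun_prop)]
    simp only
    simp_rw [lintegral_const_mul _ hDm]
    rw [lintegral_mul_const _ (by fun_prop), hexp]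
  have hfin : ∫⁻ ω, D ω ∂pathLaw θ p ≠ ⊤ := by
    refine ((lintegral_mono hD1).trans_lt ?_).ne
    simp
  have hzero : ∫⁻ ω, D ω ∂pathLaw θ p = 0 := by
    by_contra hne
    have hlt : ENNReal.ofReal (θ / (θ + 1)) < 1 := by
      rw [← ENNReal.ofReal_one]
      exact (ENNReal.ofReal_lt_ofReal_iff one_pos).2 (by rw [div_lt_one] <;> linarith)
    have := ENNReal.mul_lt_mul_left hne hfin hlt
    rw [one_mul] at this
    exact absurd hE (not_le.2 this)
  rw [lintegral_eq_zero_iff hDm] at hzero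
  filter_upwards [hzero, ae_holdingTime_pos (θ := θ) (p := p)] with ω h0 hpos
  have hmono : Monotone (jumpTime ω) := monotone_nat_of_le_succ fun n => by
    rw [jumpTime, jumpTime, Finset.sum_range_succ]
    linarith [hpos n]
  refine tendsto_atTop_atTop_of_monotone hmono fun b => ?_
  by_contra! hlt
  have h1 : ENNReal.ofReal (Real.exp (-b)) ≤ D ω :=
    le_iInf fun n => ENNReal.ofReal_le_ofReal (Real.exp_le_exp.2 (neg_le_neg (hlt n).le))
  rw [h0] at h1
  exact absurd h1 (not_le.2 (ENNReal.ofReal_pos.2 (Real.exp_pos _)))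

end Law

/-! ### Change of measure -/

/-- The density of one step under the tilted law. -/
theorem lintegral_stepLaw_tilt {θ p φ : ℝ} (hθ : 0 < θ) (hφ : 0 < φ) (hp : p = 1 / (2 * θ * φ))
    (hq : 1 - p = φ / (2 * θ)) {f : ℝ × Bool → ℝ≥0∞} (hf : Measurable f) :
    ∫⁻ c, f c ∂stepLaw θ p = ∫⁻ c, ENNReal.ofReal (Real.exp ((1 - θ) * c.1) * φ ^ (-step c.2)) * f c
      ∂stepLaw 1 (1 / 2) := by
  have hm : Measurable fun c : ℝ × Bool => ENNReal.ofReal (Real.exp ((1 - θ) * c.1) *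
      φ ^ (-step c.2)) := by
    refine ENNReal.measurable_ofReal.comp (Measurable.mul (by fun_prop) ?_)
    exact (measurable_of_countable fun b : Bool => φ ^ (-step b)).comp measurable_snd
  have hmf : Measurable fun c : ℝ × Bool => ENNReal.ofReal (Real.exp ((1 - θ) * c.1) *
      φ ^ (-step c.2)) * f c := hm.mul hf
  rw [lintegral_stepLaw _ _ hf, lintegral_stepLaw _ _ hmf]
  refine setLIntegral_congr_fun measurableSet_Ioi fun x _ => ?_
  have h1 : Real.exp (-(θ * x)) = Real.exp (-x) * Real.exp ((1 - θ) * x) := by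
    rw [← Real.exp_add]; ring_nf
  simp only [step, if_true, Bool.false_eq_true, if_false, one_mul, mul_add,
    ← mul_assoc]
  congr 1
  · rw [← ENNReal.ofReal_mul (by positivity), ← ENNReal.ofReal_mul (by positivity),
      ← ENNReal.ofReal_mul (by positivity), h1, hp]
    congr 2
    rw [zpow_neg, zpow_one]
    field_simp
  · rw [← ENNReal.ofReal_mul (by positivity), ← ENNReal.ofReal_mul (by positivity),
      ← ENNReal.ofReal_mul (by norm_num; positivity), h1, hq]
    congr 2
    rw [neg_neg, zpow_one]
    field_simp
    norm_num

theorem measurable_tilt (θ φ : ℝ) (n : ℕ) : Measurable fun ω =>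
    ENNReal.ofReal (Real.exp ((1 - θ) * jumpTime ω n) * φ ^ (-position ω n)) := by
  refine ENNReal.measurable_ofReal.comp (Measurable.mul (by fun_prop) ?_)
  exact (measurable_of_countable fun k : ℤ => φ ^ (-k)).comp (measurable_position n)

/-- The change of measure on the first `n` steps. -/
theorem lintegral_pathLaw_tilt {θ p φ : ℝ} (hθ : 0 < θ) (hφ : 0 < φ) (hp : p = 1 / (2 * θ * φ))
    (hq : 1 - p = φ / (2 * θ)) [IsProbabilityMeasure (stepLaw θ p)]
    [IsProbabilityMeasure (stepLaw 1 (1 / 2))] (n : ℕ) {f : (ℕ → ℝ × Bool) → ℝ≥0∞}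
    (hf : Measurable f) (hdep : ∀ ω ω' : ℕ → ℝ × Bool, (∀ i < n, ω i = ω' i) → f ω = f ω') :
    ∫⁻ ω, f ω ∂pathLaw θ p = ∫⁻ ω, ENNReal.ofReal (Real.exp ((1 - θ) * jumpTime ω n) *
      φ ^ (-position ω n)) * f ω ∂pathLaw 1 (1 / 2) := by
  -- Rejoining the first step and the tail lets the induction peel off one step at a time.
  let cons : (ℝ × Bool) × (ℕ → ℝ × Bool) → ℕ → ℝ × Bool := fun q i => Nat.casesOn i q.1 q.2
  have hcons : Measurable cons := by
    refine measurable_pi_lambda _ fun i => ?_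
    cases i with
    | zero => exact measurable_fst
    | succ i => exact (measurable_pi_apply i).comp measurable_snd
  have hct : ∀ ω : ℕ → ℝ × Bool, cons (ω 0, tail ω) = ω := by
    intro ω
    ext i : 1
    cases i <;> rfl
  induction n generalizing f with
  | zero =>
    have h0 : ∀ ω, f ω = f (fun _ => (0, true)) := fun ω => hdep _ _ (by simp)
    simp_rw [h0]
    rw [lintegral_const, measure_univ]
    simp only [jumpTime_zero, position_zero, mul_zero, Real.exp_zero, neg_zero, zpow_zero, mul_one,
      ENNReal.ofReal_one, one_mul, lintegral_const, measure_univ]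
  | succ n ih =>
    have hl := lintegral_pathLaw θ p (hf.comp hcons)
    have hr := lintegral_pathLaw 1 (1 / 2) (((measurable_tilt θ φ (n + 1)).mul hf).comp hcons)
    simp only [Function.comp_apply, hct, Pi.mul_apply] at hl hr
    rw [hl, hr, lintegral_stepLaw_tilt hθ hφ hp hq]
    · refine lintegral_congr fun c => ?_
      have hfc : Measurable fun ω => f (cons (c, ω)) := hf.comp (hcons.comp measurable_prodMk_left)
      have hmf : Measurable fun ω => ENNReal.ofReal (Real.exp ((1 - θ) * jumpTime ω n) *
          φ ^ (-position ω n)) * f (cons (c, ω)) := (measurable_tilt θ φ n).mul hfc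
      rw [ih hfc, ← lintegral_const_mul _ hmf]
      · refine lintegral_congr fun ω => ?_
        rw [← mul_assoc]
        congr 1
        rw [← ENNReal.ofReal_mul (by positivity), jumpTime_succ, position_succ]
        congr 1
        have e1 : (cons (c, ω) 0) = c := rfl
        have e2 : tail (cons (c, ω)) = ω := rfl
        rw [e1, e2, mul_add, Real.exp_add, neg_add, zpow_add₀ hφ.ne']
        ring
      · intro ω ω' h
        refine hdep _ _ fun i hi => ?_
        cases i with
        | zero => rfl
        | succ i => exact h i (by omega)
    · exact (hf.comp hcons).lintegral_prod_right'

/-! ### Hitting probabilities and mean hitting times -/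

/-- The path reaches `k` for the first time at its `n`-th jump. -/
def HitsAt (k : ℤ) (n : ℕ) (ω : ℕ → ℝ × Bool) : Prop :=
  position ω n = k ∧ ∀ m < n, position ω m ≠ k

theorem measurableSet_hitsAt (k : ℤ) (n : ℕ) : MeasurableSet {ω | HitsAt k n ω} := by
  have h : {ω | HitsAt k n ω} = {ω | position ω n = k} ∩ ⋂ m, ⋂ _ : m < n,
      {ω | position ω m = k}ᶜ := by
    ext ω; simp [HitsAt]
  rw [h]
  exact (measurable_position n (measurableSet_singleton k)).inter (MeasurableSet.iInter fun m =>
    MeasurableSet.iInter fun _ => (measurable_position m (measurableSet_singleton k)).compl)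

theorem HitsAt.unique {k : ℤ} {m n : ℕ} {ω : ℕ → ℝ × Bool} (hm : HitsAt k m ω)
    (hn : HitsAt k n ω) : m = n := by
  by_contra hne
  rcases lt_or_gt_of_ne hne with h | h
  · exact hn.2 m h hm.1
  · exact hm.2 n h hn.1

theorem exists_hitsAt {k : ℤ} {ω : ℕ → ℝ × Bool} (h : ∃ n, position ω n = k) :
    ∃ n, HitsAt k n ω := by
  classical
  exact ⟨Nat.find h, Nat.find_spec h, fun m hm => Nat.find_min h hm⟩

theorem position_congr {ω ω' : ℕ → ℝ × Bool} {n : ℕ} (h : ∀ i < n, ω i = ω' i) :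
    position ω n = position ω' n :=
  Finset.sum_congr rfl fun i hi => by rw [h i (Finset.mem_range.1 hi)]

theorem jumpTime_congr {ω ω' : ℕ → ℝ × Bool} {n : ℕ} (h : ∀ i < n, ω i = ω' i) :
    jumpTime ω n = jumpTime ω' n :=
  Finset.sum_congr rfl fun i hi => by rw [h i (Finset.mem_range.1 hi)]

theorem HitsAt.congr {k : ℤ} {n : ℕ} {ω ω' : ℕ → ℝ × Bool} (hk : HitsAt k n ω)
    (h : ∀ i < n, ω i = ω' i) : HitsAt k n ω' := by
  refine ⟨(position_congr h).symm.trans hk.1, fun m hm => ?_⟩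
  rw [← position_congr fun i hi => h i (hi.trans hm)]
  exact hk.2 m hm

/-- The time at which the path reaches `k`. -/
noncomputable def hitTime (k : ℤ) (ω : ℕ → ℝ × Bool) : ℝ≥0∞ :=
  ⨅ (n : ℕ) (_ : position ω n = k), ∑ i ∈ Finset.range n, ENNReal.ofReal (ω i).1

@[fun_prop]
theorem measurable_hitTime (k : ℤ) : Measurable (hitTime k) := by
  classical
  have h : hitTime k = fun ω => ⨅ n : ℕ, if position ω n = k then
      ∑ i ∈ Finset.range n, ENNReal.ofReal (ω i).1 else ⊤ := by
    ext ω
    refine iInf_congr fun n => ?_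
    split_ifs with hn <;> simp [hn]
  rw [h]
  refine Measurable.iInf fun n => Measurable.ite
    (measurable_position n (measurableSet_singleton k)) ?_ measurable_const
  fun_prop

theorem HitsAt.hitTime_eq {k : ℤ} {n : ℕ} {ω : ℕ → ℝ × Bool} (h : HitsAt k n ω) :
    hitTime k ω = ∑ i ∈ Finset.range n, ENNReal.ofReal (ω i).1 := by
  refine le_antisymm (iInf₂_le n h.1) (le_iInf₂ fun m hm => ?_)
  refine Finset.sum_le_sum_of_subset (Finset.range_mono (not_lt.1 fun hlt => h.2 m hlt hm))

theorem hitTime_zero (ω : ℕ → ℝ × Bool) : hitTime 0 ω = 0 := by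
  have h : HitsAt 0 0 ω := ⟨position_zero ω, fun m hm => absurd hm (Nat.not_lt_zero m)⟩
  rw [h.hitTime_eq, Finset.sum_range_zero]

theorem exists_position_iff {k : ℤ} (hk : k ≠ 0) (ω : ℕ → ℝ × Bool) :
    (∃ n, position ω n = k) ↔ ∃ n, position (tail ω) n = k - step (ω 0).2 := by
  constructor
  · rintro ⟨_ | n, hn⟩
    · exact absurd ((position_zero ω).symm.trans hn).symm hk
    · rw [position_succ] at hn
      exact ⟨n, by omega⟩
  · rintro ⟨n, hn⟩
    exact ⟨n + 1, by rw [position_succ]; omega⟩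

theorem hitTime_eq_add {k : ℤ} (hk : k ≠ 0) (ω : ℕ → ℝ × Bool) :
    hitTime k ω = ENNReal.ofReal (ω 0).1 + hitTime (k - step (ω 0).2) (tail ω) := by
  rw [hitTime, hitTime, ENNReal.add_iInf]
  simp_rw [ENNReal.add_iInf]
  have hsum : ∀ n : ℕ, ∑ i ∈ Finset.range (n + 1), ENNReal.ofReal (ω i).1 =
      ENNReal.ofReal (ω 0).1 + ∑ i ∈ Finset.range n, ENNReal.ofReal (tail ω i).1 := by
    intro n
    rw [Finset.sum_range_succ', add_comm]
    rfl
  refine le_antisymm (le_iInf₂ fun n hn => ?_) (le_iInf₂ fun n hn => ?_)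
  · rw [← hsum]
    exact iInf₂_le (n + 1) (by rw [position_succ]; omega)
  · cases n with
    | zero => exact absurd ((position_zero ω).symm.trans hn).symm hk
    | succ n =>
      rw [hsum]
      rw [position_succ] at hn
      exact iInf₂_le n (by omega)

section Recursion

variable {θ p : ℝ} [IsProbabilityMeasure (stepLaw θ p)] (hθ : 0 < θ)

omit [IsProbabilityMeasure (stepLaw θ p)] in
include hθ in
theorem lintegral_stepLaw_snd (g : Bool → ℝ≥0∞) :
    ∫⁻ c, g c.2 ∂stepLaw θ p = ENNReal.ofReal p * g true + ENNReal.ofReal (1 - p) * g false := by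
  have h2 := lintegral_exp_neg_mul_Ioi hθ 0
  simp only [mul_zero, neg_zero, Real.exp_zero, ENNReal.ofReal_one] at h2
  have hm : Measurable fun c : ℝ × Bool => g c.2 :=
    (measurable_of_countable g).comp measurable_snd
  rw [lintegral_stepLaw _ _ hm]
  simp only
  rw [lintegral_mul_const _ (by fun_prop), h2, one_mul]

include hθ in
theorem lintegral_stepLaw_fst :
    ∫⁻ c, ENNReal.ofReal c.1 ∂stepLaw θ p = (ENNReal.ofReal θ)⁻¹ := by
  have hsum := lintegral_stepLaw_snd (p := p) hθ 1
  simp only [Pi.one_apply, mul_one, lintegral_const, measure_univ] at hsum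
  rw [lintegral_stepLaw _ _ (by fun_prop), ← lintegral_exp_neg_mul]
  simp_rw [← add_mul, ← hsum, one_mul]
  -- Layer cake: `x` is the length of `{t | 0 < t < x}`, so the mean is the integral of the tail
  -- probabilities.
  have h1 : ∀ x ∈ Ioi (0 : ℝ), ENNReal.ofReal (θ * Real.exp (-(θ * x))) * ENNReal.ofReal x =
      ∫⁻ t in Ioi 0, if t < x then ENNReal.ofReal (θ * Real.exp (-(θ * x))) else 0 := by
    intro x hx
    have h2 : ENNReal.ofReal x = volume (Ioo 0 x) := by rw [Real.volume_Ioo, sub_zero]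
    rw [h2, ← setLIntegral_const, ← lintegral_indicator measurableSet_Ioo,
      ← lintegral_indicator measurableSet_Ioi]
    refine lintegral_congr fun t => ?_
    by_cases h0 : 0 < t
    · by_cases ht : t < x
      · simp [h0, ht]
      · simp [indicator, ht]
    · simp [h0]
  rw [setLIntegral_congr_fun measurableSet_Ioi h1, lintegral_lintegral_swap]
  · refine setLIntegral_congr_fun measurableSet_Ioi fun t ht => ?_
    have ht' : (0 : ℝ) < t := ht
    rw [← lintegral_exp_neg_mul_Ioi hθ t, ← lintegral_indicator measurableSet_Ioi,
      ← lintegral_indicator measurableSet_Ioi]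
    refine lintegral_congr fun x => ?_
    by_cases hx : t < x
    · simp [hx, ht'.trans hx]
    · simp [hx]
  · refine Measurable.aemeasurable (Measurable.ite ?_ (by fun_prop) measurable_const)
    exact measurableSet_lt measurable_snd measurable_fst

/-- The probability that the path ever reaches `k`. -/
noncomputable def hitProb (θ p : ℝ) (k : ℤ) : ℝ≥0∞ := pathLaw θ p {ω | ∃ n, position ω n = k}

theorem measurableSet_exists_position (k : ℤ) : MeasurableSet {ω | ∃ n, position ω n = k} := by
  have h : {ω | ∃ n, position ω n = k} = ⋃ n, {ω | position ω n = k} := by ext; simp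
  rw [h]
  exact MeasurableSet.iUnion fun n => measurable_position n (measurableSet_singleton k)

include hθ in
theorem hitProb_eq {k : ℤ} (hk : k ≠ 0) : hitProb θ p k =
    ENNReal.ofReal p * hitProb θ p (k - 1) + ENNReal.ofReal (1 - p) * hitProb θ p (k + 1) := by
  have hm : MeasurableSet {q : (ℝ × Bool) × (ℕ → ℝ × Bool) |
      ∃ n, position q.2 n = k - step q.1.2} := by
    have h : {q : (ℝ × Bool) × (ℕ → ℝ × Bool) | ∃ n, position q.2 n = k - step q.1.2} =
        ⋃ n, {q | position q.2 n = k - step q.1.2} := by ext; simp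
    rw [h]
    exact MeasurableSet.iUnion fun n => measurableSet_eq_fun (by fun_prop) (by fun_prop)
  have h := lintegral_pathLaw θ p ((measurable_one (α := ℝ≥0∞)).indicator hm)
  have h1 : hitProb θ p k = ∫⁻ ω, {q : (ℝ × Bool) × (ℕ → ℝ × Bool) |
      ∃ n, position q.2 n = k - step q.1.2}.indicator 1 (ω 0, tail ω) ∂pathLaw θ p := by
    rw [hitProb, ← lintegral_indicator_one (measurableSet_exists_position k)]
    refine lintegral_congr fun ω => ?_
    classical
    simp only [indicator, mem_ofPred_eq, exists_position_iff hk]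
    congr
  rw [h1, h]
  have h2 : ∀ c : ℝ × Bool, ∫⁻ ω, {q : (ℝ × Bool) × (ℕ → ℝ × Bool) |
      ∃ n, position q.2 n = k - step q.1.2}.indicator 1 (c, ω) ∂pathLaw θ p =
      hitProb θ p (k - step c.2) := by
    intro c
    rw [hitProb, ← lintegral_indicator_one (measurableSet_exists_position _)]
    rfl
  simp_rw [h2]
  rw [lintegral_stepLaw_snd hθ fun b => hitProb θ p (k - step b)]
  simp [step]

/-- The mean time to reach `k`. -/
noncomputable def meanHit (θ p : ℝ) (k : ℤ) : ℝ≥0∞ := ∫⁻ ω, hitTime k ω ∂pathLaw θ p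

theorem meanHit_zero : meanHit θ p 0 = 0 := by simp [meanHit, hitTime_zero]

include hθ in
theorem meanHit_eq {k : ℤ} (hk : k ≠ 0) : meanHit θ p k = (ENNReal.ofReal θ)⁻¹ +
    (ENNReal.ofReal p * meanHit θ p (k - 1) + ENNReal.ofReal (1 - p) * meanHit θ p (k + 1)) := by
  have hm : Measurable fun q : (ℝ × Bool) × (ℕ → ℝ × Bool) => hitTime (k - step q.1.2) q.2 := by
    have h : Measurable fun q : Bool × (ℕ → ℝ × Bool) => hitTime (k - step q.1) q.2 :=
      measurable_from_prod_countable_right fun b => measurable_hitTime (k - step b)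
    have hg : Measurable fun q : (ℝ × Bool) × (ℕ → ℝ × Bool) => (q.1.2, q.2) := by fun_prop
    have hc := h.comp hg
    simp only [Function.comp_def] at hc
    exact hc
  have hm1 : Measurable fun q : (ℝ × Bool) × (ℕ → ℝ × Bool) => ENNReal.ofReal q.1.1 := by fun_prop
  have hm2 : Measurable fun q : (ℝ × Bool) × (ℕ → ℝ × Bool) => ENNReal.ofReal q.1.1 +
    hitTime (k - step q.1.2) q.2 := hm1.add hm
  have h := lintegral_pathLaw θ p hm2
  have h1 : ∀ c : ℝ × Bool, ∫⁻ ω, (ENNReal.ofReal c.1 + hitTime (k - step c.2) ω) ∂pathLaw θ p =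
      ENNReal.ofReal c.1 + meanHit θ p (k - step c.2) := by
    intro c
    rw [lintegral_add_left measurable_const, lintegral_const, measure_univ, mul_one]
    rfl
  rw [meanHit]
  simp_rw [hitTime_eq_add hk]
  rw [h]
  simp only
  simp_rw [h1]
  rw [lintegral_add_left (by fun_prop), lintegral_stepLaw_fst hθ,
    lintegral_stepLaw_snd hθ fun b => meanHit θ p (k - step b)]
  simp [step]

end Recursion

/-- The increments are multiplied by `p / (1 - p) ≥ 1` at each step. A negative first increment
would make `U` fall at least linearly, below zero, and a positive one is excluded by `U ≤ 1`. -/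
theorem eq_one_of_harmonic {U : ℕ → ℝ} {p : ℝ} (hp : 1 / 2 ≤ p) (hp1 : p < 1) (h0 : U 0 = 1)
    (hU0 : ∀ k, 0 ≤ U k) (hU1 : ∀ k, U k ≤ 1)
    (hrec : ∀ k, U (k + 1) = p * U k + (1 - p) * U (k + 2)) (k : ℕ) : U k = 1 := by
  have hd : ∀ k, (1 - p) * (U (k + 2) - U (k + 1)) = p * (U (k + 1) - U k) := fun k => by
    linarith [hrec k]
  have hd0 : U 1 - U 0 ≤ 0 := by linarith [hU1 1]
  have hdk : ∀ k, U (k + 1) - U k ≤ U 1 - U 0 := by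
    intro k
    induction k with
    | zero => exact le_rfl
    | succ k ih =>
      have h := hd k
      have h1 : (1 - p) * (U (k + 2) - U (k + 1)) ≤ (1 - p) * (U (k + 1) - U k) := by
        rw [h]
        nlinarith
      exact (le_of_mul_le_mul_left h1 (by linarith)).trans ih
  have hlin : ∀ k : ℕ, U k ≤ 1 + k * (U 1 - U 0) := by
    intro k
    induction k with
    | zero => simp [h0]
    | succ k ih =>
      push_cast
      linarith [hdk k]
  have hzero : U 1 - U 0 = 0 := by
    by_contra hne
    have hlt : U 1 - U 0 < 0 := lt_of_le_of_ne hd0 hne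
    obtain ⟨n, hn⟩ := exists_nat_gt (1 / -(U 1 - U 0))
    rw [div_lt_iff₀ (by linarith)] at hn
    linarith [hlin n, hU0 n]
  have hall : ∀ k, U (k + 1) - U k = 0 := by
    intro k
    induction k with
    | zero => exact hzero
    | succ k ih =>
      have h := hd k
      rw [ih, mul_zero] at h
      exact (mul_eq_zero.1 h).resolve_left (by linarith)
  induction k with
  | zero => exact h0
  | succ k ih => linarith [hall k]

/-- A walk without drift to the left reaches every site on the right. -/
theorem ae_exists_position {θ p : ℝ} [IsProbabilityMeasure (stepLaw θ p)] (hθ : 0 < θ)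
    (hp : 1 / 2 ≤ p) (hp1 : p < 1) (k : ℕ) :
    ∀ᵐ ω ∂pathLaw θ p, ∃ n, position ω n = k := by
  have h := eq_one_of_harmonic (U := fun k : ℕ => (hitProb θ p k).toReal) hp hp1 ?_
    (fun _ => ENNReal.toReal_nonneg) (fun k => ?_) (fun k => ?_) k
  · have h1 : hitProb θ p k = 1 := by
      rw [← ENNReal.toReal_eq_one_iff]
      exact h
    rw [ae_iff]
    have h2 := prob_compl_eq_zero_iff (μ := pathLaw θ p) (measurableSet_exists_position (k : ℤ))
    exact h2.2 h1
  · have : {ω | ∃ n, position ω n = ((0 : ℕ) : ℤ)} = univ :=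
      eq_univ_of_forall fun ω => ⟨0, by simp [position_zero]⟩
    simp only [hitProb]
    rw [this]
    simp
  · exact ENNReal.toReal_mono ENNReal.one_ne_top prob_le_one
  · have hfin : ∀ k, hitProb θ p k ≠ ⊤ := fun k => measure_ne_top _ _
    have h3 := congrArg ENNReal.toReal
      (hitProb_eq (p := p) hθ (by omega : ((k + 1 : ℕ) : ℤ) ≠ 0))
    rw [ENNReal.toReal_add (ENNReal.mul_ne_top ENNReal.ofReal_ne_top (hfin _))
      (ENNReal.mul_ne_top ENNReal.ofReal_ne_top (hfin _)), ENNReal.toReal_mul, ENNReal.toReal_mul,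
      ENNReal.toReal_ofReal (by linarith), ENNReal.toReal_ofReal (by linarith)] at h3
    have e1 : ((k + 1 : ℕ) : ℤ) - 1 = k := by push_cast; ring
    have e2 : ((k + 1 : ℕ) : ℤ) + 1 = (k + 2 : ℕ) := by push_cast; ring
    rw [e1, e2] at h3
    exact h3

/-- The time spent on the way to `k` during the first `n` steps. -/
noncomputable def truncatedHitTime : ℕ → ℤ → (ℕ → ℝ × Bool) → ℝ≥0∞
  | 0, _, _ => 0
  | n + 1, k, ω => if k = 0 then 0 else
      ENNReal.ofReal (ω 0).1 + truncatedHitTime n (k - step (ω 0).2) (tail ω)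

theorem measurable_truncatedHitTime (n : ℕ) (k : ℤ) : Measurable (truncatedHitTime n k) := by
  induction n generalizing k with
  | zero => exact measurable_const
  | succ n ih =>
    by_cases hk : k = 0
    · simp only [truncatedHitTime, hk, if_true]
      exact measurable_const
    · simp only [truncatedHitTime, hk, if_false]
      have h : Measurable fun q : Bool × (ℕ → ℝ × Bool) =>
          truncatedHitTime n (k - step q.1) q.2 :=
        measurable_from_prod_countable_right fun b => ih (k - step b)
      have hg : Measurable fun ω : ℕ → ℝ × Bool => ((ω 0).2, tail ω) := by
        unfold tail; fun_prop
      have h1 : Measurable fun ω : ℕ → ℝ × Bool => ENNReal.ofReal (ω 0).1 := by fun_prop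
      exact h1.add (h.comp hg)

theorem hitTime_le_truncatedHitTime {k : ℤ} {n N : ℕ} (hn : N ≤ n) {ω : ℕ → ℝ × Bool}
    (h : position ω N = k) : hitTime k ω ≤ truncatedHitTime n k ω := by
  induction n generalizing k N ω with
  | zero =>
    obtain rfl : N = 0 := by omega
    rw [position_zero] at h
    rw [← h, hitTime_zero]
    exact bot_le
  | succ n ih =>
    by_cases hk : k = 0
    · rw [hk, hitTime_zero]
      exact bot_le
    · cases N with
      | zero => exact absurd ((position_zero ω).symm.trans h).symm hk
      | succ N =>
        rw [hitTime_eq_add hk, truncatedHitTime, if_neg hk]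
        rw [position_succ] at h
        exact add_le_add_right (ih (by omega : N ≤ n) (by omega)) _

/-- The linear function `k / (θ (2p - 1))` solves the first-step equation exactly for `k > 0`;
truncation provides the start of an induction without knowing that the mean is finite. -/
theorem lintegral_truncatedHitTime_le {θ p : ℝ} [IsProbabilityMeasure (stepLaw θ p)] (hθ : 0 < θ)
    (hp : 1 / 2 < p) (hp1 : p < 1) (n k : ℕ) :
    ∫⁻ ω, truncatedHitTime n k ω ∂pathLaw θ p ≤ ENNReal.ofReal (k / (θ * (2 * p - 1))) := by
  have hd : 0 < θ * (2 * p - 1) := mul_pos hθ (by linarith)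
  induction n generalizing k with
  | zero => simp [truncatedHitTime]
  | succ n ih =>
    cases k with
    | zero => simp [truncatedHitTime]
    | succ k =>
      have hk : ((k + 1 : ℕ) : ℤ) ≠ 0 := by omega
      simp only [truncatedHitTime, hk, if_false]
      have hm : Measurable fun q : (ℝ × Bool) × (ℕ → ℝ × Bool) =>
          truncatedHitTime n ((k + 1 : ℕ) - step q.1.2) q.2 := by
        have h : Measurable fun q : Bool × (ℕ → ℝ × Bool) =>
            truncatedHitTime n ((k + 1 : ℕ) - step q.1) q.2 :=
          measurable_from_prod_countable_right fun b =>
            measurable_truncatedHitTime n ((k + 1 : ℕ) - step b)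
        have hg : Measurable fun q : (ℝ × Bool) × (ℕ → ℝ × Bool) => (q.1.2, q.2) := by fun_prop
        exact h.comp hg
      have hm1 : Measurable fun q : (ℝ × Bool) × (ℕ → ℝ × Bool) => ENNReal.ofReal q.1.1 := by
        fun_prop
      have hm2 : Measurable fun q : (ℝ × Bool) × (ℕ → ℝ × Bool) => ENNReal.ofReal q.1.1 +
        truncatedHitTime n ((k + 1 : ℕ) - step q.1.2) q.2 := hm1.add hm
      rw [lintegral_pathLaw θ p hm2]
      have h1 : ∀ c : ℝ × Bool, ∫⁻ ω, (ENNReal.ofReal c.1 +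
          truncatedHitTime n ((k + 1 : ℕ) - step c.2) ω) ∂pathLaw θ p = ENNReal.ofReal c.1 +
          ∫⁻ ω, truncatedHitTime n ((k + 1 : ℕ) - step c.2) ω ∂pathLaw θ p := by
        intro c
        rw [lintegral_add_left measurable_const, lintegral_const, measure_univ, mul_one]
      simp only
      simp_rw [h1]
      rw [lintegral_add_left (by fun_prop), lintegral_stepLaw_fst hθ, lintegral_stepLaw_snd hθ
        fun b => ∫⁻ ω, truncatedHitTime n ((k + 1 : ℕ) - step b) ω ∂pathLaw θ p]
      have e1 : ((k + 1 : ℕ) : ℤ) - step true = k := by simp [step]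
      have e2 : ((k + 1 : ℕ) : ℤ) - step false = (k + 2 : ℕ) := by simp [step]; ring
      rw [e1, e2]
      have hc : ∀ j : ℕ, 0 ≤ (j : ℝ) / (θ * (2 * p - 1)) := fun j => by positivity
      refine (add_le_add_right (add_le_add (mul_le_mul_right (ih k) _)
        (mul_le_mul_right (ih (k + 2)) _)) _).trans ?_
      rw [← ENNReal.ofReal_inv_of_pos hθ, ← ENNReal.ofReal_mul (by linarith),
        ← ENNReal.ofReal_mul (by linarith), ← ENNReal.ofReal_add, ← ENNReal.ofReal_add]
      · refine ENNReal.ofReal_le_ofReal (le_of_eq ?_)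
        have h3 : 2 * p - 1 ≠ 0 := by linarith
        push_cast
        have h4 : θ⁻¹ = (2 * p - 1) / (θ * (2 * p - 1)) := by
          field_simp
        rw [h4, mul_div_assoc', mul_div_assoc', ← add_div, ← add_div]
        ring
      · positivity
      · exact add_nonneg (mul_nonneg (by linarith) (hc k))
          (mul_nonneg (by linarith) (hc (k + 2)))
      · exact mul_nonneg (by linarith) (hc k)
      · exact mul_nonneg (by linarith) (hc (k + 2))

/-- Fatou's lemma: once `n` exceeds a time at which the path is at `k`, the truncated time dominates
the hitting time. -/
theorem meanHit_le {θ p : ℝ} [IsProbabilityMeasure (stepLaw θ p)] (hθ : 0 < θ)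
    (hp : 1 / 2 < p) (hp1 : p < 1) (k : ℕ) :
    meanHit θ p k ≤ ENNReal.ofReal (k / (θ * (2 * p - 1))) := by
  have h : meanHit θ p k ≤
      ∫⁻ ω, liminf (fun n => truncatedHitTime n k ω) atTop ∂pathLaw θ p := by
    refine lintegral_mono_ae ?_
    filter_upwards [ae_exists_position hθ hp.le hp1 k] with ω ⟨N, hN⟩
    refine le_liminf_of_le (by isBoundedDefault) ?_
    filter_upwards [eventually_ge_atTop N] with n hn
    exact hitTime_le_truncatedHitTime hn hN
  refine h.trans ((lintegral_liminf_le fun n => measurable_truncatedHitTime n k).trans ?_)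
  refine liminf_le_of_le (by isBoundedDefault) fun b hb => ?_
  obtain ⟨n, hn⟩ := hb.exists
  exact hn.trans (lintegral_truncatedHitTime_le hθ hp hp1 n k)

theorem meanHit_toReal_rec {θ p : ℝ} [IsProbabilityMeasure (stepLaw θ p)] (hθ : 0 < θ)
    (hp : 0 ≤ p) (hp1 : p ≤ 1) (hfin : ∀ k : ℕ, meanHit θ p k ≠ ⊤) (k : ℕ) :
    (meanHit θ p (k + 1 : ℕ)).toReal = θ⁻¹ + (p * (meanHit θ p k).toReal +
      (1 - p) * (meanHit θ p (k + 2 : ℕ)).toReal) := by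
  have h := meanHit_eq (p := p) hθ (by omega : ((k + 1 : ℕ) : ℤ) ≠ 0)
  have e1 : ((k + 1 : ℕ) : ℤ) - 1 = k := by push_cast; ring
  have e2 : ((k + 1 : ℕ) : ℤ) + 1 = (k + 2 : ℕ) := by push_cast; ring
  have hn1 := ENNReal.mul_ne_top (ENNReal.ofReal_ne_top (r := p)) (hfin k)
  have hn2 := ENNReal.mul_ne_top (ENNReal.ofReal_ne_top (r := 1 - p)) (hfin (k + 2))
  rw [e1, e2] at h
  rw [h, ENNReal.toReal_add _ (ENNReal.add_ne_top.2 ⟨hn1, hn2⟩), ENNReal.toReal_add hn1 hn2,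
    ENNReal.toReal_mul, ENNReal.toReal_mul, ENNReal.toReal_inv, ENNReal.toReal_ofReal hp,
    ENNReal.toReal_ofReal (by linarith : (0 : ℝ) ≤ 1 - p), ENNReal.toReal_ofReal hθ.le]
  exact ENNReal.inv_ne_top.2 (ENNReal.ofReal_pos.2 hθ).ne'

/-- Solutions of the recursion that vanish at zero are linear up to a geometrically growing term.
The upper bound `meanHit_le` excludes one sign of that term, nonnegativity of the mean the other. -/
theorem meanHit_one_of_drift {θ p : ℝ} [IsProbabilityMeasure (stepLaw θ p)] (hθ : 0 < θ)
    (hp : 1 / 2 < p) (hp1 : p < 1) :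
    meanHit θ p 1 = (ENNReal.ofReal (θ * (2 * p - 1)))⁻¹ := by
  have hd : 0 < θ * (2 * p - 1) := mul_pos hθ (by linarith)
  have hfin : ∀ k : ℕ, meanHit θ p k ≠ ⊤ := fun k =>
    ((meanHit_le hθ hp hp1 k).trans_lt ENNReal.ofReal_lt_top).ne
  set c := 1 / (θ * (2 * p - 1)) with hc
  have hc0 : 0 < c := by positivity
  set M : ℕ → ℝ := fun k => (meanHit θ p k).toReal with hM
  have hM0 : M 0 = 0 := by simp [hM, meanHit_zero]
  have hMnonneg : ∀ k, 0 ≤ M k := fun k => ENNReal.toReal_nonneg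
  have hrec : ∀ k, M (k + 1) = θ⁻¹ + (p * M k + (1 - p) * M (k + 2)) :=
    meanHit_toReal_rec hθ (by linarith) hp1.le hfin
  have hle : ∀ k : ℕ, M k ≤ c * k := by
    intro k
    have h := ENNReal.toReal_mono ENNReal.ofReal_ne_top (meanHit_le hθ hp hp1 k)
    rw [ENNReal.toReal_ofReal (by positivity)] at h
    refine h.trans_eq ?_
    rw [hc]; ring
  have hcθ : c * (2 * p - 1) = θ⁻¹ := by
    have h3 : 2 * p - 1 ≠ 0 := by linarith
    rw [hc]; field_simp
  -- the gap to the linear solution has geometrically growing increments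
  set D : ℕ → ℝ := fun k => c * k - M k with hD
  have hDrec : ∀ k, (1 - p) * (D (k + 2) - D (k + 1)) = p * (D (k + 1) - D k) := by
    intro k
    simp only [hD]
    push_cast
    linarith [hrec k]
  have hr : 1 < p / (1 - p) := by rw [lt_div_iff₀ (by linarith)]; linarith
  have hDinc : ∀ k, D (k + 1) - D k = (p / (1 - p)) ^ k * D 1 := by
    intro k
    induction k with
    | zero => simp [hD, hM0]
    | succ k ih =>
      have h := hDrec k
      rw [ih] at h
      rw [pow_succ]
      have h3 : 1 - p ≠ 0 := by linarith
      field_simp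
      field_simp at h
      linarith
  have hD1 : 0 ≤ D 1 := by have := hle 1; simp only [hD]; linarith
  have hD0 : D 1 = 0 := by
    by_contra hne
    have hpos : 0 < D 1 := lt_of_le_of_ne hD1 (Ne.symm hne)
    have hub : ∀ k : ℕ, (p / (1 - p)) ^ k * D 1 ≤ c * (k + 1) := by
      intro k
      have h1 := hDinc k
      have h2 := hMnonneg (k + 1)
      have h3 := hle k
      have h4 : D (k + 1) = c * (k + 1) - M (k + 1) := by simp only [hD]; push_cast; ring
      have h5 : 0 ≤ D k := by simp only [hD]; linarith
      linarith
    have ht := tendsto_pow_const_div_const_pow_of_one_lt 1 hr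
    have ht0 := tendsto_pow_const_div_const_pow_of_one_lt 0 hr
    have ht1 := (ht.add ht0).const_mul c
    rw [add_zero, mul_zero] at ht1
    obtain ⟨n, hn⟩ := (ht1.eventually_lt_const hpos).exists
    simp only [pow_one, pow_zero] at hn
    rw [← add_div, mul_div_assoc', div_lt_iff₀ (by positivity)] at hn
    linarith [hub n, mul_comm (D 1) ((p / (1 - p)) ^ n)]
  have hM1 : M 1 = c := by
    simp only [hD] at hD0
    push_cast at hD0
    linarith
  rw [← ENNReal.ofReal_inv_of_pos hd, ← one_div, ← hc, ← hM1, hM,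
    ENNReal.ofReal_toReal (hfin 1)]
  rfl

/-- If the mean were finite for the first site, the recursion would make it finite for all. Its
second differences would equal `-2/θ`, and such a sequence becomes negative. -/
theorem meanHit_one_of_fair {θ : ℝ} [IsProbabilityMeasure (stepLaw θ (1 / 2))] (hθ : 0 < θ) :
    meanHit θ (1 / 2) 1 = ⊤ := by
  by_contra hne
  have hfin : ∀ k : ℕ, meanHit θ (1 / 2) k ≠ ⊤ ∧ meanHit θ (1 / 2) (k + 1 : ℕ) ≠ ⊤ := by
    intro k
    induction k with
    | zero => exact ⟨by rw [Nat.cast_zero, meanHit_zero]; exact ENNReal.zero_ne_top, hne⟩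
    | succ k ih =>
      refine ⟨ih.2, fun htop => ih.2 ?_⟩
      rw [meanHit_eq hθ (by omega : ((k + 1 : ℕ) : ℤ) ≠ 0)]
      have e2 : ((k + 1 : ℕ) : ℤ) + 1 = (k + 1 + 1 : ℕ) := by push_cast; ring
      rw [e2, htop, ENNReal.mul_top (by norm_num), add_top, add_top]
  have hrec := meanHit_toReal_rec hθ (by norm_num) (by norm_num) fun k => (hfin k).1
  set M : ℕ → ℝ := fun k => (meanHit θ (1 / 2) k).toReal with hM
  have hMnonneg : ∀ k, 0 ≤ M k := fun k => ENNReal.toReal_nonneg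
  have hinc : ∀ k : ℕ, M (k + 1) - M k = M 1 - M 0 - 2 * θ⁻¹ * k := by
    intro k
    induction k with
    | zero => simp
    | succ k ih =>
      have h : M (k + 1) = θ⁻¹ + (1 / 2 * M k + (1 - 1 / 2) * M (k + 2)) := hrec k
      push_cast
      linarith
  have hpos : 0 < θ⁻¹ := inv_pos.2 hθ
  -- From `K` on, every increment is below `-1`.
  obtain ⟨K, hK⟩ := exists_nat_gt ((M 1 - M 0 + 1) / (2 * θ⁻¹))
  rw [div_lt_iff₀ (by positivity)] at hK
  have hdec : ∀ j : ℕ, M (K + j) ≤ M K - j := by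
    intro j
    induction j with
    | zero => simp
    | succ j ih =>
      have h := hinc (K + j)
      have h2 : (0 : ℝ) ≤ 2 * θ⁻¹ * j := by positivity
      rw [← add_assoc]
      push_cast at h ⊢
      nlinarith
  obtain ⟨j, hj⟩ := exists_nat_gt (M K)
  linarith [hdec j, hMnonneg (K + j)]

/-! ### The walk and its hitting times in terms of the jump chain -/

theorem jumpTime_strictMono (ω : WalkSpace) : StrictMono (jumpTime ω.1) :=
  strictMono_nat_of_lt_succ fun n => by
    rw [jumpTime, jumpTime, Finset.sum_range_succ]
    linarith [ω.2.1 n]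

theorem jumpTime_nonneg (ω : WalkSpace) (n : ℕ) : 0 ≤ jumpTime ω.1 n :=
  (jumpTime_zero ω.1).symm.trans_le ((jumpTime_strictMono ω).monotone n.zero_le)

theorem exists_jumpTime_le_lt (ω : WalkSpace) {t : ℝ} (ht : 0 ≤ t) :
    ∃ n, jumpTime ω.1 n ≤ t ∧ t < jumpTime ω.1 (n + 1) := by
  classical
  have h : ∃ n, t < jumpTime ω.1 n := (ω.2.2.eventually_gt_atTop t).exists
  obtain ⟨m, hm⟩ : ∃ m, Nat.find h = m + 1 := by
    refine Nat.exists_eq_succ_of_ne_zero fun h0 => ?_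
    have h1 := Nat.find_spec h
    rw [h0, jumpTime_zero] at h1
    exact absurd h1 (not_lt.2 ht)
  exact ⟨m, not_lt.1 (Nat.find_min h (by omega)), hm ▸ Nat.find_spec h⟩

theorem jumpCount_eq {ω : WalkSpace} {t : ℝ} {n : ℕ} (h1 : jumpTime ω.1 n ≤ t)
    (h2 : t < jumpTime ω.1 (n + 1)) : jumpCount ω t = n := by
  have h : {m : ℕ | ∑ i ∈ Finset.range (m + 1), (ω.1 i).1 ≤ t} = (Finset.range n : Set ℕ) := by
    ext m
    simp only [mem_ofPred_eq, Finset.coe_range, mem_Iio]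
    refine ⟨fun hm => ?_, fun hm => ?_⟩
    · by_contra hlt
      exact absurd (h2.trans_le ((jumpTime_strictMono ω).monotone (by omega : n + 1 ≤ m + 1)))
        (not_lt.2 hm)
    · exact ((jumpTime_strictMono ω).monotone (by omega : m + 1 ≤ n)).trans h1
  rw [jumpCount, h, ncard_coe_finset, Finset.card_range]

theorem walk_eq (x : ℤ) {ω : WalkSpace} {t : ℝ} {n : ℕ} (h1 : jumpTime ω.1 n ≤ t)
    (h2 : t < jumpTime ω.1 (n + 1)) : walk x ω t = x + position ω.1 n := by
  rw [walk, jumpCount_eq h1 h2]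
  rfl

theorem walk_jumpTime (x : ℤ) (ω : WalkSpace) (n : ℕ) :
    walk x ω (jumpTime ω.1 n) = x + position ω.1 n :=
  walk_eq x le_rfl (jumpTime_strictMono ω n.lt_succ_self)

theorem sum_ofReal_eq (ω : WalkSpace) (n : ℕ) :
    ∑ i ∈ Finset.range n, ENNReal.ofReal (ω.1 i).1 = ENNReal.ofReal (jumpTime ω.1 n) :=
  (ENNReal.ofReal_sum_of_nonneg fun i _ => (ω.2.1 i).le).symm

/-- The walk is constant between jumps, so any visit to `y` is preceded by a jump time (or time
zero) at which it is already there. -/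
theorem hit_eq_hitTime (x y : ℤ) (ω : WalkSpace) : hit x y ω = hitTime (y - x) ω.1 := by
  refine le_antisymm (le_iInf₂ fun n hn => ?_) (le_iInf₂ fun t ht => ?_)
  · rw [sum_ofReal_eq]
    refine iInf₂_le (Real.toNNReal (jumpTime ω.1 n)) ?_
    rw [Real.coe_toNNReal _ (jumpTime_nonneg ω n), walk_jumpTime]
    omega
  · obtain ⟨n, h1, h2⟩ := exists_jumpTime_le_lt ω t.2
    have ht' : x + position ω.1 n = y := (walk_eq x h1 h2).symm.trans ht
    refine (iInf₂_le n (by omega)).trans ?_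
    rw [sum_ofReal_eq]
    exact ENNReal.ofReal_le_of_le_toReal h1

theorem HitsAt.hit_eq {x y : ℤ} {n : ℕ} {ω : WalkSpace} (h : HitsAt (y - x) n ω.1) :
    hit x y ω = ENNReal.ofReal (jumpTime ω.1 n) := by
  rw [hit_eq_hitTime, h.hitTime_eq, sum_ofReal_eq]

theorem HitsAt.weight_eq {x y : ℤ} {n : ℕ} {ω : WalkSpace} (h : HitsAt (y - x) n ω.1)
    (γ η : ℝ) : weight x y (fun _ => γ) η ω =
      ENNReal.ofReal (Real.exp ((γ + η) * jumpTime ω.1 n)) := by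
  rw [weight, h.hit_eq, ENNReal.toReal_ofReal (jumpTime_nonneg ω n),
    intervalIntegral.integral_const, sub_zero, smul_eq_mul, mul_comm]

/-- The position at time `t` of the walk stopped when it reaches `y`. -/
noncomputable def stoppedWalk (x y : ℤ) (t : ℝ≥0) (ω : WalkSpace) : ℤ :=
  walk x ω (min (t : ℝ≥0∞) (hit x y ω)).toReal

theorem HitsAt.stoppedWalk_eq {x y : ℤ} {n : ℕ} {ω : WalkSpace} (h : HitsAt (y - x) n ω.1)
    (t : ℝ≥0) : stoppedWalk x y t ω = walk x ω (min (t : ℝ) (jumpTime ω.1 n)) := by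
  rw [stoppedWalk, h.hit_eq, ENNReal.toReal_min ENNReal.coe_ne_top ENNReal.ofReal_ne_top,
    ENNReal.toReal_ofReal (jumpTime_nonneg ω n), ENNReal.coe_toReal]

theorem HitsAt.stoppedWalk_congr {x y : ℤ} {n : ℕ} {ω ω' : WalkSpace}
    (h : HitsAt (y - x) n ω.1) (hω : ∀ i < n, ω.1 i = ω'.1 i) (t : ℝ≥0) :
    stoppedWalk x y t ω = stoppedWalk x y t ω' := by
  rw [h.stoppedWalk_eq, (h.congr hω).stoppedWalk_eq, ← jumpTime_congr hω]
  have hs : 0 ≤ min (t : ℝ) (jumpTime ω.1 n) := le_min t.2 (jumpTime_nonneg ω n)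
  obtain ⟨m, h1, h2⟩ := exists_jumpTime_le_lt ω hs
  have hmn : m ≤ n := (jumpTime_strictMono ω).le_iff_le.1 (h1.trans (min_le_right _ _))
  have e1 : jumpTime ω'.1 m = jumpTime ω.1 m :=
    (jumpTime_congr fun i hi => hω i (hi.trans_le hmn)).symm
  have e2 : position ω'.1 m = position ω.1 m :=
    (position_congr fun i hi => hω i (hi.trans_le hmn)).symm
  rw [walk_eq x h1 h2, walk_eq x (e1.trans_le h1), e2]
  -- The paths may differ from step `n` on. If `m = n`, the stopped time is the `n`-th jump time,
  -- and only positivity of the next holding time of `ω'` matters.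
  rcases hmn.lt_or_eq with hlt | rfl
  · rw [← jumpTime_congr fun i hi => hω i (by omega)]
    exact h2
  · refine (min_le_right _ _).trans_lt ?_
    rw [← e1]
    exact jumpTime_strictMono ω' m.lt_succ_self

theorem exists_hitsAt_of_hit_ne_top {x y : ℤ} {ω : WalkSpace} (h : hit x y ω ≠ ⊤) :
    ∃ n, HitsAt (y - x) n ω.1 := by
  refine exists_hitsAt ?_
  by_contra! hne
  refine h ?_
  rw [hit_eq_hitTime, hitTime]
  simp [hne]

theorem stoppedWalk_eq_iff (x y : ℤ) (t : ℝ≥0) (ω : WalkSpace) :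
    stoppedWalk x y t ω = y ↔ hit x y ω ≤ t := by
  refine ⟨fun h => ?_, fun h => ?_⟩
  · have hne : min (t : ℝ≥0∞) (hit x y ω) ≠ ⊤ :=
      ((min_le_left _ _).trans_lt ENNReal.coe_lt_top).ne
    have h1 : hit x y ω ≤ ((min (t : ℝ≥0∞) (hit x y ω)).toNNReal : ℝ≥0∞) :=
      iInf₂_le (f := fun (s : ℝ≥0) (_ : walk x ω s = y) => (s : ℝ≥0∞)) _ h
    rw [ENNReal.coe_toNNReal hne] at h1
    exact h1.trans (min_le_left _ _)
  · obtain ⟨n, hn⟩ := exists_hitsAt_of_hit_ne_top (h.trans_lt ENNReal.coe_lt_top).ne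
    rw [hn.stoppedWalk_eq, min_eq_right, walk_jumpTime, hn.1]
    · ring
    · rw [hn.hit_eq] at h
      exact (ENNReal.ofReal_le_iff_le_toReal ENNReal.coe_ne_top).1 h

theorem measurable_coe_walkSpace : Measurable fun ω : WalkSpace => ω.1 := measurable_subtype_coe

theorem measurable_walk (x : ℤ) {s : WalkSpace → ℝ} (hs : Measurable s) (h0 : ∀ ω, 0 ≤ s ω) :
    Measurable fun ω => walk x ω (s ω) := by
  intro B _
  have hT : ∀ n, Measurable fun ω : WalkSpace => jumpTime ω.1 n := fun n =>
    (measurable_jumpTime n).comp measurable_coe_walkSpace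
  have hP : ∀ n, Measurable fun ω : WalkSpace => x + position ω.1 n := fun n =>
    ((measurable_position n).comp measurable_coe_walkSpace).const_add x
  have h : (fun ω => walk x ω (s ω)) ⁻¹' B = ⋃ n, {ω : WalkSpace | jumpTime ω.1 n ≤ s ω} ∩
      {ω : WalkSpace | s ω < jumpTime ω.1 (n + 1)} ∩
      (fun ω : WalkSpace => x + position ω.1 n) ⁻¹' B := by
    ext ω
    simp only [mem_preimage, mem_iUnion, mem_inter_iff, mem_ofPred_eq]
    constructor
    · intro hB
      obtain ⟨n, h1, h2⟩ := exists_jumpTime_le_lt ω (h0 ω)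
      rw [walk_eq x h1 h2] at hB
      exact ⟨n, ⟨h1, h2⟩, hB⟩
    · rintro ⟨n, ⟨h1, h2⟩, hB⟩
      rwa [walk_eq x h1 h2]
  rw [h]
  exact MeasurableSet.iUnion fun n => ((measurableSet_le (hT n) hs).inter
    (measurableSet_lt hs (hT (n + 1)))).inter (hP n (MeasurableSet.of_discrete))

theorem measurable_hit (x y : ℤ) : Measurable (hit x y) := by
  have h : hit x y = fun ω => hitTime (y - x) ω.1 := funext (hit_eq_hitTime x y)
  rw [h]
  exact (measurable_hitTime _).comp measurable_coe_walkSpace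

theorem stoppedSigma_le (x y : ℤ) : stoppedSigma x y ≤ instMeasurableSpaceWalkSpace := by
  refine iSup_le fun t => ?_
  refine Measurable.comap_le ?_
  exact measurable_walk x ((measurable_const.min (measurable_hit x y)).ennreal_toReal)
    fun ω => ENNReal.toReal_nonneg

/-- The tilted law is prescribed on this `σ`-algebra only, so its mean hitting time is determined
because the hitting time is measurable there. -/
theorem measurable_stoppedSigma_hit (x y : ℤ) : Measurable[stoppedSigma x y] (hit x y) := by
  let _ := stoppedSigma x y
  refine measurable_of_Iic fun c => ?_
  induction c with
  | top => simp
  | coe t =>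
    have h : hit x y ⁻¹' Iic (t : ℝ≥0∞) = stoppedWalk x y t ⁻¹' {y} := by
      ext ω
      exact (stoppedWalk_eq_iff x y t ω).symm
    rw [h]
    exact le_iSup (fun t : ℝ≥0 => MeasurableSpace.comap (stoppedWalk x y t) ⊤) t _
      ⟨{y}, trivial, rfl⟩

/-- Membership in an event of the stopped `σ`-algebra is decided by the steps up to the hitting
time. -/
theorem mem_iff_of_hitsAt {x y : ℤ} {A : Set WalkSpace} (hA : MeasurableSet[stoppedSigma x y] A)
    {n : ℕ} {ω ω' : WalkSpace} (h : HitsAt (y - x) n ω.1) (hω : ∀ i < n, ω.1 i = ω'.1 i) :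
    ω ∈ A ↔ ω' ∈ A := by
  -- The sets that do not separate `ω` from `ω'` form a `σ`-algebra; it contains the generators
  -- because the stopped walks agree.
  let m : MeasurableSpace WalkSpace :=
    { MeasurableSet' := fun A => ω ∈ A ↔ ω' ∈ A
      measurableSet_empty := Iff.rfl
      measurableSet_compl := fun _ hs => not_congr hs
      measurableSet_iUnion := fun f hf => by
        simp only [mem_iUnion]
        exact exists_congr hf }
  have hle : stoppedSigma x y ≤ m := by
    refine iSup_le fun t => ?_
    rintro _ ⟨B, _, rfl⟩
    change stoppedWalk x y t ω ∈ B ↔ stoppedWalk x y t ω' ∈ B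
    rw [h.stoppedWalk_congr hω]
  exact hle A hA

/-! ### The tilted law -/

theorem measurableSet_range_walkSpace : MeasurableSet (range fun ω : WalkSpace => ω.1) := by
  have h : (range fun ω : WalkSpace => ω.1) = (⋂ i : ℕ, {ω | 0 < (ω i).1}) ∩
      {ω | Tendsto (fun n => jumpTime ω n) atTop atTop} := by
    ext ω
    simp only [mem_range, mem_inter_iff, mem_iInter, mem_ofPred_eq]
    exact ⟨fun ⟨ω', h⟩ => h ▸ ω'.2, fun h => ⟨⟨ω, h⟩, rfl⟩⟩
  rw [h]
  refine MeasurableSet.inter (MeasurableSet.iInter fun i =>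
    measurableSet_lt measurable_const (by fun_prop)) ?_
  exact measurableSet_tendsto _ fun n => measurable_jumpTime n

theorem measurableEmbedding_coe_walkSpace : MeasurableEmbedding fun ω : WalkSpace => ω.1 :=
  ⟨Subtype.val_injective, measurable_coe_walkSpace, fun {s} hs => by
    obtain ⟨u, hu, rfl⟩ := hs
    have h : (fun ω : WalkSpace => ω.1) '' (Subtype.val ⁻¹' u) =
        (range fun ω : WalkSpace => ω.1) ∩ u := by
      rw [inter_comm]
      exact image_preimage_eq_inter_range
    exact (congrArg MeasurableSet h).mpr (measurableSet_range_walkSpace.inter hu)⟩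

/-- The law of the walk with rate `θ` that jumps upwards with probability `p`. -/
noncomputable def walkLaw (θ p : ℝ) : Measure WalkSpace :=
  Measure.comap (fun ω : WalkSpace => ω.1) (pathLaw θ p)

theorem walkMeasure_eq_walkLaw : walkMeasure = walkLaw 1 (1 / 2) := by
  rw [walkMeasure, fairCoin_eq_coin]
  rfl

section

variable {θ p : ℝ} [IsProbabilityMeasure (stepLaw θ p)]

theorem ae_mem_range_walkSpace (hθ : 0 < θ) :
    ∀ᵐ ω ∂pathLaw θ p, ω ∈ range fun ω : WalkSpace => ω.1 := by
  filter_upwards [ae_holdingTime_pos (θ := θ) (p := p), ae_tendsto_jumpTime hθ] with ω h1 h2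
  exact ⟨⟨ω, h1, h2⟩, rfl⟩

theorem map_walkLaw (hθ : 0 < θ) : (walkLaw θ p).map (fun ω : WalkSpace => ω.1) = pathLaw θ p := by
  rw [walkLaw, measurableEmbedding_coe_walkSpace.map_comap]
  exact Measure.restrict_eq_self_of_ae_mem (ae_mem_range_walkSpace hθ)

theorem lintegral_walkLaw (hθ : 0 < θ) (f : (ℕ → ℝ × Bool) → ℝ≥0∞) :
    ∫⁻ ω, f ω.1 ∂walkLaw θ p = ∫⁻ ω, f ω ∂pathLaw θ p := by
  rw [← map_walkLaw hθ, measurableEmbedding_coe_walkSpace.lintegral_map]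

theorem isProbabilityMeasure_walkLaw (hθ : 0 < θ) : IsProbabilityMeasure (walkLaw θ p) := by
  constructor
  have h := lintegral_walkLaw (p := p) hθ 1
  simpa using h

theorem ae_exists_hitsAt_walkLaw (hθ : 0 < θ) (hp : 1 / 2 ≤ p) (hp1 : p < 1) (k : ℕ) :
    ∀ᵐ ω ∂walkLaw θ p, ∃ n, HitsAt k n ω.1 := by
  have h := ae_exists_position (p := p) hθ hp hp1 k
  rw [← map_walkLaw hθ] at h
  filter_upwards [ae_of_ae_map measurable_coe_walkSpace.aemeasurable h] with ω hω
  exact exists_hitsAt hω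

theorem measurableSet_hitsAt_walkSpace (k : ℤ) (n : ℕ) :
    MeasurableSet {ω : WalkSpace | HitsAt k n ω.1} :=
  measurable_coe_walkSpace (measurableSet_hitsAt k n)

/-- The change of measure is available for a fixed number of steps, hence the partition by the
number of jumps at the hitting time. -/
theorem setLIntegral_eq_tsum_hitsAt {μ : Measure WalkSpace} {k : ℤ}
    (hμ : ∀ᵐ ω ∂μ, ∃ n, HitsAt k n ω.1) {A : Set WalkSpace} (hA : MeasurableSet A)
    (f : WalkSpace → ℝ≥0∞) :
    ∫⁻ ω in A, f ω ∂μ = ∑' n, ∫⁻ ω in A ∩ {ω | HitsAt k n ω.1}, f ω ∂μ := by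
  rw [← lintegral_iUnion (fun n => hA.inter (measurableSet_hitsAt_walkSpace k n))]
  · refine setLIntegral_congr ?_
    filter_upwards [hμ] with ω ⟨n, hn⟩
    refine propext ⟨fun h => mem_iUnion.2 ⟨n, h, hn⟩, fun h => ?_⟩
    obtain ⟨n, h, _⟩ := mem_iUnion.1 h
    exact h
  · intro m n hmn
    exact disjoint_left.2 fun ω h1 h2 => hmn (h1.2.unique h2.2)

end

/-- The path whose steps from the `n`-th on are replaced by unit steps upwards. -/
noncomputable def truncatePath (n : ℕ) (ω : ℕ → ℝ × Bool) : ℕ → ℝ × Bool :=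
  fun i => if i < n then ω i else (1, true)

theorem measurable_truncatePath (n : ℕ) : Measurable (truncatePath n) := by
  refine measurable_pi_lambda _ fun i => ?_
  by_cases hi : i < n
  · simp only [truncatePath, hi, if_true]
    exact measurable_pi_apply i
  · simp only [truncatePath, hi, if_false]
    exact measurable_const

/-- The truncation of a walk. -/
noncomputable def truncateWalk (n : ℕ) (ω : WalkSpace) : WalkSpace :=
  ⟨truncatePath n ω.1, fun i => by
    unfold truncatePath
    split_ifs
    · exact ω.2.1 i
    · exact one_pos, by
    have h : ∀ m : ℕ, (m : ℝ) - n ≤ ∑ i ∈ Finset.range m, (truncatePath n ω.1 i).1 := by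
      intro m
      induction m with
      | zero => simp
      | succ m ih =>
        rw [Finset.sum_range_succ]
        by_cases hm : m < n
        · have h1 : 0 ≤ ∑ i ∈ Finset.range m, (truncatePath n ω.1 i).1 :=
            Finset.sum_nonneg fun i _ => by
              unfold truncatePath
              split_ifs
              · exact (ω.2.1 i).le
              · exact zero_le_one
          have h2 : 0 < (truncatePath n ω.1 m).1 := by
            simp only [truncatePath, hm, if_true]
            exact ω.2.1 m
          have h3 : ((m + 1 : ℕ) : ℝ) ≤ n := by exact_mod_cast hm
          linarith
        · have h2 : (truncatePath n ω.1 m).1 = 1 := by simp [truncatePath, hm]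
          rw [h2]
          push_cast
          linarith
    exact tendsto_atTop_mono h
      (tendsto_atTop_add_const_right _ _ tendsto_natCast_atTop_atTop)⟩

section Tilt

variable {θ p φ : ℝ} [IsProbabilityMeasure (stepLaw θ p)]
  [IsProbabilityMeasure (stepLaw 1 (1 / 2))]

/-- On this event the jump time is the hitting time and the displacement is `y - x`, so the density
of the first `n` steps is the weight times a constant. -/
theorem walkLaw_inter_hitsAt (hθ : 0 < θ) (hφ : 0 < φ) (hp : p = 1 / (2 * θ * φ))
    (hq : 1 - p = φ / (2 * θ)) {γ η : ℝ} (hγ : γ + η = 1 - θ) {x y : ℤ} {A : Set WalkSpace}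
    (hA : MeasurableSet[stoppedSigma x y] A) (n : ℕ) :
    walkLaw θ p (A ∩ {ω | HitsAt (y - x) n ω.1}) = ENNReal.ofReal (φ ^ (-(y - x))) *
      ∫⁻ ω in A ∩ {ω | HitsAt (y - x) n ω.1}, weight x y (fun _ => γ) η ω ∂walkMeasure := by
  classical
  set B := A ∩ {ω | HitsAt (y - x) n ω.1} with hB
  have hBm : MeasurableSet B :=
    (stoppedSigma_le x y A hA).inter (measurableSet_hitsAt_walkSpace _ _)
  have hBm' := measurableEmbedding_coe_walkSpace.measurableSet_image.2 hBm
  -- Evaluating at the truncated path makes the indicator of `B` a function of the first `n`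
  -- coordinates on all sequences, not merely on `WalkSpace`.
  let f : (ℕ → ℝ × Bool) → ℝ≥0∞ := fun ω =>
    ((fun ω : WalkSpace => ω.1) '' B).indicator 1 (truncatePath n ω)
  have hf : Measurable f := (measurable_one.indicator hBm').comp (measurable_truncatePath n)
  have hdep : ∀ ω ω' : ℕ → ℝ × Bool, (∀ i < n, ω i = ω' i) → f ω = f ω' := by
    intro ω ω' h
    have : truncatePath n ω = truncatePath n ω' := by
      ext i : 1
      unfold truncatePath
      split_ifs with hi
      · exact h i hi
      · rfl
    simp only [f, this]
  have hagree : ∀ (ω : WalkSpace), ∀ i < n, ω.1 i = (truncateWalk n ω).1 i := by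
    intro ω i hi
    simp only [truncateWalk, truncatePath, hi, if_true]
  have hfB : ∀ ω : WalkSpace, f ω.1 = B.indicator 1 ω := by
    intro ω
    have h1 : ((fun ω : WalkSpace => ω.1) '' B).indicator (1 : (ℕ → ℝ × Bool) → ℝ≥0∞)
        (truncatePath n ω.1) = B.indicator (1 : WalkSpace → ℝ≥0∞) (truncateWalk n ω) :=
      indicator_image (g := fun ω : WalkSpace => ω.1) (f := (1 : (ℕ → ℝ × Bool) → ℝ≥0∞))
        (x := truncateWalk n ω) measurableEmbedding_coe_walkSpace.injective
    have h2 : truncateWalk n ω ∈ B ↔ ω ∈ B := by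
      constructor
      · rintro ⟨h3, h4⟩
        have h5 : HitsAt (y - x) n ω.1 := HitsAt.congr h4 fun i hi => (hagree ω i hi).symm
        exact ⟨(mem_iff_of_hitsAt hA h5 (hagree ω)).2 h3, h5⟩
      · rintro ⟨h3, h4⟩
        exact ⟨(mem_iff_of_hitsAt hA h4 (hagree ω)).1 h3, HitsAt.congr h4 (hagree ω)⟩
    simp only [f]
    rw [h1]
    simp only [indicator, h2, Pi.one_apply]
  rw [← lintegral_indicator_one hBm]
  simp_rw [← hfB]
  rw [lintegral_walkLaw hθ, lintegral_pathLaw_tilt hθ hφ hp hq n hf hdep,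
    ← lintegral_walkLaw one_pos, ← walkMeasure_eq_walkLaw, ← lintegral_indicator hBm,
    ← lintegral_const_mul' _ _ ENNReal.ofReal_ne_top]
  refine lintegral_congr fun ω => ?_
  rw [hfB]
  by_cases hω : ω ∈ B
  · have hh : HitsAt (y - x) n ω.1 := hω.2
    rw [indicator_of_mem hω, indicator_of_mem hω, hh.weight_eq, hh.1, Pi.one_apply, mul_one, hγ,
      mul_comm (Real.exp _), ENNReal.ofReal_mul (by positivity)]
  · rw [indicator_of_notMem hω, indicator_of_notMem hω, mul_zero, mul_zero]

/-- Both walks reach `y` almost surely, so summing over the number of jumps gives the density on the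
whole stopped `σ`-algebra. The event `univ` shows that the normalizing constant is `φ ^ (y - x)`. -/
theorem isTiltedLaw_walkLaw (hθ : 0 < θ) (hφ : 0 < φ) (hp : p = 1 / (2 * θ * φ))
    (hq : 1 - p = φ / (2 * θ)) (hp0 : 1 / 2 ≤ p) (hp1 : p < 1) {γ η : ℝ} (hγ : γ + η = 1 - θ)
    (x : ℤ) : IsTiltedLaw x (fun _ => γ) η (walkLaw θ p) := by
  intro y hxy
  obtain ⟨k, hk⟩ := Int.eq_ofNat_of_zero_le (sub_nonneg.2 hxy)
  have hQ : ∀ᵐ ω ∂walkLaw θ p, ∃ n, HitsAt (y - x) n ω.1 := by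
    rw [hk]
    exact ae_exists_hitsAt_walkLaw hθ hp0 hp1 k
  have hP : ∀ᵐ ω ∂walkMeasure, ∃ n, HitsAt (y - x) n ω.1 := by
    rw [hk, walkMeasure_eq_walkLaw]
    exact ae_exists_hitsAt_walkLaw one_pos le_rfl (by norm_num) k
  have key : ∀ A : Set WalkSpace, MeasurableSet[stoppedSigma x y] A → walkLaw θ p A =
      ENNReal.ofReal (φ ^ (-(y - x))) * ∫⁻ ω in A, weight x y (fun _ => γ) η ω ∂walkMeasure := by
    intro A hA
    have hAm := stoppedSigma_le x y A hA
    have h1 := setLIntegral_eq_tsum_hitsAt hQ hAm 1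
    simp only [Pi.one_apply, lintegral_const, one_mul, Measure.restrict_apply_univ] at h1
    rw [h1, setLIntegral_eq_tsum_hitsAt hP hAm, ← ENNReal.tsum_mul_left]
    exact tsum_congr fun n => walkLaw_inter_hitsAt hθ hφ hp hq hγ hA n
  have hZ : partitionFunction x y (fun _ => γ) η =
      ∫⁻ ω in univ, weight x y (fun _ => γ) η ω ∂walkMeasure := by
    rw [partitionFunction, Measure.restrict_univ]
  have h1 : ENNReal.ofReal (φ ^ (-(y - x))) * partitionFunction x y (fun _ => γ) η = 1 := by
    have := isProbabilityMeasure_walkLaw (p := p) hθ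
    rw [hZ, ← key univ MeasurableSet.univ, measure_univ]
  intro A hA
  rw [key A hA, ENNReal.eq_inv_of_mul_eq_one_left h1]

end Tilt

/-- The measure `tiltedLaw` is an arbitrary choice among the extensions; the mean hitting time does
not depend on it. -/
theorem lintegral_hit_eq_of_isTiltedLaw {x y : ℤ} (hxy : x ≤ y) {ζ : ℤ → ℝ} {η : ℝ}
    {Q Q' : Measure WalkSpace} (hQ : IsTiltedLaw x ζ η Q) (hQ' : IsTiltedLaw x ζ η Q') :
    ∫⁻ ω, hit x y ω ∂Q = ∫⁻ ω, hit x y ω ∂Q' := by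
  have h : Q.trim (stoppedSigma_le x y) = Q'.trim (stoppedSigma_le x y) := by
    refine @Measure.ext _ (stoppedSigma x y) _ _ fun A hA => ?_
    rw [trim_measurableSet_eq _ hA, trim_measurableSet_eq _ hA, hQ y hxy A hA, hQ' y hxy A hA]
  have h1 := lintegral_trim (μ := Q) (stoppedSigma_le x y) (measurable_stoppedSigma_hit x y)
  have h2 := lintegral_trim (μ := Q') (stoppedSigma_le x y) (measurable_stoppedSigma_hit x y)
  rw [← h1, ← h2, h]

/-- The speed of the tilted walk. -/
theorem tiltedSpeed_eq {γ η : ℝ} (hγ : γ ≤ 0) (hη : η ≤ 0) :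
    tiltedSpeed γ η = ENNReal.ofReal (Real.sqrt ((γ + η) * (γ + η - 2))) := by
  -- Matching one-step densities requires `θ p = 1/(2φ)` and `θ (1 - p) = φ/2`. These sum to `φ +
  -- 1/φ = 2θ`, and the smaller root is the one with `p ≥ 1/2`.
  set θ := 1 - (γ + η) with hθdef
  set s := Real.sqrt ((γ + η) * (γ + η - 2)) with hs
  set φ := θ - s with hφdef
  set p := (θ + s) / (2 * θ) with hpdef
  have hθ1 : 1 ≤ θ := by linarith
  have hθ : 0 < θ := by linarith
  have hs0 : 0 ≤ s := Real.sqrt_nonneg _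
  have hs2 : s ^ 2 = θ ^ 2 - 1 := by
    rw [hs, Real.sq_sqrt (mul_nonneg_of_nonpos_of_nonpos (by linarith) (by linarith))]
    ring
  have hsθ : s < θ := lt_of_pow_lt_pow_left₀ 2 hθ.le (by linarith)
  have hφ : 0 < φ := by linarith
  have hp : p = 1 / (2 * θ * φ) := by
    rw [hpdef, div_eq_div_iff (by positivity) (by positivity)]
    have h1 : (θ + s) * φ = 1 := by rw [hφdef]; linarith
    linear_combination 2 * θ * h1
  have hq : 1 - p = φ / (2 * θ) := by
    rw [hpdef, hφdef]
    field_simp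
    ring
  have hps : θ * (2 * p - 1) = s := by
    rw [hpdef]
    field_simp
    ring
  have hp0 : 1 / 2 ≤ p := by
    rw [hpdef, div_le_div_iff₀ (by norm_num) (by positivity)]
    linarith
  have hp1 : p < 1 := by
    rw [hpdef, div_lt_one (by positivity)]
    linarith
  have i1 := isProbabilityMeasure_stepLaw hθ (by linarith : 0 ≤ p) hp1.le
  have i2 := isProbabilityMeasure_stepLaw one_pos (by norm_num : (0 : ℝ) ≤ 1 / 2) (by norm_num)
  have hQ : IsTiltedLaw 0 (fun _ => γ) η (walkLaw θ p) :=
    isTiltedLaw_walkLaw hθ hφ hp hq hp0 hp1 (by rw [hθdef]; ring) 0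
  have hex : ∃ Q, IsTiltedLaw 0 (fun _ => γ) η Q := ⟨_, hQ⟩
  have htl : IsTiltedLaw 0 (fun _ => γ) η (tiltedLaw 0 (fun _ => γ) η) := by
    rw [tiltedLaw, dif_pos hex]
    exact hex.choose_spec
  have hmean : ∫⁻ ω, hit 0 1 ω ∂tiltedLaw 0 (fun _ => γ) η = meanHit θ p 1 := by
    rw [lintegral_hit_eq_of_isTiltedLaw zero_le_one htl hQ]
    simp_rw [hit_eq_hitTime]
    rw [lintegral_walkLaw hθ (hitTime (1 - 0)), sub_zero]
    rfl
  rw [tiltedSpeed, hmean]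
  -- The case `p = 1/2` is `γ + η = 0`: the mean hitting time is infinite and the speed is zero by
  -- `⊤⁻¹ = 0`.
  rcases hp0.lt_or_eq with hlt | heq
  · rw [meanHit_one_of_drift hθ hlt hp1, inv_inv, hps]
  · have hs00 : s = 0 := by rw [← hps, ← heq]; norm_num
    rw [← heq] at i1 ⊢
    rw [meanHit_one_of_fair hθ, hs00]
    simp

end BRWRE

/-! ### The two claims together, with the elementary inequalities -/

theorem lemma5p4 :
    (∀ γ η : ℝ, γ ≤ 0 → η ≤ 0 →
      BRWRE.tiltedSpeed γ η = ENNReal.ofReal (Real.sqrt ((γ + η) * (γ + η - 2)))) ∧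
    (∀ (Ω : Type*) [MeasurableSpace Ω] (P : Measure Ω) (ξ : ℤ → Ω → ℝ) (ei es : ℝ),
      BRWRE.IsEnvironment P ξ ei es →
        (∀ (lam : ℝ → ℝ) (vc : ℝ),
          BRWRE.IsLyapunovExponent P ξ lam → BRWRE.IsCriticalSpeed lam vc →
            vc ≤ Real.sqrt ((es - ei) * (2 + (es - ei)))) ∧
        Real.sqrt ((es - ei) * (2 + (es - ei))) < Real.sqrt (es * (2 + es)) ∧
        Real.sqrt (es * (2 + es)) < es + 1) := by
  refine ⟨fun γ η hγ hη => BRWRE.tiltedSpeed_eq hγ hη, fun Ω _ P ξ ei es henv =>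
    ⟨fun lam vc hlam hvc => BRWRE.critical_speed_le henv hlam hvc, ?_, ?_⟩⟩
  · have h1 := henv.ei_pos
    have h2 := henv.ei_lt_es
    exact Real.sqrt_lt_sqrt (mul_nonneg (by linarith) (by linarith))
      (mul_lt_mul'' (by linarith) (by linarith) (by linarith) (by linarith))
  · have h3 : 0 < es := henv.ei_pos.trans henv.ei_lt_es
    rw [Real.sqrt_lt' (by linarith)]
    nlinarith
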